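/- Let $T>0$, and let $A\in L^1((0,T);\mathbb R^{n\times n})$, $B\in L^\infty((0,T);\mathbb R^{n\times m})$, $M\in C^1([0,T]^2;\mathbb R^{m\times m})$ with symmetric positive definite values, $Q\in C^1([0,T]^2;\mathbb R^{n\times n})$ and $G\in C^1([0,T];\mathbb R^{n\times n})$ with symmetric positive semidefinite values, and $S\in C^1([0,T]^2;\mathbb R^{m\times n})$. Subscripts $t$ or $s$ on $M,Q,S$ denote the partial derivative in the first variable. Differential equations are understood in the Carathéodory (integral) sense. *Control problem.* For $(t,x)\in[0,T)\times\mathbb R^n$ and a control $u\in L^2$, the state solves $\dot X=AX+Bu$ on $[t,T]$, $X(t)=x$, and $$J(t,x;u)=\int_t^T\big[\langle Q(t,s)X(s),X(s)\rangle+2\langle S(t,s)X(s),u(s)\rangle+\langle M(t,s)u(s),u(s)\rangle\big]ds+\langle G(t)X(T),X(T)\rangle .$$ For a feedback law $\bar u:[0,T]\times\mathbb R^n\to\mathbb R^m$, $J(t,x;\bar u)$ is this cost along the closed-loop state, with $u(s)=\bar u(s,X(s))$. A measurable $\bar u$ such that $\bar u(\cdot,X(\cdot))\in L^2([0,T];\mathbb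 R^m)$ for every continuous $X$, and whose closed-loop equation is uniquely solvable from every $(t,x)\in[0,T)\times\mathbb R^n$, is an *equilibrium control* if for all $(t,x)\in[0,T)\times\mathbb R^n$ and $v\in\mathbb R^m$ $$\liminf_{\varepsilon\searrow0}\frac{J(t,x;u^{\varepsilon,v})-J(t,x;\bar u)}{\varepsilon}\ge0,$$ where $u^{\varepsilon,v}(s,y)=v$ for $s\in[t,t+\varepsilon]$ and $u^{\varepsilon,v}(s,y)=\bar u(s,y)$ for $s\in(t+\varepsilon,T]$. It is *linear* if $\bar u(t,x)=\tilde u(t)x$ for some $\tilde u:[0,T]\to\mathbb R^{m\times n}$ (the integrability requirement then says $\tilde u\in L^2$, and unique solvability is automatic). *Boundary value problem.* Write $M^{-1}(s,s)=M(s,s)^{-1}$ and $F(s)=A(s)-B(s)M^{-1}(s,s)S(s,s)$. For an integrable function $\hat Q$ on $[0,T]$ with symmetric $n\times n$ values, consider on $[t,T]$ $$\dot{\bar X}=F\bar X-B M^{-1}B^\top\varphi,\qquad \dot\varphi=-F^\top\varphi-[\hat Q-S^\top M^{-1}S]\bar X,\qquad \bar X(t)=x,\quad \varphi(T)=G(T)\bar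 X(T),\tag{1}$$ with $M,S$ evaluated at $(s,s)$, together with the requirement that for all $s\in[t,T]$ $$\begin{aligned}\langle\hat Q(s)\bar X(s),\bar X(s)\rangle={}&\langle Q(s,s)\bar X(s),\bar X(s)\rangle-\langle\dot G(s)\bar X(T),\bar X(T)\rangle-\int_s^T\langle Q_s(s,\tau)\bar X(\tau),\bar X(\tau)\rangle d\tau\\&-\int_s^T\langle M_s(s,\tau)w(\tau)-2S_s(s,\tau)\bar X(\tau),\,w(\tau)\rangle d\tau,\end{aligned}\tag{2}$$ where $w(\tau)=M^{-1}(\tau,\tau)\big(B^\top(\tau)\varphi(\tau)+S(\tau,\tau)\bar X(\tau)\big)$. *Riccati equation.* For continuous $P:[0,T]\to\mathbb R^{n\times n}$ let $\Upsilon(s)=M^{-1}(s,s)(B^\top(s)P(s)+S(s,s))$, let $\Phi$ be the state-transition matrix of $A-B\Upsilon$ (that is, $\partial_t\Phi(t,s)=(A(t)-B(t)\Upsilon(t))\Phi(t,s)$, $\Phi(s,s)=I$), and $$\begin{aligned}\bar Q(t)={}&Q(t,t)-\Phi^\top(T,t)\dot G(t)\Phi(T,t)-\int_t^T\Phi^\top(s,t)Q_t(t,s)\Phi(s,t)ds\\&-\int_t^T\Phi^\top(s,t)\big[\Upsilon^\top(s)M_t(t,s)\Upsilon(s)-\Upsilon^\top(s)S_t(t,s)-S_t^\top(t,s)\Upsilon(s)\big]\Phi(s,t)ds.\end{aligned}$$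 $P$ solves the equilibrium Riccati equation if for all $t\in[0,T]$ $$P(t)=G(T)+\int_t^T\Big(A^\top P+PA+\bar Q-[PB+S^\top]M^{-1}[B^\top P+S]\Big)(s)\,ds ,\tag{3}$$ with $M,S$ evaluated at $(s,s)$. **Theorem.** The following are equivalent. (i) A linear equilibrium control exists. (ii) There is an integrable symmetric-matrix-valued function $\hat Q$ on $[0,T]$ such that for every $(t,x)\in[0,T)\times\mathbb R^n$ the problem (1)–(2) has a solution $(\bar X,\varphi)\in C([t,T];\mathbb R^n)\times C([t,T];\mathbb R^n)$. (iii) The equilibrium Riccati equation (3) has a solution $P\in C([0,T];\mathbb R^{n\times n})$ with symmetric values. Moreover, for every such $P$, the feedback $\bar u(t,x)=-M^{-1}(t,t)\big(B^\top(t)P(t)+S(t,t)\big)x$ is a (linear) equilibrium control. -/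

import Mathlib

open scoped Matrix

noncomputable section

/-- The data of the linear-quadratic problem: horizon `T`, dynamics `A`, `B`, and the
two-parameter weights `M`, `Q`, `S` and terminal weight `G` of the cost. The first argument
of `M`, `Q`, `S` is the time of evaluation, the second one the running time. -/
structure LQProblem (n m : ℕ) where
  T : ℝ
  A : ℝ → Matrix (Fin n) (Fin n) ℝ
  B : ℝ → Matrix (Fin n) (Fin m) ℝ
  M : ℝ → ℝ → Matrix (Fin m) (Fin m) ℝ
  Q : ℝ → ℝ → Matrix (Fin n) (Fin n) ℝ
  S : ℝ → ℝ → Matrix (Fin m) (Fin n) ℝ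
  G : ℝ → Matrix (Fin n) (Fin n) ℝ

/-- Entrywise integral of a matrix-valued function over `a..b`. -/
def matIntegral {k l : ℕ} (F : ℝ → Matrix (Fin k) (Fin l) ℝ) (a b : ℝ) :
    Matrix (Fin k) (Fin l) ℝ :=
  Matrix.of fun i j => ∫ r in a..b, F r i j

namespace LQProblem

variable {n m : ℕ} (D : LQProblem n m)

/-- The matrix-valued function `F` of two variables is `C¹` on the closed square `[0,T]²`. -/
def IsC1Square {k l : ℕ} (F : ℝ → ℝ → Matrix (Fin k) (Fin l) ℝ) : Prop :=
  ∀ i j, ContDiffOn ℝ 1 (fun p : ℝ × ℝ => F p.1 p.2 i j)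
    (Set.Icc 0 D.T ×ˢ Set.Icc 0 D.T)

/-- The standing assumptions. -/
structure Assumptions : Prop where
  T_pos : 0 < D.T
  A_L1 : ∀ i j, MeasureTheory.MemLp (fun t => D.A t i j) 1
    (MeasureTheory.volume.restrict (Set.Icc 0 D.T))
  B_Linfty : ∀ i j, MeasureTheory.MemLp (fun t => D.B t i j) ⊤
    (MeasureTheory.volume.restrict (Set.Icc 0 D.T))
  M_C1 : D.IsC1Square D.M
  M_posDef : ∀ t ∈ Set.Icc 0 D.T, ∀ s ∈ Set.Icc 0 D.T, (D.M t s).PosDef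
  Q_C1 : D.IsC1Square D.Q
  Q_posSemidef : ∀ t ∈ Set.Icc 0 D.T, ∀ s ∈ Set.Icc 0 D.T, (D.Q t s).PosSemidef
  G_C1 : ∀ i j, ContDiffOn ℝ 1 (fun t => D.G t i j) (Set.Icc 0 D.T)
  G_posSemidef : ∀ t ∈ Set.Icc 0 D.T, (D.G t).PosSemidef
  S_C1 : D.IsC1Square D.S

/-! ### The control problem -/

/-- `X` is the state on `[t,T]` driven by the control `u` from `X(t) = x`
(a Carathéodory solution of `X' = A X + B u`). -/
def IsState (t : ℝ) (x : Fin n → ℝ) (u : ℝ → Fin m → ℝ) (X : ℝ → Fin n → ℝ) : Prop :=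
  ContinuousOn X (Set.Icc t D.T) ∧
    ∀ s ∈ Set.Icc t D.T, X s = x + ∫ r in t..s, (D.A r *ᵥ X r + D.B r *ᵥ u r)

/-- The cost, evaluated at time `t`, of a state/control pair on `[t,T]`. -/
def cost (t : ℝ) (X : ℝ → Fin n → ℝ) (u : ℝ → Fin m → ℝ) : ℝ :=
  (∫ s in t..D.T, ((D.Q t s *ᵥ X s) ⬝ᵥ X s + 2 * ((D.S t s *ᵥ X s) ⬝ᵥ u s)))
    + (∫ s in t..D.T, (D.M t s *ᵥ u s) ⬝ᵥ u s)
    + (D.G t *ᵥ X D.T) ⬝ᵥ X D.T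

/-- `X` is the state on `[t,T]` from `X(t) = x` under the feedback law `ub`. -/
def IsClosedLoop (ub : ℝ → (Fin n → ℝ) → Fin m → ℝ) (t : ℝ) (x : Fin n → ℝ)
    (X : ℝ → Fin n → ℝ) : Prop :=
  D.IsState t x (fun s => ub s (X s)) X

/-- The closed-loop state under `ub` from `(t,x)`; it is meaningful, on `[t,T]`, when the
closed-loop equation is uniquely solvable. -/
def closedLoop (ub : ℝ → (Fin n → ℝ) → Fin m → ℝ) (t : ℝ) (x : Fin n → ℝ) :
    ℝ → Fin n → ℝ :=
  Classical.epsilon fun X => D.IsClosedLoop ub t x X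

/-- `J(t,x;ub)` for a feedback law `ub`. -/
def J (t : ℝ) (x : Fin n → ℝ) (ub : ℝ → (Fin n → ℝ) → Fin m → ℝ) : ℝ :=
  D.cost t (D.closedLoop ub t x) (fun s => ub s (D.closedLoop ub t x s))

open Classical in
/-- The perturbed law: the constant `v` on `[t, t + ε]`, and `ub` elsewhere. -/
def perturb (ub : ℝ → (Fin n → ℝ) → Fin m → ℝ) (t ε : ℝ) (v : Fin m → ℝ) :
    ℝ → (Fin n → ℝ) → Fin m → ℝ :=
  fun s y => if s ∈ Set.Icc t (t + ε) then v else ub s y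

/-- Equilibrium controls. The field `measurable` is Lebesgue measurability on
`[0,T] × ℝⁿ`; the limit inferior is taken in the extended reals. -/
structure IsEquilibrium (ub : ℝ → (Fin n → ℝ) → Fin m → ℝ) : Prop where
  measurable : AEMeasurable (Function.uncurry ub)
    (MeasureTheory.volume.restrict (Set.Icc 0 D.T ×ˢ (Set.univ : Set (Fin n → ℝ))))
  squareIntegrable : ∀ X : ℝ → Fin n → ℝ, ContinuousOn X (Set.Icc 0 D.T) →
    MeasureTheory.MemLp (fun s => ub s (X s)) 2
      (MeasureTheory.volume.restrict (Set.Icc 0 D.T))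
  wellPosed : ∀ t ∈ Set.Ico 0 D.T, ∀ x, ∃ X, D.IsClosedLoop ub t x X ∧
    ∀ Y, D.IsClosedLoop ub t x Y → Set.EqOn Y X (Set.Icc t D.T)
  equilibrium : ∀ t ∈ Set.Ico 0 D.T, ∀ (x : Fin n → ℝ) (v : Fin m → ℝ),
    (0 : EReal) ≤ Filter.liminf
      (fun ε : ℝ => (((D.J t x (perturb ub t ε v) - D.J t x ub) / ε : ℝ) : EReal))
      (nhdsWithin 0 (Set.Ioi 0))

/-- Linear equilibrium controls. -/
def IsLinearEquilibrium (ub : ℝ → (Fin n → ℝ) → Fin m → ℝ) : Prop :=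
  D.IsEquilibrium ub ∧
    ∃ ut : ℝ → Matrix (Fin m) (Fin n) ℝ, ∀ t ∈ Set.Icc 0 D.T, ∀ x, ub t x = ut t *ᵥ x

/-! ### Derivatives of the weights in the time of evaluation -/

/-- Partial derivative in the first variable, within `[0,T]`. -/
def d1 {k l : ℕ} (F : ℝ → ℝ → Matrix (Fin k) (Fin l) ℝ) (t s : ℝ) :
    Matrix (Fin k) (Fin l) ℝ :=
  Matrix.of fun i j => derivWithin (fun r => F r s i j) (Set.Icc 0 D.T) t

/-- The derivative of `G`, within `[0,T]`. -/
def dG (t : ℝ) : Matrix (Fin n) (Fin n) ℝ :=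
  Matrix.of fun i j => derivWithin (fun r => D.G r i j) (Set.Icc 0 D.T) t

/-- `M(s,s)⁻¹`. -/
def Minv (s : ℝ) : Matrix (Fin m) (Fin m) ℝ := (D.M s s)⁻¹

/-! ### The two-point boundary value problem -/

/-- The drift `A(s) - B(s) M(s,s)⁻¹ S(s,s)`. -/
def drift (s : ℝ) : Matrix (Fin n) (Fin n) ℝ :=
  D.A s - D.B s * D.Minv s * D.S s s

/-- `M(τ,τ)⁻¹ (B(τ)ᵀ φ(τ) + S(τ,τ) X(τ))`. -/
def gain (X φ : ℝ → Fin n → ℝ) (τ : ℝ) : Fin m → ℝ :=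
  D.Minv τ *ᵥ ((D.B τ)ᵀ *ᵥ φ τ + D.S τ τ *ᵥ X τ)

/-- The nonlocal quadratic form along `(X, φ)` at time `s`. -/
def nonlocalForm (X φ : ℝ → Fin n → ℝ) (s : ℝ) : ℝ :=
  (D.Q s s *ᵥ X s) ⬝ᵥ X s - (D.dG s *ᵥ X D.T) ⬝ᵥ X D.T
    - (∫ τ in s..D.T, (D.d1 D.Q s τ *ᵥ X τ) ⬝ᵥ X τ)
    - ∫ τ in s..D.T,
        (D.d1 D.M s τ *ᵥ D.gain X φ τ - (2 : ℝ) • (D.d1 D.S s τ *ᵥ X τ)) ⬝ᵥ D.gain X φ τ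

/-- `(X, φ)` is a continuous (Carathéodory) solution on `[t,T]` of the two-point boundary value
problem from `(t,x)`, where `Qh` is the coefficient written `Q̂(s,s)`; the last clause
is the relation that ties `Qh` to the solution. -/
structure IsBVPSolution (Qh : ℝ → Matrix (Fin n) (Fin n) ℝ) (t : ℝ) (x : Fin n → ℝ)
    (X φ : ℝ → Fin n → ℝ) : Prop where
  continuousOn_X : ContinuousOn X (Set.Icc t D.T)
  continuousOn_φ : ContinuousOn φ (Set.Icc t D.T)
  eq_X : ∀ s ∈ Set.Icc t D.T, X s = x + ∫ r in t..s,
    (D.drift r *ᵥ X r - (D.B r * D.Minv r * (D.B r)ᵀ) *ᵥ φ r)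
  eq_φ : ∀ s ∈ Set.Icc t D.T, φ s = D.G D.T *ᵥ X D.T + ∫ r in s..D.T,
    ((D.drift r)ᵀ *ᵥ φ r + (Qh r - (D.S r r)ᵀ * D.Minv r * D.S r r) *ᵥ X r)
  eq_Qh : ∀ s ∈ Set.Icc t D.T, (Qh s *ᵥ X s) ⬝ᵥ X s = D.nonlocalForm X φ s

/-- The two-point boundary value problem is solvable for all `(t,x) ∈ [0,T) × ℝⁿ`. The
coefficient `Q̂(s,s)` is one symmetric, integrable matrix function of `s`, which serves all
initial data. -/
def BVPSolvable : Prop :=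
  ∃ Qh : ℝ → Matrix (Fin n) (Fin n) ℝ,
    (∀ s ∈ Set.Icc 0 D.T, (Qh s).IsSymm) ∧
    (∀ i j, MeasureTheory.IntegrableOn (fun s => Qh s i j) (Set.Icc 0 D.T)) ∧
    ∀ t ∈ Set.Ico 0 D.T, ∀ x : Fin n → ℝ, ∃ X φ, D.IsBVPSolution Qh t x X φ

/-! ### The equilibrium Riccati equation -/

/-- `Υ(s) = M(s,s)⁻¹ (B(s)ᵀ P(s) + S(s,s))`. -/
def Upsilon (P : ℝ → Matrix (Fin n) (Fin n) ℝ) (s : ℝ) : Matrix (Fin m) (Fin n) ℝ :=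
  D.Minv s * ((D.B s)ᵀ * P s + D.S s s)

/-- `Φ(t,s)` is the state-transition matrix on `[0,T]` of `X' = F X`:
`∂ₜ Φ(t,s) = F(t) Φ(t,s)`, `Φ(s,s) = 1`. -/
def IsTransition (F : ℝ → Matrix (Fin n) (Fin n) ℝ)
    (Φ : ℝ → ℝ → Matrix (Fin n) (Fin n) ℝ) : Prop :=
  ∀ s ∈ Set.Icc 0 D.T, ContinuousOn (fun t => Φ t s) (Set.Icc 0 D.T) ∧
    ∀ t ∈ Set.Icc 0 D.T, Φ t s = 1 + matIntegral (fun r => F r * Φ r s) s t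

/-- The nonlocal term `Q̄(t,t)` built from `P` and the transition matrix `Φ`. -/
def Qbar (P : ℝ → Matrix (Fin n) (Fin n) ℝ) (Φ : ℝ → ℝ → Matrix (Fin n) (Fin n) ℝ)
    (t : ℝ) : Matrix (Fin n) (Fin n) ℝ :=
  D.Q t t - (Φ D.T t)ᵀ * D.dG t * Φ D.T t
    - matIntegral (fun s => (Φ s t)ᵀ * D.d1 D.Q t s * Φ s t) t D.T
    - matIntegral (fun s => (Φ s t)ᵀ *
        ((D.Upsilon P s)ᵀ * D.d1 D.M t s * D.Upsilon P s
          - (D.Upsilon P s)ᵀ * D.d1 D.S t s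
          - (D.d1 D.S t s)ᵀ * D.Upsilon P s) * Φ s t) t D.T

/-- `P` is a continuous symmetric solution of the equilibrium Riccati equation, in integral
form, with `Φ` the transition matrix of the closed-loop matrix `A - B Υ`. -/
def IsRiccatiSolution (P : ℝ → Matrix (Fin n) (Fin n) ℝ) : Prop :=
  ContinuousOn P (Set.Icc 0 D.T) ∧
  (∀ t ∈ Set.Icc 0 D.T, (P t).IsSymm) ∧
  ∃ Φ : ℝ → ℝ → Matrix (Fin n) (Fin n) ℝ,
    D.IsTransition (fun r => D.A r - D.B r * D.Upsilon P r) Φ ∧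
    ∀ t ∈ Set.Icc 0 D.T, P t = D.G D.T + matIntegral (fun s =>
      (D.A s)ᵀ * P s + P s * D.A s + D.Qbar P Φ s
        - (P s * D.B s + (D.S s s)ᵀ) * D.Minv s * ((D.B s)ᵀ * P s + D.S s s)) t D.T

/-- The feedback law `(t,x) ↦ -M(t,t)⁻¹ (B(t)ᵀ P(t) + S(t,t)) x`. -/
def riccatiFeedback (P : ℝ → Matrix (Fin n) (Fin n) ℝ) : ℝ → (Fin n → ℝ) → Fin m → ℝ :=
  fun t x => -((D.Minv t * ((D.B t)ᵀ * P t + D.S t t)) *ᵥ x)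

end LQProblem

end

open scoped Matrix ENNReal
open MeasureTheory Set Filter Topology

noncomputable section

/-- `f` is absolutely continuous on `[a,b]` with almost everywhere derivative `g`, in integral
form. -/
def IsPrim (a b : ℝ) (f g : ℝ → ℝ) : Prop :=
  IntegrableOn g (Icc a b) ∧ ∀ s ∈ Icc a b, f s = f a + ∫ r in a..s, g r

theorem MeasureTheory.IntegrableOn.intervalIntegrable_of_mem {a b c d : ℝ} {g : ℝ → ℝ}
    (h : IntegrableOn g (Icc a b)) (hc : c ∈ Icc a b) (hd : d ∈ Icc a b) :
    IntervalIntegrable g volume c d := by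
  rw [intervalIntegrable_iff]
  exact h.mono_set (uIoc_subset_uIcc.trans (uIcc_subset_Icc hc hd))

namespace IsPrim

variable {a b : ℝ} {f g f₁ g₁ f₂ g₂ : ℝ → ℝ}

theorem sub_eq (h : IsPrim a b f g) {c d : ℝ} (hc : c ∈ Icc a b) (hd : d ∈ Icc a b) :
    f d - f c = ∫ r in c..d, g r := by
  have ha : a ∈ Icc a b := left_mem_Icc.2 (hc.1.trans hc.2)
  rw [h.2 c hc, h.2 d hd, ← intervalIntegral.integral_interval_sub_left
    (h.1.intervalIntegrable_of_mem ha hd) (h.1.intervalIntegrable_of_mem ha hc)]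
  ring

theorem eq_sub_integral (h : IsPrim a b f g) {s : ℝ} (hs : s ∈ Icc a b) :
    f s = f b - ∫ r in s..b, g r := by
  rw [← h.sub_eq hs (right_mem_Icc.2 (hs.1.trans hs.2))]; ring

theorem absolutelyContinuous (hab : a ≤ b) (h : IsPrim a b f g) :
    AbsolutelyContinuousOnInterval (fun x => f a + ∫ r in a..x, g r) a b := by
  have h1 := (h.1.intervalIntegrable_of_mem (left_mem_Icc.2 hab)
    (right_mem_Icc.2 hab)).absolutelyContinuousOnInterval_intervalIntegral (c := a) (by simp)
  have h2 : AbsolutelyContinuousOnInterval (fun _ : ℝ => f a) a b :=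
    (LipschitzWith.const (f a)).lipschitzOnWith.absolutelyContinuousOnInterval
  exact h2.fun_add h1

theorem continuousOn (h : IsPrim a b f g) : ContinuousOn f (Icc a b) := by
  rcases le_or_gt a b with hab | hab
  · have := (h.absolutelyContinuous hab).continuousOn
    rw [uIcc_of_le hab] at this
    exact this.congr h.2
  · simp [Icc_eq_empty_of_lt hab]

theorem ae_hasDerivAt (hab : a ≤ b) (h : IsPrim a b f g) :
    ∀ᵐ x, x ∈ Icc a b → HasDerivAt (fun x => f a + ∫ r in a..x, g r) (g x) x := by
  have h1 := (h.1.intervalIntegrable_of_mem (left_mem_Icc.2 hab)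
    (right_mem_Icc.2 hab)).ae_hasDerivAt_integral
  rw [uIcc_of_le hab] at h1
  filter_upwards [h1] with x hx hxab
  exact (hx hxab a (left_mem_Icc.2 hab)).const_add _

theorem mono (h : IsPrim a b f g) {c d : ℝ} (hc : a ≤ c) (hd : d ≤ b) : IsPrim c d f g := by
  refine ⟨h.1.mono_set (Icc_subset_Icc hc hd), fun s hs => ?_⟩
  rw [← h.sub_eq ⟨hc, hs.1.trans (hs.2.trans hd)⟩ ⟨hc.trans hs.1, hs.2.trans hd⟩]; ring

theorem congr (h : IsPrim a b f g) (hf : EqOn f₁ f (Icc a b))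
    (hg : g₁ =ᵐ[volume.restrict (Icc a b)] g) : IsPrim a b f₁ g₁ := by
  refine ⟨h.1.congr_fun_ae hg.symm, fun s hs => ?_⟩
  rw [hf hs, hf (left_mem_Icc.2 (hs.1.trans hs.2)), h.2 s hs]
  congr 1
  apply intervalIntegral.integral_congr_ae
  have := (ae_restrict_iff' measurableSet_Icc).1 hg
  filter_upwards [this] with x hx hx'
  rw [uIoc_of_le hs.1] at hx'
  exact (hx ⟨hx'.1.le, hx'.2.trans hs.2⟩).symm

theorem congr_on (h : IsPrim a b f g) (hf : EqOn f₁ f (Icc a b))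
    (hg : EqOn g₁ g (Icc a b)) : IsPrim a b f₁ g₁ :=
  h.congr hf ((ae_restrict_iff' measurableSet_Icc).2 (ae_of_all _ hg))

theorem const (c : ℝ) : IsPrim a b (fun _ => c) (fun _ => 0) :=
  ⟨integrableOn_zero, by simp⟩

theorem add (h₁ : IsPrim a b f₁ g₁) (h₂ : IsPrim a b f₂ g₂) :
    IsPrim a b (fun s => f₁ s + f₂ s) (fun s => g₁ s + g₂ s) := by
  refine ⟨h₁.1.add h₂.1, fun s hs => ?_⟩
  have ha : a ∈ Icc a b := left_mem_Icc.2 (hs.1.trans hs.2)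
  beta_reduce
  rw [intervalIntegral.integral_add (h₁.1.intervalIntegrable_of_mem ha hs)
    (h₂.1.intervalIntegrable_of_mem ha hs), h₁.2 s hs, h₂.2 s hs]
  ring

theorem const_mul (c : ℝ) (h : IsPrim a b f g) :
    IsPrim a b (fun s => c * f s) (fun s => c * g s) := by
  refine ⟨h.1.const_mul c, fun s hs => ?_⟩
  beta_reduce
  rw [intervalIntegral.integral_const_mul, h.2 s hs]
  ring

theorem neg (h : IsPrim a b f g) : IsPrim a b (fun s => - f s) (fun s => - g s) := by
  simpa using h.const_mul (-1)

theorem sub (h₁ : IsPrim a b f₁ g₁) (h₂ : IsPrim a b f₂ g₂) :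
    IsPrim a b (fun s => f₁ s - f₂ s) (fun s => g₁ s - g₂ s) := by
  simpa [sub_eq_add_neg] using h₁.add h₂.neg

theorem sum {ι : Type*} (t : Finset ι) {f g : ι → ℝ → ℝ}
    (h : ∀ i ∈ t, IsPrim a b (f i) (g i)) :
    IsPrim a b (fun s => ∑ i ∈ t, f i s) (fun s => ∑ i ∈ t, g i s) := by
  classical
  induction t using Finset.induction_on with
  | empty => simpa using const 0
  | insert i t hi ih =>
    simp only [Finset.sum_insert hi]
    exact (h i (by simp)).add (ih fun j hj => h j (by simp [hj]))

theorem mul (h₁ : IsPrim a b f₁ g₁) (h₂ : IsPrim a b f₂ g₂) :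
    IsPrim a b (fun s => f₁ s * f₂ s) (fun s => g₁ s * f₂ s + f₁ s * g₂ s) := by
  refine ⟨(h₁.1.mul_continuousOn h₂.continuousOn isCompact_Icc).add
    (h₂.1.continuousOn_mul h₁.continuousOn isCompact_Icc), fun s hs => ?_⟩
  have k₁ := h₁.mono le_rfl hs.2
  have k₂ := h₂.mono le_rfl hs.2
  have hab := hs.1
  have key := (k₁.absolutelyContinuous hab).integral_deriv_mul_eq_sub
    (k₂.absolutelyContinuous hab)
  have e : ∫ r in a..s, (g₁ r * f₂ r + f₁ r * g₂ r) =
      f₁ s * f₂ s - f₁ a * f₂ a := by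
    rw [h₁.2 s hs, h₂.2 s hs]
    simp only [intervalIntegral.integral_same, add_zero] at key
    rw [← key]
    apply intervalIntegral.integral_congr_ae
    filter_upwards [k₁.ae_hasDerivAt hab, k₂.ae_hasDerivAt hab] with x h1 h2 hx
    rw [uIoc_of_le hab] at hx
    have hx' : x ∈ Icc a s := ⟨hx.1.le, hx.2⟩
    rw [(h1 hx').deriv, (h2 hx').deriv, ← k₁.2 x hx', ← k₂.2 x hx']
  rw [e]; ring

theorem of_terminal {c : ℝ} (hg : IntegrableOn g (Icc a b))
    (h : ∀ s ∈ Icc a b, f s = c + ∫ r in s..b, g r) : IsPrim a b f (fun s => - g s) := by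
  refine ⟨hg.neg, fun s hs => ?_⟩
  have ha : a ∈ Icc a b := left_mem_Icc.2 (hs.1.trans hs.2)
  have hb : b ∈ Icc a b := right_mem_Icc.2 (hs.1.trans hs.2)
  rw [h s hs, h a ha, intervalIntegral.integral_neg,
    ← intervalIntegral.integral_add_adjacent_intervals (hg.intervalIntegrable_of_mem ha hs)
      (hg.intervalIntegrable_of_mem hs hb)]
  ring

theorem of_initial {c : ℝ} (hg : IntegrableOn g (Icc a b))
    (h : ∀ s ∈ Icc a b, f s = c + ∫ r in a..s, g r) : IsPrim a b f g := by
  refine ⟨hg, fun s hs => ?_⟩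
  rw [h s hs, h a (left_mem_Icc.2 (hs.1.trans hs.2))]
  simp

theorem eq_of_zero (h : IsPrim a b f g) (hg : EqOn g 0 (Icc a b)) {s r : ℝ}
    (hs : s ∈ Icc a b) (hr : r ∈ Icc a b) : f s = f r := by
  have := h.sub_eq hr hs
  rw [intervalIntegral.integral_congr (g := fun _ => 0)
    (fun x hx => hg (uIcc_subset_Icc hr hs hx)), intervalIntegral.integral_zero] at this
  linarith

theorem pow_div_factorial (h : IsPrim a b f g) (h0 : f a = 0) (k : ℕ) {s : ℝ}
    (hs : s ∈ Icc a b) :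
    ∫ r in a..s, g r * (f r ^ k / k.factorial) = f s ^ (k + 1) / (k + 1).factorial := by
  have key : IsPrim a b (fun s => f s ^ (k + 1) / (k + 1).factorial)
      (fun s => g s * (f s ^ k / k.factorial)) := by
    induction k with
    | zero => simpa using h
    | succ k ih =>
      refine ((ih.mul h).const_mul (1 / ((k : ℝ) + 2))).congr_on (fun x _ => ?_) (fun x _ => ?_)
      · simp only [Nat.factorial_succ (k + 1)]
        push_cast
        field_simp
        ring
      · simp only [Nat.factorial_succ k]
        push_cast
        field_simp
        ring
  have := key.2 s hs
  simp only [h0, ne_eq, Nat.add_eq_zero_iff, one_ne_zero, and_false, not_false_eq_true,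
    zero_pow, zero_div, zero_add] at this
  exact this.symm

end IsPrim

/-- Entrywise version of `IsPrim` for matrix-valued functions. -/
def IsMatPrim {κ l : Type*} (a b : ℝ) (X dX : ℝ → Matrix κ l ℝ) : Prop :=
  ∀ i j, IsPrim a b (fun s => X s i j) (fun s => dX s i j)

/-- Coordinatewise version of `IsPrim` for vector-valued functions. -/
def IsVecPrim {κ : Type*} (a b : ℝ) (X dX : ℝ → κ → ℝ) : Prop :=
  ∀ i, IsPrim a b (fun s => X s i) (fun s => dX s i)

namespace IsMatPrim

variable {κ l o : Type*} {a b : ℝ} {X X' Y Y' : ℝ → Matrix κ l ℝ}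

theorem continuousOn (h : IsMatPrim a b X X') : ContinuousOn X (Icc a b) :=
  continuousOn_pi.2 fun i => continuousOn_pi.2 fun j => (h i j).continuousOn

theorem mul [Fintype l] {Z Z' : ℝ → Matrix l o ℝ} (h : IsMatPrim a b X X') (k : IsMatPrim a b Z Z') :
    IsMatPrim a b (fun s => X s * Z s) (fun s => X' s * Z s + X s * Z' s) := by
  intro i j
  simp only [Matrix.add_apply, Matrix.mul_apply, ← Finset.sum_add_distrib]
  exact IsPrim.sum _ fun q _ => (h i q).mul (k q j)

theorem mulVec [Fintype l] {x x' : ℝ → l → ℝ} (h : IsMatPrim a b X X') (k : IsVecPrim a b x x') :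
    IsVecPrim a b (fun s => X s *ᵥ x s) (fun s => X' s *ᵥ x s + X s *ᵥ x' s) := by
  intro i
  simp only [Pi.add_apply, Matrix.mulVec, dotProduct, ← Finset.sum_add_distrib]
  exact IsPrim.sum _ fun q _ => (h i q).mul (k q)

theorem transpose (h : IsMatPrim a b X X') : IsMatPrim a b (fun s => (X s)ᵀ) (fun s => (X' s)ᵀ) :=
  fun i j => h j i

theorem const (C : Matrix κ l ℝ) : IsMatPrim a b (fun _ => C) (fun _ => 0) :=
  fun i j => IsPrim.const (C i j)

theorem add (h : IsMatPrim a b X X') (k : IsMatPrim a b Y Y') :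
    IsMatPrim a b (fun s => X s + Y s) (fun s => X' s + Y' s) :=
  fun i j => (h i j).add (k i j)

theorem sub (h : IsMatPrim a b X X') (k : IsMatPrim a b Y Y') :
    IsMatPrim a b (fun s => X s - Y s) (fun s => X' s - Y' s) :=
  fun i j => (h i j).sub (k i j)

theorem congr_on (h : IsMatPrim a b X X') (hX : EqOn Y X (Icc a b)) (hX' : EqOn Y' X' (Icc a b)) :
    IsMatPrim a b Y Y' :=
  fun i j => (h i j).congr_on (fun s hs => by simp only [hX hs]) (fun s hs => by simp only [hX' hs])

theorem congr_ae (h : IsMatPrim a b X X') (hX' : Y' =ᵐ[volume.restrict (Icc a b)] X') :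
    IsMatPrim a b X Y' :=
  fun i j => (h i j).congr (fun s _ => rfl) (hX'.mono fun s hs => by simp only [hs])

theorem mono (h : IsMatPrim a b X X') {c d : ℝ} (hc : a ≤ c) (hd : d ≤ b) : IsMatPrim c d X X' :=
  fun i j => (h i j).mono hc hd

theorem eq_of_zero (h : IsMatPrim a b X X') (h0 : EqOn X' 0 (Icc a b)) {s r : ℝ}
    (hs : s ∈ Icc a b) (hr : r ∈ Icc a b) : X s = X r := by
  ext i j
  exact (h i j).eq_of_zero (fun x hx => by simp [h0 hx]) hs hr

end IsMatPrim

namespace IsVecPrim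

variable {κ : Type*} {a b : ℝ} {X X' Y Y' : ℝ → κ → ℝ}

theorem continuousOn (h : IsVecPrim a b X X') : ContinuousOn X (Icc a b) :=
  continuousOn_pi.2 fun i => (h i).continuousOn

theorem const (c : κ → ℝ) : IsVecPrim a b (fun _ => c) (fun _ => 0) :=
  fun i => IsPrim.const (c i)

theorem dotProduct [Fintype κ] (h : IsVecPrim a b X X') (k : IsVecPrim a b Y Y') :
    IsPrim a b (fun s => X s ⬝ᵥ Y s) (fun s => X' s ⬝ᵥ Y s + X s ⬝ᵥ Y' s) := by
  simp only [_root_.dotProduct, ← Finset.sum_add_distrib]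
  exact IsPrim.sum _ fun q _ => (h q).mul (k q)

theorem congr_on (h : IsVecPrim a b X X') (hX : EqOn Y X (Icc a b)) (hX' : EqOn Y' X' (Icc a b)) :
    IsVecPrim a b Y Y' :=
  fun i => (h i).congr_on (fun s hs => by simp only [hX hs]) (fun s hs => by simp only [hX' hs])

theorem mono (h : IsVecPrim a b X X') {c d : ℝ} (hc : a ≤ c) (hd : d ≤ b) : IsVecPrim c d X X' :=
  fun i => (h i).mono hc hd

theorem eq_of_zero (h : IsVecPrim a b X X') (h0 : EqOn X' 0 (Icc a b)) {s r : ℝ}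
    (hs : s ∈ Icc a b) (hr : r ∈ Icc a b) : X s = X r := by
  ext i
  exact (h i).eq_of_zero (fun x hx => by simp [h0 hx]) hs hr

theorem iff_integral [Fintype κ] :
    IsVecPrim a b X X' ↔ IntegrableOn X' (Icc a b) ∧
      ∀ s ∈ Icc a b, X s = X a + ∫ r in a..s, X' r := by
  have key : IntegrableOn X' (Icc a b) → ∀ s ∈ Icc a b, ∀ i,
      (∫ r in a..s, X' r) i = ∫ r in a..s, X' r i := by
    intro h s hs i
    have : IntervalIntegrable X' volume a s := by
      rw [intervalIntegrable_iff, uIoc_of_le hs.1]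
      exact h.mono_set (Ioc_subset_Icc_self.trans (Icc_subset_Icc le_rfl hs.2))
    exact ((ContinuousLinearMap.proj (R := ℝ) (φ := fun _ : κ => ℝ)
      i).intervalIntegral_comp_comm this).symm
  constructor
  · intro h
    have hi : IntegrableOn X' (Icc a b) := Integrable.of_eval fun i => (h i).1
    refine ⟨hi, fun s hs => ?_⟩
    ext i
    rw [Pi.add_apply, key hi s hs i, ← (h i).2 s hs]
  · rintro ⟨hi, h⟩ i
    refine ⟨hi.eval i, fun s hs => ?_⟩
    rw [← key hi s hs i, ← Pi.add_apply, ← h s hs]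

end IsVecPrim

theorem Matrix.norm_mulVec_le_sum {κ ι : Type*} [Fintype κ] [Fintype ι] (C : Matrix κ ι ℝ)
    (v : ι → ℝ) : ‖C *ᵥ v‖ ≤ (∑ i, ∑ j, |C i j|) * ‖v‖ := by
  refine (pi_norm_le_iff_of_nonneg (by positivity)).2 fun i => ?_
  calc ‖(C *ᵥ v) i‖ ≤ ∑ j, ‖C i j * v j‖ := norm_sum_le _ _
    _ ≤ ∑ j, |C i j| * ‖v‖ := by
        gcongr with j
        rw [norm_mul, Real.norm_eq_abs]
        gcongr
        exact norm_le_pi_norm v j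
    _ = (∑ j, |C i j|) * ‖v‖ := by rw [Finset.sum_mul]
    _ ≤ _ := by
        gcongr
        exact Finset.single_le_sum (f := fun i => ∑ j, |C i j|)
          (fun i _ => by positivity) (Finset.mem_univ i)

theorem IsVecPrim.of_linear {ι κ : Type*} [Fintype ι] {a b : ℝ} {F : ℝ → Matrix κ ι ℝ}
    (hF : ∀ i j, IntegrableOn (fun s => F s i j) (Icc a b)) {X : ℝ → ι → ℝ}
    (hX : ContinuousOn X (Icc a b)) (i : κ) :
    IntegrableOn (fun s => (F s *ᵥ X s) i) (Icc a b) := by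
  simp only [Matrix.mulVec]
  exact integrable_finsetSum _ fun j _ =>
    (hF i j).mul_continuousOn (continuousOn_pi.1 hX j) isCompact_Icc

section Existence

variable {ι : Type*} [Fintype ι] {a b : ℝ} {F : ℝ → Matrix ι ι ℝ}

theorem exists_linear_vecPrim (hab : a ≤ b)
    (hF : ∀ i j, IntegrableOn (fun s => F s i j) (Icc a b)) (x : ι → ℝ) :
    ∃ X : ℝ → ι → ℝ, IsVecPrim a b X (fun s => F s *ᵥ X s) ∧ X a = x := by
  have ha : a ∈ Icc a b := left_mem_Icc.2 hab
  have hInt : ∀ Z : C(Icc a b, ι → ℝ),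
      IntegrableOn (fun s => F s *ᵥ IccExtend hab Z s) (Icc a b) := fun Z =>
    Integrable.of_eval fun i => IsVecPrim.of_linear hF (continuous_IccExtend_iff.2 Z.continuous).continuousOn i
  have hprim : ∀ Z : C(Icc a b, ι → ℝ), IsVecPrim a b
      (fun t => x + ∫ s in a..t, F s *ᵥ IccExtend hab Z s)
      (fun s => F s *ᵥ IccExtend hab Z s) := fun Z =>
    IsVecPrim.iff_integral.2 ⟨hInt Z, fun s hs => by simp⟩
  let K : C(Icc a b, ι → ℝ) → C(Icc a b, ι → ℝ) := fun Z =>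
    ⟨fun t => x + ∫ s in a..(t : ℝ), F s *ᵥ IccExtend hab Z s,
      continuousOn_iff_continuous_domRestrict.1 (hprim Z).continuousOn⟩
  let f : ℝ → ℝ := fun s => ∑ i, ∑ j, |F s i j|
  have hf : IntegrableOn f (Icc a b) :=
    integrable_finsetSum _ fun i _ => integrable_finsetSum _ fun j _ => (hF i j).abs
  let α : ℝ → ℝ := fun t => ∫ s in a..t, f s
  have hα : IsPrim a b α f := ⟨hf, fun s hs => by simp [α]⟩
  have hα0 : α a = 0 := by simp [α]
  have hf0 : ∀ s, 0 ≤ f s := fun s => by positivity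
  have hαle : ∀ t ∈ Icc a b, 0 ≤ α t ∧ α t ≤ α b := fun t ht =>
    ⟨intervalIntegral.integral_nonneg ht.1 fun s _ => hf0 s, by
      have := hα.sub_eq ht (right_mem_Icc.2 hab)
      have h2 := intervalIntegral.integral_nonneg (μ := volume) ht.2 fun s _ => hf0 s
      linarith⟩
  have bound : ∀ (k : ℕ) (Z W : C(Icc a b, ι → ℝ)) (t : Icc a b),
      ‖(K^[k] Z) t - (K^[k] W) t‖ ≤ α t ^ k / k.factorial * dist Z W := by
    intro k Z W
    induction k with
    | zero =>
      intro t
      simpa [dist_eq_norm] using ContinuousMap.dist_apply_le_dist (f := Z) (g := W) t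
    | succ k ih =>
      intro t
      rw [Function.iterate_succ_apply', Function.iterate_succ_apply']
      have hii : ∀ Z : C(Icc a b, ι → ℝ), IntervalIntegrable (fun s => F s *ᵥ IccExtend hab Z s) volume a t :=
        fun Z => by
          rw [intervalIntegrable_iff, uIoc_of_le t.2.1]
          exact (hInt Z).mono_set (Ioc_subset_Icc_self.trans (Icc_subset_Icc le_rfl t.2.2))
      have e : (K (K^[k] Z)) t - (K (K^[k] W)) t = ∫ s in a..(t : ℝ),
          F s *ᵥ (IccExtend hab (K^[k] Z) s - IccExtend hab (K^[k] W) s) := by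
        simp only [Matrix.mulVec_sub]
        rw [intervalIntegral.integral_sub (hii _) (hii _)]
        exact add_sub_add_left_eq_sub _ _ _
      rw [e, ← hα.pow_div_factorial hα0 k t.2, ← intervalIntegral.integral_mul_const]
      refine intervalIntegral.norm_integral_le_of_norm_le t.2.1 (ae_of_all _ fun s hs => ?_) ?_
      · have hs' : s ∈ Icc a b := ⟨hs.1.le, hs.2.trans t.2.2⟩
        refine (Matrix.norm_mulVec_le_sum _ _).trans ?_
        rw [mul_assoc]
        refine mul_le_mul_of_nonneg_left ?_ (hf0 s)
        rw [IccExtend_of_mem _ _ hs', IccExtend_of_mem _ _ hs']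
        exact ih ⟨s, hs'⟩
      · have hc : ContinuousOn (fun s => α s ^ k / (k.factorial : ℝ)) (Icc a b) :=
          (hα.continuousOn.pow k).div_const _
        exact (IntegrableOn.intervalIntegrable_of_mem
          (hf.mul_continuousOn hc isCompact_Icc) ha t.2).mul_const _
  obtain ⟨k, hk⟩ := ((FloorSemiring.tendsto_pow_div_factorial_atTop (α b)).eventually
    (gt_mem_nhds (show (0 : ℝ) < 1 by norm_num))).exists
  have hb0 := (hαle b (right_mem_Icc.2 hab)).1
  let c : NNReal := ⟨α b ^ k / k.factorial, by positivity⟩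
  have hcontr : ContractingWith c K^[k] := by
    refine ⟨by exact_mod_cast hk, LipschitzWith.of_dist_le_mul fun Z W => ?_⟩
    refine (ContinuousMap.dist_le (by positivity)).2 fun t => ?_
    rw [dist_eq_norm]
    refine (bound k Z W t).trans ?_
    refine mul_le_mul_of_nonneg_right ?_ dist_nonneg
    change α t ^ k / k.factorial ≤ α b ^ k / k.factorial
    have := hαle t t.2
    gcongr
    · exact this.1
    · exact this.2
  let Z := hcontr.fixedPoint _
  have hZ : K Z = Z := hcontr.isFixedPt_fixedPoint_iterate
  refine ⟨fun t => x + ∫ s in a..t, F s *ᵥ IccExtend hab Z s, ?_, by simp⟩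
  refine (hprim Z).congr_on (fun s _ => rfl) (fun s hs => ?_)
  change F s *ᵥ (x + ∫ s in a..s, F s *ᵥ IccExtend hab Z s) = F s *ᵥ IccExtend hab Z s
  rw [IccExtend_of_mem _ _ hs]
  congr 1
  exact congrArg (fun W : C(Icc a b, ι → ℝ) => W ⟨s, hs⟩) hZ

variable [DecidableEq ι]

/-- `Ψ` is a fundamental matrix of `X' = F X` on `[a,b]`, and `Y` its inverse. -/
structure IsFundamental (a b : ℝ) (F Ψ Y : ℝ → Matrix ι ι ℝ) : Prop where
  prim : IsMatPrim a b Ψ (fun s => F s * Ψ s)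
  prim_inv : IsMatPrim a b Y (fun s => -(Y s * F s))
  inv_mul : ∀ s ∈ Icc a b, Y s * Ψ s = 1
  mul_inv : ∀ s ∈ Icc a b, Ψ s * Y s = 1

theorem exists_linear_matPrim (hab : a ≤ b)
    (hF : ∀ i j, IntegrableOn (fun s => F s i j) (Icc a b)) :
    ∃ X : ℝ → Matrix ι ι ℝ, IsMatPrim a b X (fun s => F s * X s) ∧ X a = 1 := by
  choose X hX hX0 using fun j : ι => exists_linear_vecPrim hab hF (Pi.single j 1)
  refine ⟨fun s => Matrix.of fun i j => X j s i, fun i j => hX j i, ?_⟩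
  ext i j
  simp [hX0, Pi.single_apply, Matrix.one_apply]

theorem exists_isFundamental (hab : a ≤ b)
    (hF : ∀ i j, IntegrableOn (fun s => F s i j) (Icc a b)) :
    ∃ Ψ Y : ℝ → Matrix ι ι ℝ, IsFundamental a b F Ψ Y := by
  obtain ⟨Ψ, hΨ, hΨ0⟩ := exists_linear_matPrim hab hF
  obtain ⟨W, hW, hW0⟩ := exists_linear_matPrim (F := fun s => -(F s)ᵀ) hab
    (fun i j => (hF j i).neg)
  have hY : IsMatPrim a b (fun s => (W s)ᵀ) (fun s => -((W s)ᵀ * F s)) :=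
    hW.transpose.congr_on (fun s _ => rfl) (fun s _ => by simp)
  have h1 : ∀ s ∈ Icc a b, (W s)ᵀ * Ψ s = 1 := fun s hs => by
    have := (hY.mul hΨ).eq_of_zero (fun s _ => by simp [Matrix.mul_assoc]) hs
      (left_mem_Icc.2 hab)
    simpa [hΨ0, hW0] using this
  exact ⟨Ψ, fun s => (W s)ᵀ, hΨ, hY, h1, fun s hs => mul_eq_one_comm.1 (h1 s hs)⟩

namespace IsFundamental

variable {Ψ Y : ℝ → Matrix ι ι ℝ}

theorem mono (h : IsFundamental a b F Ψ Y) {c d : ℝ} (hc : a ≤ c) (hd : d ≤ b) :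
    IsFundamental c d F Ψ Y :=
  ⟨h.prim.mono hc hd, h.prim_inv.mono hc hd,
    fun s hs => h.inv_mul s (Icc_subset_Icc hc hd hs),
    fun s hs => h.mul_inv s (Icc_subset_Icc hc hd hs)⟩

theorem matPrim_eq {κ : Type*} (h : IsFundamental a b F Ψ Y) {X : ℝ → Matrix ι κ ℝ}
    (hX : IsMatPrim a b X (fun s => F s * X s)) {s r : ℝ} (hs : s ∈ Icc a b) (hr : r ∈ Icc a b) :
    X s = Ψ s * Y r * X r := by
  have h1 := (h.prim_inv.mul hX).eq_of_zero (fun s _ => by simp [Matrix.mul_assoc]) hs hr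
  rw [Matrix.mul_assoc, ← h1, ← Matrix.mul_assoc, h.mul_inv s hs, Matrix.one_mul]

theorem vecPrim_eq (h : IsFundamental a b F Ψ Y) {X : ℝ → ι → ℝ}
    (hX : IsVecPrim a b X (fun s => F s *ᵥ X s)) {s r : ℝ} (hs : s ∈ Icc a b)
    (hr : r ∈ Icc a b) : X s = (Ψ s * Y r) *ᵥ X r := by
  have h1 := (h.prim_inv.mulVec hX).eq_of_zero
    (fun s _ => by simp [Matrix.neg_mulVec]) hs hr
  rw [← Matrix.mulVec_mulVec, ← h1, Matrix.mulVec_mulVec, h.mul_inv s hs, Matrix.one_mulVec]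

/-- Uniqueness for the inhomogeneous equation. -/
theorem vecPrim_unique (h : IsFundamental a b F Ψ Y) {X Z β : ℝ → ι → ℝ}
    (hX : IsVecPrim a b X (fun s => F s *ᵥ X s + β s))
    (hZ : IsVecPrim a b Z (fun s => F s *ᵥ Z s + β s)) (h0 : X a = Z a) :
    EqOn X Z (Icc a b) := by
  intro s hs
  have hd : IsVecPrim a b (fun s => X s - Z s) (fun s => F s *ᵥ (X s - Z s)) := fun i =>
    ((hX i).sub (hZ i)).congr_on (fun s _ => rfl) (fun s _ => by simp [Matrix.mulVec_sub])
  have := h.vecPrim_eq hd hs (left_mem_Icc.2 (hs.1.trans hs.2))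
  simp only [h0, sub_self, Matrix.mulVec_zero] at this
  exact sub_eq_zero.1 this

/-- Existence for the inhomogeneous equation. -/
theorem exists_vecPrim (h : IsFundamental a b F Ψ Y) (hab : a ≤ b) {β : ℝ → ι → ℝ}
    (hβ : ∀ i, IntegrableOn (fun s => β s i) (Icc a b)) (x : ι → ℝ) :
    ∃ X, IsVecPrim a b X (fun s => F s *ᵥ X s + β s) ∧ X a = x := by
  let c : ℝ → ι → ℝ := fun s i => (Y a *ᵥ x) i + ∫ r in a..s, (Y r *ᵥ β r) i
  have hc : IsVecPrim a b c (fun s => Y s *ᵥ β s) := fun i => by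
    refine IsPrim.of_initial (c := (Y a *ᵥ x) i) ?_ (fun s _ => rfl)
    simp only [Matrix.mulVec, dotProduct]
    exact integrable_finsetSum _ fun j _ =>
      (hβ j).continuousOn_mul (h.prim_inv i j).continuousOn isCompact_Icc
  refine ⟨fun s => Ψ s *ᵥ c s, (h.prim.mulVec hc).congr_on (fun s _ => rfl) (fun s hs => ?_), ?_⟩
  · simp only [Matrix.mulVec_mulVec, h.mul_inv s hs, Matrix.one_mulVec]
  · have : c a = Y a *ᵥ x := by ext i; simp [c]
    simp only [this, Matrix.mulVec_mulVec, h.mul_inv a (left_mem_Icc.2 hab), Matrix.one_mulVec]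

end IsFundamental

end Existence

/-- The entries of the matrix-valued function `X` are in `L^p` on `[a,b]`. -/
def MatLp {κ l : Type*} (p : ℝ≥0∞) (a b : ℝ) (X : ℝ → Matrix κ l ℝ) : Prop :=
  ∀ i j, MemLp (fun s => X s i j) p (volume.restrict (Icc a b))

theorem ContinuousOn.memLp_top_Icc {a b : ℝ} {f : ℝ → ℝ} (hf : ContinuousOn f (Icc a b)) :
    MemLp f ⊤ (volume.restrict (Icc a b)) := by
  obtain ⟨C, hC⟩ := isCompact_Icc.exists_bound_of_continuousOn hf
  exact MemLp.of_bound (hf.aestronglyMeasurable measurableSet_Icc) C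
    ((ae_restrict_iff' measurableSet_Icc).2 (ae_of_all _ hC))

theorem ContinuousOn.matrix_entry {κ l α : Type*} [TopologicalSpace α] {X : α → Matrix κ l ℝ}
    {s : Set α} (h : ContinuousOn X s) (i : κ) (j : l) : ContinuousOn (fun r => X r i j) s :=
  continuousOn_pi.1 (continuousOn_pi.1 h i) j

theorem ContinuousOn.of_matrix_entry {κ l α : Type*} [TopologicalSpace α] {X : α → Matrix κ l ℝ}
    {s : Set α} (h : ∀ i j, ContinuousOn (fun r => X r i j) s) : ContinuousOn X s :=
  continuousOn_pi.2 fun i => continuousOn_pi.2 fun j => h i j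

theorem ContinuousOn.matMul {κ l o α : Type*} [Fintype l] [TopologicalSpace α]
    {X : α → Matrix κ l ℝ} {Y : α → Matrix l o ℝ} {s : Set α}
    (hX : ContinuousOn X s) (hY : ContinuousOn Y s) : ContinuousOn (fun r => X r * Y r) s := by
  refine ContinuousOn.of_matrix_entry fun i j => ?_
  simp only [Matrix.mul_apply]
  exact continuousOn_finsetSum _ fun q _ => (hX.matrix_entry i q).mul (hY.matrix_entry q j)

theorem ContinuousOn.matTranspose {κ l α : Type*} [TopologicalSpace α]
    {X : α → Matrix κ l ℝ} {s : Set α} (hX : ContinuousOn X s) :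
    ContinuousOn (fun r => (X r)ᵀ) s :=
  ContinuousOn.of_matrix_entry fun i j => hX.matrix_entry j i

theorem ContinuousOn.matMulVec {κ l α : Type*} [Fintype l] [TopologicalSpace α]
    {X : α → Matrix κ l ℝ} {y : α → l → ℝ} {s : Set α}
    (hX : ContinuousOn X s) (hy : ContinuousOn y s) : ContinuousOn (fun r => X r *ᵥ y r) s := by
  refine continuousOn_pi.2 fun i => ?_
  simp only [Matrix.mulVec, dotProduct]
  exact continuousOn_finsetSum _ fun q _ => (hX.matrix_entry i q).mul (continuousOn_pi.1 hy q)

theorem ContinuousOn.matInv {ι α : Type*} [Fintype ι] [DecidableEq ι] [TopologicalSpace α]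
    {X : α → Matrix ι ι ℝ} {s : Set α} (hX : ContinuousOn X s) (h : ∀ r ∈ s, IsUnit (X r).det) :
    ContinuousOn (fun r => (X r)⁻¹) s := fun r hr =>
  (continuousAt_matrix_inv _ (NormedRing.inverse_continuousAt
    (h r hr).unit)).comp_continuousWithinAt (hX r hr)

namespace MatLp

variable {κ l o : Type*} {p q r : ℝ≥0∞} {a b : ℝ} {X Y : ℝ → Matrix κ l ℝ}

theorem of_continuousOn (h : ContinuousOn X (Icc a b)) : MatLp ⊤ a b X :=
  fun i j => (h.matrix_entry i j).memLp_top_Icc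

theorem of_le (h : MatLp p a b X) (hqp : q ≤ p) : MatLp q a b X :=
  fun i j => (h i j).mono_exponent hqp

theorem integrable (h : MatLp 1 a b X) (i : κ) (j : l) :
    IntegrableOn (fun s => X s i j) (Icc a b) :=
  memLp_one_iff_integrable.1 (h i j)

theorem of_integrable (h : ∀ i j, IntegrableOn (fun s => X s i j) (Icc a b)) : MatLp 1 a b X :=
  fun i j => memLp_one_iff_integrable.2 (h i j)

theorem transpose (h : MatLp p a b X) : MatLp p a b (fun s => (X s)ᵀ) := fun i j => h j i

theorem add (h : MatLp p a b X) (k : MatLp p a b Y) : MatLp p a b (fun s => X s + Y s) :=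
  fun i j => (h i j).add (k i j)

theorem sub (h : MatLp p a b X) (k : MatLp p a b Y) : MatLp p a b (fun s => X s - Y s) :=
  fun i j => (h i j).sub (k i j)

theorem neg (h : MatLp p a b X) : MatLp p a b (fun s => - X s) := fun i j => (h i j).neg

theorem mul [Fintype l] {Z : ℝ → Matrix l o ℝ} [p.HolderTriple q r] (h : MatLp p a b X)
    (k : MatLp q a b Z) : MatLp r a b (fun s => X s * Z s) := by
  intro i j
  simp only [Matrix.mul_apply]
  exact memLp_finsetSum _ fun w _ => (k w j).mul' (h i w)

theorem mono (h : MatLp p a b X) {c d : ℝ} (hc : a ≤ c) (hd : d ≤ b) : MatLp p c d X :=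
  fun i j => (h i j).mono_measure (Measure.restrict_mono (Icc_subset_Icc hc hd) le_rfl)

theorem congr_ae (h : MatLp p a b X) (hXY : Y =ᵐ[volume.restrict (Icc a b)] X) : MatLp p a b Y :=
  fun i j => (h i j).ae_eq (hXY.symm.mono fun s hs => by simp only [hs])

theorem congr_on (h : MatLp p a b X) (hXY : EqOn Y X (Icc a b)) : MatLp p a b Y :=
  h.congr_ae ((ae_restrict_iff' measurableSet_Icc).2 (ae_of_all _ hXY))

end MatLp

theorem IsPrim.of_hasDerivWithinAt {a b : ℝ} {f f' : ℝ → ℝ}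
    (hf : ∀ t ∈ Icc a b, HasDerivWithinAt f (f' t) (Icc a b) t)
    (hf' : ContinuousOn f' (Icc a b)) : IsPrim a b f f' := by
  have hi : IntegrableOn f' (Icc a b) := hf'.integrableOn_compact isCompact_Icc
  refine ⟨hi, fun s hs => ?_⟩
  have ha : a ∈ Icc a b := left_mem_Icc.2 (hs.1.trans hs.2)
  rw [intervalIntegral.integral_eq_sub_of_hasDerivAt_of_le hs.1
    (fun t ht => ((hf t ⟨ht.1, ht.2.trans hs.2⟩).continuousWithinAt.mono
      (Icc_subset_Icc le_rfl hs.2)))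
    (fun t ht => (hf t ⟨ht.1.le, ht.2.le.trans hs.2⟩).hasDerivAt
      (Icc_mem_nhds ht.1 (ht.2.trans_le hs.2)))
    (hi.intervalIntegrable_of_mem ha hs)]
  ring

namespace LQProblem

variable {n m : ℕ} {D : LQProblem n m} {k l : ℕ} {F : ℝ → ℝ → Matrix (Fin k) (Fin l) ℝ}

theorem IsC1Square.continuousOn (hF : D.IsC1Square F) (i : Fin k) (j : Fin l) :
    ContinuousOn (fun p : ℝ × ℝ => F p.1 p.2 i j) (Icc 0 D.T ×ˢ Icc 0 D.T) :=
  (hF i j).continuousOn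

theorem IsC1Square.continuousOn_right (hF : D.IsC1Square F) {t : ℝ} (ht : t ∈ Icc 0 D.T) :
    ContinuousOn (fun s => F t s) (Icc 0 D.T) :=
  ContinuousOn.of_matrix_entry fun i j => (hF.continuousOn i j).comp (f := fun s => (t, s))
    (by fun_prop) (fun _ hs => ⟨ht, hs⟩)

theorem IsC1Square.continuousOn_diag (hF : D.IsC1Square F) :
    ContinuousOn (fun s => F s s) (Icc 0 D.T) :=
  ContinuousOn.of_matrix_entry fun i j => (hF.continuousOn i j).comp (f := fun s => (s, s))
    (by fun_prop) (fun _ hs => ⟨hs, hs⟩)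

theorem IsC1Square.hasDerivWithinAt (hF : D.IsC1Square F) {t s : ℝ} (ht : t ∈ Icc 0 D.T)
    (hs : s ∈ Icc 0 D.T) (i : Fin k) (j : Fin l) :
    HasDerivWithinAt (fun r => F r s i j)
      (fderivWithin ℝ (fun p : ℝ × ℝ => F p.1 p.2 i j) (Icc 0 D.T ×ˢ Icc 0 D.T) (t, s) (1, 0))
      (Icc 0 D.T) t := by
  have h1 := ((hF i j).differentiableOn (by norm_num) (t, s) ⟨ht, hs⟩).hasFDerivWithinAt
  have h2 : HasDerivWithinAt (fun r : ℝ => (r, s)) (1, 0) (Icc 0 D.T) t :=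
    (hasDerivWithinAt_id t _).prodMk (hasDerivWithinAt_const t _ s)
  exact h1.comp_hasDerivWithinAt (f := fun r : ℝ => (r, s)) t h2 (fun r hr => ⟨hr, hs⟩)

theorem IsC1Square.d1_eq (hT : 0 < D.T) (hF : D.IsC1Square F) {t s : ℝ} (ht : t ∈ Icc 0 D.T)
    (hs : s ∈ Icc 0 D.T) (i : Fin k) (j : Fin l) :
    D.d1 F t s i j = fderivWithin ℝ (fun p : ℝ × ℝ => F p.1 p.2 i j)
      (Icc 0 D.T ×ˢ Icc 0 D.T) (t, s) (1, 0) :=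
  (hF.hasDerivWithinAt ht hs i j).derivWithin (uniqueDiffOn_Icc hT t ht)

theorem IsC1Square.continuousOn_d1 (hT : 0 < D.T) (hF : D.IsC1Square F) (i : Fin k)
    (j : Fin l) :
    ContinuousOn (fun p : ℝ × ℝ => D.d1 F p.1 p.2 i j) (Icc 0 D.T ×ˢ Icc 0 D.T) := by
  have h1 := (hF i j).continuousOn_fderivWithin
    ((uniqueDiffOn_Icc hT).prod (uniqueDiffOn_Icc hT)) le_rfl
  exact (h1.clm_apply continuousOn_const (g := fun _ => ((1 : ℝ), (0 : ℝ)))).congr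
    fun p hp => hF.d1_eq hT hp.1 hp.2 i j

theorem IsC1Square.continuousOn_d1_right (hT : 0 < D.T) (hF : D.IsC1Square F) {t : ℝ}
    (ht : t ∈ Icc 0 D.T) : ContinuousOn (fun s => D.d1 F t s) (Icc 0 D.T) :=
  ContinuousOn.of_matrix_entry fun i j => (hF.continuousOn_d1 hT i j).comp (f := fun s => (t, s))
    (by fun_prop) (fun _ hs => ⟨ht, hs⟩)

theorem IsC1Square.isPrim (hT : 0 < D.T) (hF : D.IsC1Square F) {s : ℝ} (hs : s ∈ Icc 0 D.T) :
    IsMatPrim 0 D.T (fun t => F t s) (fun t => D.d1 F t s) := by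
  intro i j
  refine IsPrim.of_hasDerivWithinAt (fun t ht => ?_) ?_
  · exact (hF.hasDerivWithinAt ht hs i j).congr_deriv (hF.d1_eq hT ht hs i j).symm
  · exact (hF.continuousOn_d1 hT i j).comp (f := fun t => (t, s)) (by fun_prop)
      (fun _ ht => ⟨ht, hs⟩)

theorem d1_symm {F : ℝ → ℝ → Matrix (Fin k) (Fin k) ℝ}
    (hF : ∀ t ∈ Icc 0 D.T, ∀ s ∈ Icc 0 D.T, (F t s)ᵀ = F t s) {t s : ℝ} (ht : t ∈ Icc 0 D.T)
    (hs : s ∈ Icc 0 D.T) : (D.d1 F t s)ᵀ = D.d1 F t s := by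
  ext i j
  exact derivWithin_congr (fun r hr => congrFun₂ (hF r hr s hs) i j)
    (congrFun₂ (hF t ht s hs) i j)

namespace Assumptions

variable (hD : D.Assumptions)

include hD

theorem zero_mem : (0 : ℝ) ∈ Icc 0 D.T := left_mem_Icc.2 hD.T_pos.le

theorem T_mem : D.T ∈ Icc 0 D.T := right_mem_Icc.2 hD.T_pos.le

theorem continuousOn_dG : ContinuousOn D.dG (Icc 0 D.T) :=
  ContinuousOn.of_matrix_entry fun i j =>
    (hD.G_C1 i j).continuousOn_derivWithin (uniqueDiffOn_Icc hD.T_pos) le_rfl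

theorem isPrim_G : IsMatPrim 0 D.T D.G D.dG := fun i j =>
  IsPrim.of_hasDerivWithinAt
    (fun t ht => ((hD.G_C1 i j).differentiableOn (by norm_num) t ht).hasDerivWithinAt)
    (hD.continuousOn_dG.matrix_entry i j)

theorem isUnit_det_M {s : ℝ} (hs : s ∈ Icc 0 D.T) : IsUnit (D.M s s).det :=
  isUnit_iff_ne_zero.2 (hD.M_posDef s hs s hs).det_pos.ne'

theorem M_mul_Minv {s : ℝ} (hs : s ∈ Icc 0 D.T) : D.M s s * D.Minv s = 1 :=
  Matrix.mul_nonsing_inv _ (hD.isUnit_det_M hs)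

theorem Minv_mul_M {s : ℝ} (hs : s ∈ Icc 0 D.T) : D.Minv s * D.M s s = 1 :=
  Matrix.nonsing_inv_mul _ (hD.isUnit_det_M hs)

theorem M_symm {t s : ℝ} (ht : t ∈ Icc 0 D.T) (hs : s ∈ Icc 0 D.T) : (D.M t s)ᵀ = D.M t s := by
  simpa using (hD.M_posDef t ht s hs).1.eq

theorem Q_symm {t s : ℝ} (ht : t ∈ Icc 0 D.T) (hs : s ∈ Icc 0 D.T) : (D.Q t s)ᵀ = D.Q t s := by
  simpa using (hD.Q_posSemidef t ht s hs).1.eq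

theorem G_symm {t : ℝ} (ht : t ∈ Icc 0 D.T) : (D.G t)ᵀ = D.G t := by
  simpa using (hD.G_posSemidef t ht).1.eq

theorem Minv_symm {s : ℝ} (hs : s ∈ Icc 0 D.T) : (D.Minv s)ᵀ = D.Minv s := by
  rw [Minv, Matrix.transpose_nonsing_inv, hD.M_symm hs hs]

theorem dG_symm {t : ℝ} (ht : t ∈ Icc 0 D.T) : (D.dG t)ᵀ = D.dG t := by
  ext i j
  exact derivWithin_congr (fun r hr => congrFun₂ (hD.G_symm hr) i j)
    (congrFun₂ (hD.G_symm ht) i j)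

theorem continuousOn_Minv : ContinuousOn D.Minv (Icc 0 D.T) :=
  hD.M_C1.continuousOn_diag.matInv fun _ hs => hD.isUnit_det_M hs

theorem matLp_A : MatLp 1 0 D.T D.A := hD.A_L1

theorem matLp_B : MatLp ⊤ 0 D.T D.B := hD.B_Linfty

end Assumptions

end LQProblem

/-! ### Parameter-dependent integrals -/

/-- `ρ` is the derivative of `r` in the first variable on `[0,T]²`, with the integrability that
the differentiation of `t ↦ ∫ τ in t..T, r t τ` requires. -/
structure IsKernel (T : ℝ) (r ρ : ℝ → ℝ → ℝ) : Prop where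
  prim : ∀ τ ∈ Icc 0 T, IsPrim 0 T (fun t => r t τ) (fun t => ρ t τ)
  integrable : Integrable (Function.uncurry ρ)
    ((volume.restrict (Icc 0 T)).prod (volume.restrict (Icc 0 T)))
  diag : IntegrableOn (fun s => r s s) (Icc 0 T)
  slice : ∀ t ∈ Icc 0 T, IntegrableOn (fun τ => r t τ) (Icc 0 T)
  slice_deriv : ∀ t ∈ Icc 0 T, IntegrableOn (fun τ => ρ t τ) (Icc 0 T)

namespace IsKernel

variable {T : ℝ} {r ρ r₁ ρ₁ r₂ ρ₂ : ℝ → ℝ → ℝ}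

theorem add (h₁ : IsKernel T r₁ ρ₁) (h₂ : IsKernel T r₂ ρ₂) :
    IsKernel T (fun t τ => r₁ t τ + r₂ t τ) (fun t τ => ρ₁ t τ + ρ₂ t τ) where
  prim τ hτ := (h₁.prim τ hτ).add (h₂.prim τ hτ)
  integrable := h₁.integrable.add h₂.integrable
  diag := h₁.diag.add h₂.diag
  slice t ht := (h₁.slice t ht).add (h₂.slice t ht)
  slice_deriv t ht := (h₁.slice_deriv t ht).add (h₂.slice_deriv t ht)

theorem sub (h₁ : IsKernel T r₁ ρ₁) (h₂ : IsKernel T r₂ ρ₂) :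
    IsKernel T (fun t τ => r₁ t τ - r₂ t τ) (fun t τ => ρ₁ t τ - ρ₂ t τ) where
  prim τ hτ := (h₁.prim τ hτ).sub (h₂.prim τ hτ)
  integrable := h₁.integrable.sub h₂.integrable
  diag := h₁.diag.sub h₂.diag
  slice t ht := (h₁.slice t ht).sub (h₂.slice t ht)
  slice_deriv t ht := (h₁.slice_deriv t ht).sub (h₂.slice_deriv t ht)

theorem sum {ι : Type*} (s : Finset ι) {r ρ : ι → ℝ → ℝ → ℝ}
    (h : ∀ i ∈ s, IsKernel T (r i) (ρ i)) :
    IsKernel T (fun t τ => ∑ i ∈ s, r i t τ) (fun t τ => ∑ i ∈ s, ρ i t τ) where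
  prim τ hτ := IsPrim.sum s fun i hi => (h i hi).prim τ hτ
  integrable := integrable_finsetSum s fun i hi => (h i hi).integrable
  diag := integrable_finsetSum s fun i hi => (h i hi).diag
  slice t ht := integrable_finsetSum s fun i hi => (h i hi).slice t ht
  slice_deriv t ht := integrable_finsetSum s fun i hi => (h i hi).slice_deriv t ht

theorem of_isC1Square {n m k l : ℕ} {D : LQProblem n m} (hT : 0 < D.T)
    {F : ℝ → ℝ → Matrix (Fin k) (Fin l) ℝ} (hF : D.IsC1Square F) (i : Fin k) (j : Fin l)
    {g : ℝ → ℝ} (hg : IntegrableOn g (Icc 0 D.T)) :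
    IsKernel D.T (fun t τ => F t τ i j * g τ) (fun t τ => D.d1 F t τ i j * g τ) where
  prim τ hτ := (((hF.isPrim hT hτ) i j).const_mul (g τ)).congr_on
    (fun _ _ => mul_comm _ _) (fun _ _ => mul_comm _ _)
  integrable := by
    have hc := hF.continuousOn_d1 hT i j
    obtain ⟨C, hC⟩ := (isCompact_Icc.prod isCompact_Icc).exists_bound_of_continuousOn hc
    have hm : MeasurableSet (Icc 0 D.T ×ˢ Icc 0 D.T) := measurableSet_Icc.prod measurableSet_Icc
    have hg2 : Integrable (fun p : ℝ × ℝ => g p.2)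
        ((volume.restrict (Icc 0 D.T)).prod (volume.restrict (Icc 0 D.T))) :=
      Integrable.comp_snd hg _
    refine hg2.bdd_mul (c := C) ?_ ?_
    · rw [Measure.prod_restrict]
      exact hc.aestronglyMeasurable hm
    · rw [Measure.prod_restrict]
      exact (ae_restrict_iff' hm).2 (ae_of_all _ hC)
  diag := hg.continuousOn_mul (hF.continuousOn_diag.matrix_entry i j) isCompact_Icc
  slice t ht := hg.continuousOn_mul ((hF.continuousOn_right ht).matrix_entry i j) isCompact_Icc
  slice_deriv t ht :=
    hg.continuousOn_mul ((hF.continuousOn_d1_right hT ht).matrix_entry i j) isCompact_Icc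

theorem integrable_triangle (h : IsKernel T r ρ) :
    Integrable (Function.uncurry fun s τ => (Ici s).indicator (ρ s) τ)
      ((volume.restrict (Icc 0 T)).prod (volume.restrict (Icc 0 T))) := by
  have hm : MeasurableSet {p : ℝ × ℝ | p.1 ≤ p.2} := measurableSet_le measurable_fst measurable_snd
  refine (h.integrable.indicator hm).congr (ae_of_all _ fun p => ?_)
  by_cases hp : p.1 ≤ p.2 <;> simp [Function.uncurry, hp]

theorem integrableOn_integral_deriv (h : IsKernel T r ρ) :
    IntegrableOn (fun s => ∫ τ in s..T, ρ s τ) (Icc 0 T) := by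
  refine (h.integrable_triangle.integral_prod_left).congr
    ((ae_restrict_iff' measurableSet_Icc).2 (ae_of_all _ fun s hs => ?_))
  simp only [Function.uncurry_apply_pair]
  rw [setIntegral_indicator measurableSet_Ici, intervalIntegral.integral_of_le hs.2,
    ← integral_Icc_eq_integral_Ioc]
  congr 2
  ext τ
  simp only [mem_inter_iff, mem_Icc, mem_Ici]
  exact ⟨fun h => ⟨h.2, h.1.2⟩, fun h => ⟨⟨hs.1.trans h.1, h.2⟩, h.1⟩⟩

theorem integral_swap (h : IsKernel T r ρ) {t : ℝ} (ht : t ∈ Icc 0 T) :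
    ∫ τ in t..T, ∫ s in t..τ, ρ s τ = ∫ s in t..T, ∫ τ in s..T, ρ s τ := by
  have hsub : Ioc t T ⊆ Icc 0 T := fun x hx => ⟨ht.1.trans hx.1.le, hx.2⟩
  have hInt := h.integrable_triangle.mono_measure
    (Measure.prod_mono (Measure.restrict_mono (μ := volume) hsub le_rfl)
      (Measure.restrict_mono (μ := volume) hsub le_rfl))
  have key := integral_integral_swap hInt
  rw [intervalIntegral.integral_of_le ht.2, intervalIntegral.integral_of_le ht.2]
  have e1 : ∫ τ in Ioc t T, ∫ s in t..τ, ρ s τ =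
      ∫ τ in Ioc t T, ∫ s in Ioc t T, (Ici s).indicator (ρ s) τ := by
    refine setIntegral_congr_fun measurableSet_Ioc fun τ hτ => ?_
    have : ∀ s, (Ici s).indicator (ρ s) τ = (Iic τ).indicator (fun s => ρ s τ) s := fun s => by
      by_cases hs : s ≤ τ <;> simp [hs]
    simp only [this]
    rw [setIntegral_indicator measurableSet_Iic, intervalIntegral.integral_of_le hτ.1.le]
    congr 2
    ext s
    simp only [mem_inter_iff, mem_Ioc, mem_Iic]
    exact ⟨fun h => ⟨⟨h.1, h.2.trans hτ.2⟩, h.2⟩, fun h => ⟨h.1.1, h.2⟩⟩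
  have e2 : ∫ s in Ioc t T, ∫ τ in s..T, ρ s τ =
      ∫ s in Ioc t T, ∫ τ in Ioc t T, (Ici s).indicator (ρ s) τ := by
    refine setIntegral_congr_fun measurableSet_Ioc fun s hs => ?_
    rw [setIntegral_indicator measurableSet_Ici, intervalIntegral.integral_of_le hs.2,
      ← integral_Icc_eq_integral_Ioc]
    congr 2
    ext τ
    simp only [mem_inter_iff, mem_Icc, mem_Ioc, mem_Ici]
    exact ⟨fun h => ⟨⟨hs.1.trans_le h.1, h.2⟩, h.1⟩, fun h => ⟨h.2, h.1.2⟩⟩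
  rw [e1, e2, key]

theorem isPrim_integral (h : IsKernel T r ρ) :
    IsPrim 0 T (fun t => ∫ τ in t..T, r t τ) (fun s => -(r s s - ∫ τ in s..T, ρ s τ)) := by
  have hd := h.integrableOn_integral_deriv
  refine IsPrim.of_terminal (c := 0) (h.diag.sub hd) fun t ht => ?_
  have hT : T ∈ Icc 0 T := right_mem_Icc.2 (ht.1.trans ht.2)
  have e : ∀ τ ∈ uIcc t T, ∫ s in t..τ, ρ s τ = r τ τ - r t τ := fun τ hτ => by
    rw [uIcc_of_le ht.2] at hτ
    have hτ' : τ ∈ Icc 0 T := ⟨ht.1.trans hτ.1, hτ.2⟩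
    exact ((h.prim τ hτ').sub_eq ht hτ').symm
  rw [intervalIntegral.integral_sub (h.diag.intervalIntegrable_of_mem ht hT)
    (hd.intervalIntegrable_of_mem ht hT), ← h.integral_swap ht,
    intervalIntegral.integral_congr e,
    intervalIntegral.integral_sub (h.diag.intervalIntegrable_of_mem ht hT)
    ((h.slice t ht).intervalIntegrable_of_mem ht hT)]
  ring

end IsKernel

/-- Entrywise version of `IsKernel`. -/
def IsMatKernel {κ o : Type*} (T : ℝ) (R R' : ℝ → ℝ → Matrix κ o ℝ) : Prop :=
  ∀ i j, IsKernel T (fun t τ => R t τ i j) (fun t τ => R' t τ i j)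

namespace IsMatKernel

variable {κ o : Type*} {T : ℝ} {R R' R₁ R₁' : ℝ → ℝ → Matrix κ o ℝ}

theorem add (h : IsMatKernel T R R') (h₁ : IsMatKernel T R₁ R₁') :
    IsMatKernel T (fun t τ => R t τ + R₁ t τ) (fun t τ => R' t τ + R₁' t τ) :=
  fun i j => (h i j).add (h₁ i j)

theorem sub (h : IsMatKernel T R R') (h₁ : IsMatKernel T R₁ R₁') :
    IsMatKernel T (fun t τ => R t τ - R₁ t τ) (fun t τ => R' t τ - R₁' t τ) :=
  fun i j => (h i j).sub (h₁ i j)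

theorem matLp_slice (h : IsMatKernel T R R') {t : ℝ} (ht : t ∈ Icc 0 T) : MatLp 1 0 T (R t) :=
  MatLp.of_integrable fun i j => (h i j).slice t ht

theorem matLp_slice_deriv (h : IsMatKernel T R R') {t : ℝ} (ht : t ∈ Icc 0 T) :
    MatLp 1 0 T (R' t) :=
  MatLp.of_integrable fun i j => (h i j).slice_deriv t ht

theorem congr {Z Z' : ℝ → ℝ → Matrix κ o ℝ} (h : IsMatKernel T R R') (hZ : Z = R)
    (hZ' : Z' = R') : IsMatKernel T Z Z' := by
  subst hZ hZ'; exact h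

theorem sandwich {n m k l : ℕ} {D : LQProblem n m} (hT : 0 < D.T)
    {F : ℝ → ℝ → Matrix (Fin k) (Fin l) ℝ} (hF : D.IsC1Square F)
    {L : ℝ → Matrix (Fin k) κ ℝ} {N : ℝ → Matrix (Fin l) o ℝ}
    (hL : MatLp 2 0 D.T L) (hN : MatLp 2 0 D.T N) :
    IsMatKernel D.T (fun t τ => (L τ)ᵀ * F t τ * N τ) (fun t τ => (L τ)ᵀ * D.d1 F t τ * N τ) := by
  intro i j
  have e : ∀ F' : ℝ → ℝ → Matrix (Fin k) (Fin l) ℝ,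
      (fun t τ => ((L τ)ᵀ * F' t τ * N τ) i j) =
        fun t τ => ∑ q, ∑ p, F' t τ p q * (L τ p i * N τ q j) := fun F' => by
    funext t τ
    simp only [Matrix.mul_apply, Matrix.transpose_apply, Finset.sum_mul]
    refine Finset.sum_congr rfl fun q _ => Finset.sum_congr rfl fun p _ => by ring
  rw [e, e]
  exact IsKernel.sum _ fun q _ => IsKernel.sum _ fun p _ =>
    IsKernel.of_isC1Square hT hF p q ((hL p i).integrable_mul (hN q j))

end IsMatKernel

/-! ### Entrywise integrals of matrices -/

section matIntegral

variable {k l p q : ℕ} {a b c d : ℝ} {X Z : ℝ → Matrix (Fin k) (Fin l) ℝ}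

theorem matIntegral_add (hX : MatLp 1 a b X) (hZ : MatLp 1 a b Z) (hc : c ∈ Icc a b)
    (hd : d ∈ Icc a b) :
    matIntegral (fun s => X s + Z s) c d = matIntegral X c d + matIntegral Z c d := by
  ext i j
  exact intervalIntegral.integral_add ((hX.integrable i j).intervalIntegrable_of_mem hc hd)
    ((hZ.integrable i j).intervalIntegrable_of_mem hc hd)

theorem matIntegral_mul_mul (hX : MatLp 1 a b X) (C : Matrix (Fin p) (Fin k) ℝ)
    (E : Matrix (Fin l) (Fin q) ℝ) (hc : c ∈ Icc a b) (hd : d ∈ Icc a b) :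
    matIntegral (fun s => C * X s * E) c d = C * matIntegral X c d * E := by
  have hi : ∀ i j, IntervalIntegrable (fun s => X s i j) volume c d := fun i j =>
    (hX.integrable i j).intervalIntegrable_of_mem hc hd
  ext i j
  simp only [matIntegral, Matrix.of_apply, Matrix.mul_apply, Finset.sum_mul]
  have hs : ∀ v, IntervalIntegrable (fun s => ∑ w, C i w * X s w v * E v j) volume c d :=
    fun v => by
      have := IntervalIntegrable.sum (f := fun w s => C i w * X s w v * E v j) Finset.univ
        fun w _ => ((hi w v).const_mul _).mul_const _
      rwa [Finset.sum_fn] at this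
  rw [intervalIntegral.integral_finsetSum fun v _ => hs v]
  refine Finset.sum_congr rfl fun v _ => ?_
  rw [intervalIntegral.integral_finsetSum fun w _ => ((hi w v).const_mul _).mul_const _]
  refine Finset.sum_congr rfl fun w _ => ?_
  rw [intervalIntegral.integral_mul_const, intervalIntegral.integral_const_mul]

theorem matIntegral_congr (h : EqOn X Z (uIcc c d)) : matIntegral X c d = matIntegral Z c d := by
  ext i j
  exact intervalIntegral.integral_congr fun s hs => by simp only [h hs]

theorem matIntegral_congr_ae (h : X =ᵐ[volume.restrict (Icc a b)] Z) (hc : c ∈ Icc a b)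
    (hd : d ∈ Icc a b) : matIntegral X c d = matIntegral Z c d := by
  ext i j
  refine intervalIntegral.integral_congr_ae ?_
  filter_upwards [(ae_restrict_iff' measurableSet_Icc).1 h] with s hs hs'
  simp only [hs (uIcc_subset_Icc hc hd (uIoc_subset_uIcc hs'))]

theorem matIntegral_transpose : (matIntegral X c d)ᵀ = matIntegral (fun s => (X s)ᵀ) c d := rfl

end matIntegral

theorem IsMatKernel.isMatPrim {k l : ℕ} {T : ℝ} {R R' : ℝ → ℝ → Matrix (Fin k) (Fin l) ℝ}
    (h : IsMatKernel T R R') :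
    IsMatPrim 0 T (fun t => matIntegral (R t) t T)
      (fun s => -(R s s - matIntegral (R' s) s T)) :=
  fun i j => (h i j).isPrim_integral

theorem IsMatKernel.matLp_integral {k l : ℕ} {T : ℝ} {R R' : ℝ → ℝ → Matrix (Fin k) (Fin l) ℝ}
    (h : IsMatKernel T R R') : MatLp 1 0 T (fun s => matIntegral (R' s) s T) :=
  MatLp.of_integrable fun i j => (h i j).integrableOn_integral_deriv

theorem IsFundamental.isMatPrim_conj {ι : Type*} [Fintype ι] [DecidableEq ι] {a b : ℝ}
    {F Ψ Y H W : ℝ → Matrix ι ι ℝ} (hf : IsFundamental a b F Ψ Y)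
    (hH : IsMatPrim a b H (fun s => - W s)) :
    IsMatPrim a b (fun s => (Y s)ᵀ * H s * Y s)
      (fun s => -((F s)ᵀ * ((Y s)ᵀ * H s * Y s) + ((Y s)ᵀ * H s * Y s) * F s
        + (Y s)ᵀ * W s * Y s)) := by
  refine ((hf.prim_inv.transpose.mul hH).mul hf.prim_inv).congr_on (fun _ _ => rfl)
    (fun s _ => ?_)
  simp only [Matrix.transpose_neg, Matrix.transpose_mul, Matrix.add_mul, Matrix.neg_mul,
    Matrix.mul_neg, Matrix.mul_assoc]
  abel

theorem IsFundamental.conj_cancel {ι : Type*} [Fintype ι] [DecidableEq ι] {a b : ℝ}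
    {F Ψ Y : ℝ → Matrix ι ι ℝ} (hf : IsFundamental a b F Ψ Y) {s : ℝ} (hs : s ∈ Icc a b)
    (W : Matrix ι ι ℝ) : (Y s)ᵀ * ((Ψ s)ᵀ * W * Ψ s) * Y s = W := by
  have h1 : (Y s)ᵀ * (Ψ s)ᵀ = 1 := by
    rw [← Matrix.transpose_mul, hf.mul_inv _ hs, Matrix.transpose_one]
  calc _ = ((Y s)ᵀ * (Ψ s)ᵀ) * W * (Ψ s * Y s) := by simp only [Matrix.mul_assoc]
    _ = _ := by rw [h1, hf.mul_inv _ hs, Matrix.one_mul, Matrix.mul_one]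

/-- Two solutions of the same Lyapunov equation that agree at one time are equal. -/
theorem IsFundamental.lyapunov_unique {ι : Type*} [Fintype ι] [DecidableEq ι] {a b : ℝ}
    {F Ψ Y P P' W : ℝ → Matrix ι ι ℝ} (hf : IsFundamental a b F Ψ Y)
    (hP : IsMatPrim a b P (fun s => -((F s)ᵀ * P s + P s * F s + W s)))
    (hP' : IsMatPrim a b P' (fun s => -((F s)ᵀ * P' s + P' s * F s + W s)))
    (hb : P b = P' b) : EqOn P P' (Icc a b) := by
  intro s hs
  have hd := ((hf.prim.transpose.mul (hP.sub hP')).mul hf.prim).eq_of_zero (fun s _ => by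
    simp only [Matrix.transpose_mul, Matrix.add_mul, Matrix.mul_sub, Matrix.sub_mul,
      Matrix.mul_neg, Matrix.neg_mul, Matrix.mul_assoc, Matrix.mul_add, Pi.zero_apply]
    abel) hs (right_mem_Icc.2 (hs.1.trans hs.2))
  simp only [hb, sub_self, Matrix.mul_zero, Matrix.zero_mul] at hd
  have e := hf.conj_cancel hs (P s - P' s)
  rw [hd, Matrix.mul_zero, Matrix.zero_mul] at e
  exact sub_eq_zero.1 e.symm

namespace LQProblem

variable {n m : ℕ} (D : LQProblem n m)

/-- The weight `Q + Υᵀ M Υ - Υᵀ S - Sᵀ Υ` of the running cost under the feedback `-Υ`. -/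
def runWeight (Q : ℝ → ℝ → Matrix (Fin n) (Fin n) ℝ) (M : ℝ → ℝ → Matrix (Fin m) (Fin m) ℝ)
    (S : ℝ → ℝ → Matrix (Fin m) (Fin n) ℝ) (Υ : ℝ → Matrix (Fin m) (Fin n) ℝ) (t τ : ℝ) :
    Matrix (Fin n) (Fin n) ℝ :=
  Q t τ + ((Υ τ)ᵀ * M t τ * Υ τ - (Υ τ)ᵀ * S t τ - (S t τ)ᵀ * Υ τ)

/-- The running weight of `D` under the feedback `-Υ`. -/
abbrev weight (Υ : ℝ → Matrix (Fin m) (Fin n) ℝ) := runWeight D.Q D.M D.S Υ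

/-- The derivative of the running weight in the time of evaluation. -/
abbrev weightDeriv (Υ : ℝ → Matrix (Fin m) (Fin n) ℝ) :=
  runWeight (D.d1 D.Q) (D.d1 D.M) (D.d1 D.S) Υ

/-- The value matrix pulled back to the terminal time by the fundamental matrix `Ψ`. -/
def pulledValue (Υ : ℝ → Matrix (Fin m) (Fin n) ℝ) (Ψ : ℝ → Matrix (Fin n) (Fin n) ℝ)
    (t s : ℝ) : Matrix (Fin n) (Fin n) ℝ :=
  (Ψ D.T)ᵀ * D.G t * Ψ D.T + matIntegral (fun τ => (Ψ τ)ᵀ * D.weight Υ t τ * Ψ τ) s D.T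

/-- The matrix of the quadratic form `x ↦` cost on `[s,T]`, evaluated with the weights of time
`t`, of the feedback `-Υ` started from `(s,x)`. -/
def value (Υ : ℝ → Matrix (Fin m) (Fin n) ℝ) (Ψ Y : ℝ → Matrix (Fin n) (Fin n) ℝ)
    (t s : ℝ) : Matrix (Fin n) (Fin n) ℝ :=
  (Y s)ᵀ * D.pulledValue Υ Ψ t s * Y s

/-- `Qbar` for an arbitrary feedback `-Υ`. -/
def nonlocalWeight (Υ : ℝ → Matrix (Fin m) (Fin n) ℝ)
    (Φ : ℝ → ℝ → Matrix (Fin n) (Fin n) ℝ) (t : ℝ) : Matrix (Fin n) (Fin n) ℝ :=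
  D.Q t t - (Φ D.T t)ᵀ * D.dG t * Φ D.T t
    - matIntegral (fun s => (Φ s t)ᵀ * D.d1 D.Q t s * Φ s t) t D.T
    - matIntegral (fun s => (Φ s t)ᵀ *
        ((Υ s)ᵀ * D.d1 D.M t s * Υ s - (Υ s)ᵀ * D.d1 D.S t s - (D.d1 D.S t s)ᵀ * Υ s)
          * Φ s t) t D.T

theorem Qbar_eq_nonlocalWeight (P : ℝ → Matrix (Fin n) (Fin n) ℝ)
    (Φ : ℝ → ℝ → Matrix (Fin n) (Fin n) ℝ) (t : ℝ) :
    D.Qbar P Φ t = D.nonlocalWeight (D.Upsilon P) Φ t := rfl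

variable {D} {Υ : ℝ → Matrix (Fin m) (Fin n) ℝ} {Ψ Y : ℝ → Matrix (Fin n) (Fin n) ℝ}

theorem Assumptions.isMatKernel_Q (hD : D.Assumptions) (hΨ : ContinuousOn Ψ (Icc 0 D.T)) :
    IsMatKernel D.T (fun t τ => (Ψ τ)ᵀ * D.Q t τ * Ψ τ)
      (fun t τ => (Ψ τ)ᵀ * D.d1 D.Q t τ * Ψ τ) :=
  have hΨ2 : MatLp 2 0 D.T Ψ := (MatLp.of_continuousOn hΨ).of_le le_top
  IsMatKernel.sandwich hD.T_pos hD.Q_C1 hΨ2 hΨ2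

namespace Assumptions

variable (hD : D.Assumptions) (hΥ : MatLp 2 0 D.T Υ)

include hD hΥ

theorem matLp_closedLoop : MatLp 1 0 D.T (fun s => D.A s - D.B s * Υ s) := by
  have h : MatLp 2 0 D.T (fun s => D.B s * Υ s) := hD.matLp_B.mul hΥ
  exact hD.matLp_A.sub (h.of_le one_le_two)

variable (hΨ : ContinuousOn Ψ (Icc 0 D.T))

include hΨ

theorem isMatKernel_feedback :
    IsMatKernel D.T
      (fun t τ => (Ψ τ)ᵀ * ((Υ τ)ᵀ * D.M t τ * Υ τ - (Υ τ)ᵀ * D.S t τ - (D.S t τ)ᵀ * Υ τ) * Ψ τ)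
      (fun t τ => (Ψ τ)ᵀ * ((Υ τ)ᵀ * D.d1 D.M t τ * Υ τ - (Υ τ)ᵀ * D.d1 D.S t τ
        - (D.d1 D.S t τ)ᵀ * Υ τ) * Ψ τ) := by
  have hΨ' := MatLp.of_continuousOn hΨ
  have hΨ2 : MatLp 2 0 D.T Ψ := hΨ'.of_le le_top
  have hW : MatLp 2 0 D.T (fun s => Υ s * Ψ s) := hΥ.mul hΨ'
  have hSt : D.IsC1Square (fun t s => (D.S t s)ᵀ) := fun i j => hD.S_C1 j i
  refine (((IsMatKernel.sandwich hD.T_pos hD.M_C1 hW hW).sub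
    (IsMatKernel.sandwich hD.T_pos hD.S_C1 hW hΨ2)).sub
    (IsMatKernel.sandwich hD.T_pos hSt hΨ2 hW)).congr ?_ ?_ <;>
  · funext t τ
    simp only [Matrix.transpose_mul, Matrix.mul_sub, Matrix.sub_mul, Matrix.mul_assoc]
    try rfl

theorem isMatKernel_weight :
    IsMatKernel D.T (fun t τ => (Ψ τ)ᵀ * D.weight Υ t τ * Ψ τ)
      (fun t τ => (Ψ τ)ᵀ * D.weightDeriv Υ t τ * Ψ τ) := by
  refine ((hD.isMatKernel_Q hΨ).add (hD.isMatKernel_feedback hΥ hΨ)).congr ?_ ?_ <;>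
  · funext t τ
    simp only [runWeight, Matrix.mul_add, Matrix.add_mul]

theorem isMatPrim_pulledValue {t : ℝ} (ht : t ∈ Icc 0 D.T) :
    IsMatPrim 0 D.T (D.pulledValue Υ Ψ t) (fun s => -((Ψ s)ᵀ * D.weight Υ t s * Ψ s)) :=
  fun i j => IsPrim.of_terminal (c := ((Ψ D.T)ᵀ * D.G t * Ψ D.T) i j)
    (((hD.isMatKernel_weight hΥ hΨ).matLp_slice ht).integrable i j) (fun _ _ => rfl)

theorem isMatPrim_pulledValue_diag :
    IsMatPrim 0 D.T (fun s => D.pulledValue Υ Ψ s s)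
      (fun s => -((Ψ s)ᵀ * D.weight Υ s s * Ψ s - ((Ψ D.T)ᵀ * D.dG s * Ψ D.T
        + matIntegral (fun τ => (Ψ τ)ᵀ * D.weightDeriv Υ s τ * Ψ τ) s D.T))) := by
  refine ((((IsMatPrim.const (Ψ D.T)ᵀ).mul hD.isPrim_G).mul (IsMatPrim.const (Ψ D.T))).add
    (hD.isMatKernel_weight hΥ hΨ).isMatPrim).congr_on (fun s _ => rfl) (fun s _ => ?_)
  simp only [Matrix.zero_mul, zero_add, Matrix.mul_zero, add_zero]
  abel

theorem matIntegral_weightDeriv {t : ℝ} (ht : t ∈ Icc 0 D.T) :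
    matIntegral (fun τ => (Ψ τ)ᵀ * D.weightDeriv Υ t τ * Ψ τ) t D.T =
      matIntegral (fun τ => (Ψ τ)ᵀ * D.d1 D.Q t τ * Ψ τ) t D.T +
      matIntegral (fun τ => (Ψ τ)ᵀ * ((Υ τ)ᵀ * D.d1 D.M t τ * Υ τ - (Υ τ)ᵀ * D.d1 D.S t τ
        - (D.d1 D.S t τ)ᵀ * Υ τ) * Ψ τ) t D.T := by
  rw [← matIntegral_add ((hD.isMatKernel_Q hΨ).matLp_slice_deriv ht)
    ((hD.isMatKernel_feedback hΥ hΨ).matLp_slice_deriv ht) ht hD.T_mem]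
  simp only [runWeight, Matrix.mul_add, Matrix.add_mul]

theorem nonlocalWeight_eq {t : ℝ} (ht : t ∈ Icc 0 D.T) :
    D.nonlocalWeight Υ (fun r s => Ψ r * Y s) t = D.Q t t -
      (Y t)ᵀ * ((Ψ D.T)ᵀ * D.dG t * Ψ D.T
        + matIntegral (fun τ => (Ψ τ)ᵀ * D.weightDeriv Υ t τ * Ψ τ) t D.T) * Y t := by
  have e : ∀ X : ℝ → Matrix (Fin n) (Fin n) ℝ,
      (fun s => (Ψ s * Y t)ᵀ * X s * (Ψ s * Y t)) =
        fun s => (Y t)ᵀ * ((Ψ s)ᵀ * X s * Ψ s) * Y t := fun X => by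
    funext s
    simp only [Matrix.transpose_mul, Matrix.mul_assoc]
  simp only [nonlocalWeight, e]
  rw [matIntegral_mul_mul ((hD.isMatKernel_Q hΨ).matLp_slice_deriv ht) _ _ ht hD.T_mem,
    matIntegral_mul_mul ((hD.isMatKernel_feedback hΥ hΨ).matLp_slice_deriv ht) _ _ ht hD.T_mem,
    hD.matIntegral_weightDeriv hΥ hΨ ht]
  simp only [Matrix.transpose_mul, Matrix.mul_add, Matrix.add_mul, Matrix.mul_assoc]
  abel

theorem matLp_nonlocalWeight (hY : ContinuousOn Y (Icc 0 D.T)) :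
    MatLp 1 0 D.T (D.nonlocalWeight Υ (fun r s => Ψ r * Y s)) := by
  have hY' := MatLp.of_continuousOn hY
  have h1 : MatLp 1 0 D.T (fun t => (Ψ D.T)ᵀ * D.dG t * Ψ D.T
      + matIntegral (fun τ => (Ψ τ)ᵀ * D.weightDeriv Υ t τ * Ψ τ) t D.T) := by
    refine MatLp.add ((MatLp.of_continuousOn ?_).of_le le_top)
      (hD.isMatKernel_weight hΥ hΨ).matLp_integral
    exact (continuousOn_const.matMul hD.continuousOn_dG).matMul continuousOn_const
  have h2 : MatLp 1 0 D.T (fun t => (Y t)ᵀ * ((Ψ D.T)ᵀ * D.dG t * Ψ D.T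
      + matIntegral (fun τ => (Ψ τ)ᵀ * D.weightDeriv Υ t τ * Ψ τ) t D.T)) :=
    hY'.transpose.mul h1
  have h3 := h2.mul (r := 1) hY'
  exact (((MatLp.of_continuousOn hD.Q_C1.continuousOn_diag).of_le le_top).sub h3).congr_on
    fun t ht => hD.nonlocalWeight_eq hΥ hΨ ht

end Assumptions

theorem runWeight_symm {Q : ℝ → ℝ → Matrix (Fin n) (Fin n) ℝ}
    {M : ℝ → ℝ → Matrix (Fin m) (Fin m) ℝ} {S : ℝ → ℝ → Matrix (Fin m) (Fin n) ℝ} {t τ : ℝ}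
    (hQ : (Q t τ)ᵀ = Q t τ) (hM : (M t τ)ᵀ = M t τ) :
    (runWeight Q M S Υ t τ)ᵀ = runWeight Q M S Υ t τ := by
  simp only [runWeight, Matrix.transpose_add, Matrix.transpose_sub, Matrix.transpose_mul,
    Matrix.transpose_transpose, hQ, hM, Matrix.mul_assoc]
  abel

theorem Assumptions.nonlocalWeight_symm (hD : D.Assumptions) (hΥ : MatLp 2 0 D.T Υ)
    (hΨ : ContinuousOn Ψ (Icc 0 D.T)) {t : ℝ} (ht : t ∈ Icc 0 D.T) :
    (D.nonlocalWeight Υ (fun r s => Ψ r * Y s) t)ᵀ =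
      D.nonlocalWeight Υ (fun r s => Ψ r * Y s) t := by
  rw [hD.nonlocalWeight_eq hΥ hΨ ht]
  have e : (matIntegral (fun τ => (Ψ τ)ᵀ * D.weightDeriv Υ t τ * Ψ τ) t D.T)ᵀ =
      matIntegral (fun τ => (Ψ τ)ᵀ * D.weightDeriv Υ t τ * Ψ τ) t D.T := by
    rw [matIntegral_transpose]
    refine matIntegral_congr fun τ hτ => ?_
    have hτ' : τ ∈ Icc 0 D.T := uIcc_subset_Icc ht hD.T_mem hτ
    have := runWeight_symm (Υ := Υ) (S := D.d1 D.S)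
      (d1_symm (fun t ht s hs => hD.Q_symm ht hs) ht hτ')
      (d1_symm (fun t ht s hs => hD.M_symm ht hs) ht hτ')
    simp only [Matrix.transpose_mul, Matrix.transpose_transpose, this, Matrix.mul_assoc]
  generalize matIntegral (fun τ => (Ψ τ)ᵀ * D.weightDeriv Υ t τ * Ψ τ) t D.T = I at e
  simp only [Matrix.transpose_sub, Matrix.transpose_add, Matrix.transpose_mul,
    Matrix.transpose_transpose, e, hD.Q_symm ht ht, hD.dG_symm ht, Matrix.mul_assoc]

theorem Assumptions.value_symm (hD : D.Assumptions) {t s : ℝ} (ht : t ∈ Icc 0 D.T)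
    (hs : s ∈ Icc 0 D.T) : (D.value Υ Ψ Y t s)ᵀ = D.value Υ Ψ Y t s := by
  have e : (matIntegral (fun τ => (Ψ τ)ᵀ * D.weight Υ t τ * Ψ τ) s D.T)ᵀ =
      matIntegral (fun τ => (Ψ τ)ᵀ * D.weight Υ t τ * Ψ τ) s D.T := by
    rw [matIntegral_transpose]
    refine matIntegral_congr fun τ hτ => ?_
    have hτ' : τ ∈ Icc 0 D.T := uIcc_subset_Icc hs hD.T_mem hτ
    have := runWeight_symm (Υ := Υ) (S := D.S) (hD.Q_symm ht hτ') (hD.M_symm ht hτ')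
    simp only [Matrix.transpose_mul, Matrix.transpose_transpose, this, Matrix.mul_assoc]
  rw [value, pulledValue]
  generalize matIntegral (fun τ => (Ψ τ)ᵀ * D.weight Υ t τ * Ψ τ) s D.T = I at e
  simp only [Matrix.transpose_add, Matrix.transpose_mul,
    Matrix.transpose_transpose, e, hD.G_symm ht, Matrix.mul_assoc]

namespace Assumptions

variable (hD : D.Assumptions) (hΥ : MatLp 2 0 D.T Υ)
  (hf : IsFundamental 0 D.T (fun s => D.A s - D.B s * Υ s) Ψ Y)

include hD hf

theorem value_terminal (t : ℝ) : D.value Υ Ψ Y t D.T = D.G t := by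
  have h0 : matIntegral (fun τ => (Ψ τ)ᵀ * D.weight Υ t τ * Ψ τ) D.T D.T = 0 := by
    ext i j; simp [matIntegral]
  rw [value, pulledValue, h0, add_zero, hf.conj_cancel hD.T_mem]

include hΥ

/-- The Lyapunov equation for the value matrix with frozen time of evaluation. -/
theorem isMatPrim_value {t : ℝ} (ht : t ∈ Icc 0 D.T) :
    IsMatPrim 0 D.T (D.value Υ Ψ Y t)
      (fun s => -((D.A s - D.B s * Υ s)ᵀ * D.value Υ Ψ Y t s
        + D.value Υ Ψ Y t s * (D.A s - D.B s * Υ s) + D.weight Υ t s)) := by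
  refine (hf.isMatPrim_conj (hD.isMatPrim_pulledValue hΥ hf.prim.continuousOn ht)).congr_on
    (fun _ _ => rfl) (fun s hs => ?_)
  simp only [hf.conj_cancel hs]
  rfl

/-- The Lyapunov equation for the value matrix on the diagonal. -/
theorem isMatPrim_value_diag :
    IsMatPrim 0 D.T (fun s => D.value Υ Ψ Y s s)
      (fun s => -((D.A s - D.B s * Υ s)ᵀ * D.value Υ Ψ Y s s
        + D.value Υ Ψ Y s s * (D.A s - D.B s * Υ s)
        + (D.weight Υ s s - D.Q s s + D.nonlocalWeight Υ (fun r s => Ψ r * Y s) s))) := by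
  refine (hf.isMatPrim_conj (hD.isMatPrim_pulledValue_diag hΥ hf.prim.continuousOn)).congr_on
    (fun _ _ => rfl) (fun s hs => ?_)
  simp only [Matrix.mul_sub, Matrix.sub_mul (_ * _), hf.conj_cancel hs,
    hD.nonlocalWeight_eq hΥ hf.prim.continuousOn hs, value]
  abel

end Assumptions

end LQProblem

/-- The coordinates of the vector-valued function `u` are in `L^p` on `[a,b]`. -/
def VecLp {κ : Type*} (p : ℝ≥0∞) (a b : ℝ) (u : ℝ → κ → ℝ) : Prop :=
  ∀ i, MemLp (fun s => u s i) p (volume.restrict (Icc a b))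

namespace VecLp

variable {κ l : Type*} {p q r : ℝ≥0∞} {a b : ℝ} {u v : ℝ → κ → ℝ}

theorem of_continuousOn (h : ContinuousOn u (Icc a b)) : VecLp ⊤ a b u :=
  fun i => (continuousOn_pi.1 h i).memLp_top_Icc

theorem of_le (h : VecLp p a b u) (hqp : q ≤ p) : VecLp q a b u :=
  fun i => (h i).mono_exponent hqp

theorem add (h : VecLp p a b u) (k : VecLp p a b v) : VecLp p a b (fun s => u s + v s) :=
  fun i => (h i).add (k i)

theorem neg (h : VecLp p a b u) : VecLp p a b (fun s => - u s) := fun i => (h i).neg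

theorem integrable (h : VecLp 1 a b u) (i : κ) : IntegrableOn (fun s => u s i) (Icc a b) :=
  memLp_one_iff_integrable.1 (h i)

theorem congr_on (h : VecLp p a b u) (huv : EqOn v u (Icc a b)) : VecLp p a b v :=
  fun i => (h i).ae_eq ((ae_restrict_iff' measurableSet_Icc).2
    (ae_of_all _ fun s hs => by simp only [huv hs]))

theorem dotProduct [Fintype κ] [p.HolderTriple q r] (h : VecLp p a b u) (k : VecLp q a b v) :
    MemLp (fun s => u s ⬝ᵥ v s) r (volume.restrict (Icc a b)) := by
  simp only [_root_.dotProduct]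
  exact memLp_finsetSum _ fun w _ => (k w).mul' (h w)

end VecLp

theorem MatLp.mulVec {κ l : Type*} [Fintype l] {p q r : ℝ≥0∞} {a b : ℝ} [p.HolderTriple q r]
    {X : ℝ → Matrix κ l ℝ} {u : ℝ → l → ℝ} (h : MatLp p a b X) (k : VecLp q a b u) :
    VecLp r a b (fun s => X s *ᵥ u s) := by
  intro i
  simp only [Matrix.mulVec, dotProduct]
  exact memLp_finsetSum _ fun w _ => (k w).mul' (h i w)

theorem Matrix.transpose_mulVec_dotProduct {κ l : Type*} [Fintype κ] [Fintype l]
    (C : Matrix κ l ℝ) (x : κ → ℝ) (y : l → ℝ) : (Cᵀ *ᵥ x) ⬝ᵥ y = x ⬝ᵥ (C *ᵥ y) := by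
  rw [Matrix.mulVec_transpose, Matrix.dotProduct_mulVec]

namespace LQProblem

variable {n m : ℕ} (D : LQProblem n m)

/-- The density of the excess cost, evaluated at time `t`, of the control value `u` at `(s,x)`
over the feedback `-Υ`, where `W` is the value matrix of that feedback at `s`. -/
def excess (Υ : ℝ → Matrix (Fin m) (Fin n) ℝ) (W : Matrix (Fin n) (Fin n) ℝ) (t s : ℝ)
    (x : Fin n → ℝ) (u : Fin m → ℝ) : ℝ :=
  (D.M t s *ᵥ (u + Υ s *ᵥ x)) ⬝ᵥ (u + Υ s *ᵥ x) +
    2 * (((D.S t s + (D.B s)ᵀ * W - D.M t s * Υ s) *ᵥ x) ⬝ᵥ (u + Υ s *ᵥ x))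

variable {D} {Υ : ℝ → Matrix (Fin m) (Fin n) ℝ} {Ψ Y : ℝ → Matrix (Fin n) (Fin n) ℝ}

theorem excess_feedback (W : Matrix (Fin n) (Fin n) ℝ) (t s : ℝ) (x : Fin n → ℝ) :
    D.excess Υ W t s x (-(Υ s *ᵥ x)) = 0 := by
  simp [excess]

theorem excess_eq {V : Matrix (Fin n) (Fin n) ℝ} {t s : ℝ} (hV : Vᵀ = V)
    (hM : (D.M t s)ᵀ = D.M t s) (x : Fin n → ℝ) (u : Fin m → ℝ) :
    ((D.Q t s *ᵥ x) ⬝ᵥ x + 2 * ((D.S t s *ᵥ x) ⬝ᵥ u)) + (D.M t s *ᵥ u) ⬝ᵥ u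
      + (((-((D.A s - D.B s * Υ s)ᵀ * V + V * (D.A s - D.B s * Υ s) + D.weight Υ t s)) *ᵥ x
          + V *ᵥ (D.A s *ᵥ x + D.B s *ᵥ u)) ⬝ᵥ x
        + (V *ᵥ x) ⬝ᵥ (D.A s *ᵥ x + D.B s *ᵥ u)) = D.excess Υ V t s x u := by
  have hV' : ∀ a b : Fin n → ℝ, (V *ᵥ a) ⬝ᵥ b = (V *ᵥ b) ⬝ᵥ a := fun a b => by
    conv_lhs => rw [← hV]
    rw [Matrix.transpose_mulVec_dotProduct, dotProduct_comm]
  have hM' : ∀ a b : Fin m → ℝ, (D.M t s *ᵥ a) ⬝ᵥ b = (D.M t s *ᵥ b) ⬝ᵥ a := fun a b => by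
    conv_lhs => rw [← hM]
    rw [Matrix.transpose_mulVec_dotProduct, dotProduct_comm]
  simp only [excess, weight, runWeight, Matrix.neg_mulVec, Matrix.add_mulVec, Matrix.sub_mulVec,
    Matrix.transpose_sub, Matrix.transpose_mul, Matrix.sub_mul, Matrix.mul_sub,
    ← Matrix.mulVec_mulVec, Matrix.mulVec_add, add_dotProduct, sub_dotProduct, neg_dotProduct,
    dotProduct_add, Matrix.transpose_mulVec_dotProduct]
  generalize hw : Υ s *ᵥ x = w
  rw [hV' (D.A s *ᵥ x) x, hV' (D.B s *ᵥ w) x, hV' (D.B s *ᵥ u) x, hM' u w,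
    dotProduct_comm w (D.S t s *ᵥ x)]
  ring

theorem isVecPrim_of_isState (hD : D.Assumptions) {t : ℝ} (ht : t ∈ Icc 0 D.T)
    {x : Fin n → ℝ} {u : ℝ → Fin m → ℝ} {X : ℝ → Fin n → ℝ} (hu : VecLp 2 t D.T u)
    (hX : D.IsState t x u X) :
    IsVecPrim t D.T X (fun s => D.A s *ᵥ X s + D.B s *ᵥ u s) ∧ X t = x := by
  have ht' : X t = x := by
    have := hX.2 t (left_mem_Icc.2 ht.2)
    simpa using this
  have h1 : VecLp 1 t D.T (fun s => D.A s *ᵥ X s) :=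
    (hD.matLp_A.mono ht.1 le_rfl).mulVec (VecLp.of_continuousOn hX.1)
  have h2 : VecLp 2 t D.T (fun s => D.B s *ᵥ u s) := (hD.matLp_B.mono ht.1 le_rfl).mulVec hu
  have h3 := h1.add (h2.of_le one_le_two)
  refine ⟨IsVecPrim.iff_integral.2 ⟨Integrable.of_eval h3.integrable, ?_⟩, ht'⟩
  rw [ht']
  exact hX.2

theorem isState_of_isVecPrim {t : ℝ} {x : Fin n → ℝ} {u : ℝ → Fin m → ℝ} {X : ℝ → Fin n → ℝ}
    (hX : IsVecPrim t D.T X (fun s => D.A s *ᵥ X s + D.B s *ᵥ u s)) (h0 : X t = x) :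
    D.IsState t x u X :=
  ⟨hX.continuousOn, by rw [← h0]; exact (IsVecPrim.iff_integral.1 hX).2⟩

/-- Completion of squares: the cost of an arbitrary control in terms of the value matrix of the
feedback `-Υ`. -/
theorem cost_eq (hD : D.Assumptions) (hΥ : MatLp 2 0 D.T Υ)
    (hf : IsFundamental 0 D.T (fun s => D.A s - D.B s * Υ s) Ψ Y) {t : ℝ} (ht : t ∈ Icc 0 D.T)
    {u : ℝ → Fin m → ℝ} {X : ℝ → Fin n → ℝ} (hu : VecLp 2 t D.T u)
    (hX : IsVecPrim t D.T X (fun s => D.A s *ᵥ X s + D.B s *ᵥ u s)) :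
    IntegrableOn (fun s => D.excess Υ (D.value Υ Ψ Y t s) t s (X s) (u s)) (Icc t D.T) ∧
    D.cost t X u = (D.value Υ Ψ Y t t *ᵥ X t) ⬝ᵥ X t +
      ∫ s in t..D.T, D.excess Υ (D.value Υ Ψ Y t s) t s (X s) (u s) := by
  have hsub : Icc t D.T ⊆ Icc 0 D.T := Icc_subset_Icc ht.1 le_rfl
  have htt : t ∈ Icc t D.T := left_mem_Icc.2 ht.2
  have hTT : D.T ∈ Icc t D.T := right_mem_Icc.2 ht.2
  have hprim := (((hD.isMatPrim_value hΥ hf ht).mono ht.1 le_rfl).mulVec hX).dotProduct hX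
  have hXc := hX.continuousOn
  have hq : IntegrableOn (fun s => (D.Q t s *ᵥ X s) ⬝ᵥ X s + 2 * ((D.S t s *ᵥ X s) ⬝ᵥ u s))
      (Icc t D.T) := by
    have h1 : VecLp ⊤ t D.T (fun s => D.Q t s *ᵥ X s) := VecLp.of_continuousOn
      (((hD.Q_C1.continuousOn_right ht).mono hsub).matMulVec hXc)
    have h2 : VecLp ⊤ t D.T (fun s => D.S t s *ᵥ X s) := VecLp.of_continuousOn
      (((hD.S_C1.continuousOn_right ht).mono hsub).matMulVec hXc)
    have h3 : MemLp (fun s => (D.Q t s *ᵥ X s) ⬝ᵥ X s) ⊤ (volume.restrict (Icc t D.T)) :=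
      h1.dotProduct (VecLp.of_continuousOn hXc)
    have h4 : MemLp (fun s => (D.S t s *ᵥ X s) ⬝ᵥ u s) 2 (volume.restrict (Icc t D.T)) :=
      h2.dotProduct hu
    exact (h3.integrable le_top).add ((h4.integrable one_le_two).const_mul 2)
  have hm : IntegrableOn (fun s => (D.M t s *ᵥ u s) ⬝ᵥ u s) (Icc t D.T) := by
    have h1 : VecLp 2 t D.T (fun s => D.M t s *ᵥ u s) := (MatLp.of_continuousOn
      ((hD.M_C1.continuousOn_right ht).mono hsub)).mulVec hu
    exact memLp_one_iff_integrable.1 (h1.dotProduct hu)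
  have e : EqOn (fun s => D.excess Υ (D.value Υ Ψ Y t s) t s (X s) (u s)) _ (Icc t D.T) :=
    fun s hs => (excess_eq (Υ := Υ) (hD.value_symm (Υ := Υ) (Ψ := Ψ) (Y := Y) ht (hsub hs))
      (hD.M_symm ht (hsub hs)) (X s) (u s)).symm
  refine ⟨((hq.add hm).add hprim.1).congr_fun e.symm measurableSet_Icc, ?_⟩
  have e' := intervalIntegral.integral_congr (μ := volume) (a := t) (b := D.T)
    (e.mono (uIcc_of_le ht.2).le)
  beta_reduce at e'
  rw [e']
  have h1 := intervalIntegral.integral_add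
    ((hq.add hm).intervalIntegrable_of_mem htt hTT) (hprim.1.intervalIntegrable_of_mem htt hTT)
  have h2 := intervalIntegral.integral_add
    (hq.intervalIntegrable_of_mem htt hTT) (hm.intervalIntegrable_of_mem htt hTT)
  have h3 := hprim.sub_eq htt hTT
  rw [hD.value_terminal hf] at h3
  simp only [Pi.add_apply] at h1 h2
  rw [h1, h2, ← h3, cost]
  ring

/-- Well-posedness of the closed loop for affine feedback laws with square integrable
coefficients. -/
theorem exists_closedLoop (hD : D.Assumptions) {t : ℝ} (ht : t ∈ Icc 0 D.T)
    {ub : ℝ → (Fin n → ℝ) → Fin m → ℝ} {K : ℝ → Matrix (Fin m) (Fin n) ℝ} {c : ℝ → Fin m → ℝ}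
    (hK : MatLp 2 t D.T K) (hc : VecLp 2 t D.T c)
    (hub : ∀ s ∈ Icc t D.T, ∀ y, ub s y = K s *ᵥ y + c s) (x : Fin n → ℝ) :
    ∃ X, D.IsClosedLoop ub t x X ∧
      ∀ Z, D.IsClosedLoop ub t x Z → EqOn Z X (Icc t D.T) := by
  have hA := hD.matLp_A.mono ht.1 le_rfl
  have hB := hD.matLp_B.mono ht.1 le_rfl
  have hBK : MatLp 2 t D.T (fun s => D.B s * K s) := hB.mul hK
  have hF : MatLp 1 t D.T (fun s => D.A s + D.B s * K s) := hA.add (hBK.of_le one_le_two)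
  have hβ : VecLp 2 t D.T (fun s => D.B s *ᵥ c s) := hB.mulVec hc
  obtain ⟨Ψ, Y, hf⟩ := exists_isFundamental ht.2 hF.integrable
  obtain ⟨X, hX, hX0⟩ := hf.exists_vecPrim ht.2 (hβ.of_le one_le_two).integrable x
  have e : ∀ Z : ℝ → Fin n → ℝ, EqOn (fun s => D.A s *ᵥ Z s + D.B s *ᵥ ub s (Z s))
      (fun s => (D.A s + D.B s * K s) *ᵥ Z s + D.B s *ᵥ c s) (Icc t D.T) := fun Z s hs => by
    simp only [hub s hs, Matrix.add_mulVec, Matrix.mulVec_add, ← Matrix.mulVec_mulVec, add_assoc]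
  refine ⟨X, isState_of_isVecPrim (hX.congr_on (fun _ _ => rfl) (e X)) hX0, fun Z hZ => ?_⟩
  have hu : VecLp 2 t D.T (fun s => ub s (Z s)) := by
    have h1 : VecLp 2 t D.T (fun s => K s *ᵥ Z s) := hK.mulVec (VecLp.of_continuousOn hZ.1)
    exact (h1.add hc).congr_on fun s hs => hub s hs _
  obtain ⟨hZ1, hZ2⟩ := isVecPrim_of_isState hD ht hu hZ
  exact hf.vecPrim_unique (hZ1.congr_on (fun _ _ => rfl) (e Z).symm) hX (hZ2.trans hX0.symm)

theorem closedLoop_spec (hD : D.Assumptions) {t : ℝ} (ht : t ∈ Icc 0 D.T)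
    {ub : ℝ → (Fin n → ℝ) → Fin m → ℝ} {K : ℝ → Matrix (Fin m) (Fin n) ℝ} {c : ℝ → Fin m → ℝ}
    (hK : MatLp 2 t D.T K) (hc : VecLp 2 t D.T c)
    (hub : ∀ s ∈ Icc t D.T, ∀ y, ub s y = K s *ᵥ y + c s) (x : Fin n → ℝ) :
    VecLp 2 t D.T (fun s => ub s (D.closedLoop ub t x s)) ∧
    IsVecPrim t D.T (D.closedLoop ub t x) (fun s => D.A s *ᵥ D.closedLoop ub t x s
      + D.B s *ᵥ ub s (D.closedLoop ub t x s)) ∧ D.closedLoop ub t x t = x := by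
  have hX : D.IsClosedLoop ub t x (D.closedLoop ub t x) := by
    obtain ⟨X, hX, -⟩ := exists_closedLoop hD ht hK hc hub x
    exact Classical.epsilon_spec (p := fun X => D.IsClosedLoop ub t x X) ⟨X, hX⟩
  have hu : VecLp 2 t D.T (fun s => ub s (D.closedLoop ub t x s)) := by
    have h1 : VecLp 2 t D.T (fun s => K s *ᵥ D.closedLoop ub t x s) :=
      hK.mulVec (VecLp.of_continuousOn hX.1)
    exact (h1.add hc).congr_on fun s hs => hub s hs _
  exact ⟨hu, isVecPrim_of_isState hD ht hu hX⟩

theorem exists_constant_state (hD : D.Assumptions) {t : ℝ} (ht : t ∈ Icc 0 D.T) (x : Fin n → ℝ)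
    (v : Fin m → ℝ) : ∃ X : ℝ → Fin n → ℝ,
      IsVecPrim t D.T X (fun s => D.A s *ᵥ X s + D.B s *ᵥ v) ∧ X t = x := by
  have hc : VecLp 2 t D.T (fun _ => v) := (VecLp.of_continuousOn continuousOn_const).of_le le_top
  have hK : MatLp 2 t D.T (fun _ => (0 : Matrix (Fin m) (Fin n) ℝ)) :=
    (MatLp.of_continuousOn continuousOn_const).of_le le_top
  exact ⟨_, (closedLoop_spec hD ht (ub := fun _ _ => v) hK hc (fun s _ y => by simp) x).2⟩

theorem J_feedback (hD : D.Assumptions) (hΥ : MatLp 2 0 D.T Υ)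
    (hf : IsFundamental 0 D.T (fun s => D.A s - D.B s * Υ s) Ψ Y)
    {ub : ℝ → (Fin n → ℝ) → Fin m → ℝ} (hub : ∀ s ∈ Icc 0 D.T, ∀ y, ub s y = -(Υ s *ᵥ y))
    {t : ℝ} (ht : t ∈ Icc 0 D.T) (x : Fin n → ℝ) :
    D.J t x ub = (D.value Υ Ψ Y t t *ᵥ x) ⬝ᵥ x := by
  have hc : VecLp 2 t D.T (fun _ => (0 : Fin m → ℝ)) :=
    (VecLp.of_continuousOn continuousOn_const).of_le le_top
  obtain ⟨hu, hX, h0⟩ := closedLoop_spec hD ht (hΥ.mono ht.1 le_rfl).neg hc (ub := ub)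
    (fun s hs y => by rw [hub s ⟨ht.1.trans hs.1, hs.2⟩, Matrix.neg_mulVec, add_zero]) x
  rw [J, (cost_eq hD hΥ hf ht hu hX).2, h0]
  rw [intervalIntegral.integral_congr (g := fun _ => 0), intervalIntegral.integral_zero, add_zero]
  intro s hs
  rw [uIcc_of_le ht.2] at hs
  simp only [hub s ⟨ht.1.trans hs.1, hs.2⟩, excess_feedback]

/-- The first-order expansion of the cost under a spike perturbation, in exact form. -/
theorem J_perturb_sub (hD : D.Assumptions) (hΥ : MatLp 2 0 D.T Υ)
    (hf : IsFundamental 0 D.T (fun s => D.A s - D.B s * Υ s) Ψ Y)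
    {ub : ℝ → (Fin n → ℝ) → Fin m → ℝ} (hub : ∀ s ∈ Icc 0 D.T, ∀ y, ub s y = -(Υ s *ᵥ y))
    {t ε : ℝ} (ht : t ∈ Icc 0 D.T) (hε : 0 < ε) (htε : t + ε ≤ D.T) {x : Fin n → ℝ}
    {v : Fin m → ℝ} {X : ℝ → Fin n → ℝ}
    (hX : IsVecPrim t D.T X (fun s => D.A s *ᵥ X s + D.B s *ᵥ v)) (hX0 : X t = x) :
    D.J t x (perturb ub t ε v) - D.J t x ub =
      ∫ s in t..t + ε, D.excess Υ (D.value Υ Ψ Y t s) t s (X s) v := by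
  classical
  have hmem : ∀ {s}, s ∈ Icc t D.T → s ∈ Icc 0 D.T := fun hs => ⟨ht.1.trans hs.1, hs.2⟩
  have hK : MatLp 2 t D.T (fun s => if s ∈ Icc t (t + ε) then 0 else - Υ s) := fun i j => by
    refine (((hΥ.mono ht.1 le_rfl).neg i j).indicator
      (measurableSet_Icc (a := t) (b := t + ε)).compl).ae_eq (ae_of_all _ fun s => ?_)
    beta_reduce
    by_cases h : s ∈ Icc t (t + ε)
    · rw [indicator_of_notMem (by simpa using h), if_pos h, Matrix.zero_apply]
    · rw [indicator_of_mem (by simpa using h), if_neg h]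
  have hc : VecLp 2 t D.T (fun s => if s ∈ Icc t (t + ε) then v else 0) := fun i => by
    refine ((memLp_const (v i)).indicator
      (measurableSet_Icc (a := t) (b := t + ε))).ae_eq (ae_of_all _ fun s => ?_)
    beta_reduce
    by_cases h : s ∈ Icc t (t + ε)
    · rw [indicator_of_mem h, if_pos h]
    · rw [indicator_of_notMem h, if_neg h, Pi.zero_apply]
  obtain ⟨hu, hZ, hZ0⟩ := closedLoop_spec hD ht hK hc (ub := perturb ub t ε v)
    (fun s hs y => by
      by_cases h : s ∈ Icc t (t + ε)
      · simp only [perturb, if_pos h, Matrix.zero_mulVec, zero_add]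
      · simp only [perturb, if_neg h, hub s (hmem hs), Matrix.neg_mulVec, add_zero]) x
  rw [J_feedback hD hΥ hf hub ht, J]
  obtain ⟨hi, hcost⟩ := cost_eq hD hΥ hf ht hu hZ
  rw [hcost, hZ0, add_sub_cancel_left]
  have hm : t + ε ∈ Icc t D.T := ⟨by linarith, htε⟩
  rw [← intervalIntegral.integral_add_adjacent_intervals
    (hi.intervalIntegrable_of_mem (left_mem_Icc.2 ht.2) hm)
    (hi.intervalIntegrable_of_mem hm (right_mem_Icc.2 ht.2))]
  have e2 : ∫ s in t + ε..D.T, D.excess Υ (D.value Υ Ψ Y t s) t s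
      (D.closedLoop (perturb ub t ε v) t x s)
      (perturb ub t ε v s (D.closedLoop (perturb ub t ε v) t x s)) = 0 := by
    refine intervalIntegral.integral_zero_ae (ae_of_all _ fun s hs => ?_)
    rw [uIoc_of_le htε] at hs
    have h : s ∉ Icc t (t + ε) := fun h => absurd h.2 (not_le.2 hs.1)
    simp only [perturb, if_neg h, hub s ⟨by linarith [ht.1, hs.1], hs.2⟩, excess_feedback]
  rw [e2, add_zero]
  have hZ' : IsVecPrim t (t + ε) (D.closedLoop (perturb ub t ε v) t x)
      (fun s => D.A s *ᵥ D.closedLoop (perturb ub t ε v) t x s + D.B s *ᵥ v) :=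
    (hZ.mono le_rfl htε).congr_on (fun _ _ => rfl) fun s hs => by simp only [perturb, if_pos hs]
  obtain ⟨Ψ', Y', hf'⟩ := exists_isFundamental (a := t) (b := t + ε) (by linarith)
    (hD.matLp_A.mono ht.1 htε).integrable
  have heq := hf'.vecPrim_unique hZ' (hX.mono le_rfl htε) (hZ0.trans hX0.symm)
  refine intervalIntegral.integral_congr fun s hs => ?_
  rw [uIcc_of_le (by linarith)] at hs
  simp only [heq hs, perturb, if_pos hs]

end LQProblem

/-! ### Right means -/

/-- `g` is integrable on `[t,T]` and its means over `[t, t + ε]` tend to `L`. -/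
def HasRightMean (t T : ℝ) (g : ℝ → ℝ) (L : ℝ) : Prop :=
  IntegrableOn g (Icc t T) ∧ Tendsto (fun ε => (∫ s in t..t + ε, g s) / ε) (𝓝[>] 0) (𝓝 L)

theorem eventually_add_mem_Icc {t T : ℝ} (htT : t < T) :
    ∀ᶠ ε in 𝓝[>] (0 : ℝ), 0 < ε ∧ t + ε ∈ Icc t T := by
  filter_upwards [Ioo_mem_nhdsGT (sub_pos.2 htT)] with ε hε
  exact ⟨hε.1, by linarith [hε.1], by linarith [hε.2]⟩

namespace HasRightMean

variable {t T : ℝ} {g g₁ g₂ c : ℝ → ℝ} {L L₁ L₂ : ℝ}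

theorem add (htT : t < T) (h₁ : HasRightMean t T g₁ L₁) (h₂ : HasRightMean t T g₂ L₂) :
    HasRightMean t T (fun s => g₁ s + g₂ s) (L₁ + L₂) := by
  refine ⟨h₁.1.add h₂.1, (h₁.2.add h₂.2).congr' ?_⟩
  filter_upwards [eventually_add_mem_Icc htT] with ε hε
  have ht : t ∈ Icc t T := left_mem_Icc.2 htT.le
  rw [intervalIntegral.integral_add (h₁.1.intervalIntegrable_of_mem ht hε.2)
    (h₂.1.intervalIntegrable_of_mem ht hε.2), add_div]

theorem const_mul (a : ℝ) (h : HasRightMean t T g L) :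
    HasRightMean t T (fun s => a * g s) (a * L) := by
  refine ⟨h.1.const_mul a, (h.2.const_mul a).congr fun ε => ?_⟩
  rw [intervalIntegral.integral_const_mul, mul_div_assoc]

theorem sub (htT : t < T) (h₁ : HasRightMean t T g₁ L₁) (h₂ : HasRightMean t T g₂ L₂) :
    HasRightMean t T (fun s => g₁ s - g₂ s) (L₁ - L₂) := by
  simpa [sub_eq_add_neg] using h₁.add htT (h₂.const_mul (-1))

theorem sum (htT : t < T) {ι : Type*} (w : Finset ι) {g : ι → ℝ → ℝ} {L : ι → ℝ}
    (h : ∀ i ∈ w, HasRightMean t T (g i) (L i)) :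
    HasRightMean t T (fun s => ∑ i ∈ w, g i s) (∑ i ∈ w, L i) := by
  classical
  induction w using Finset.induction_on with
  | empty => simp [HasRightMean]
  | insert i w hi ih =>
    simp only [Finset.sum_insert hi]
    exact (h i (by simp)).add htT (ih fun j hj => h j (by simp [hj]))

theorem congr_on (h : HasRightMean t T g L) (htT : t < T) (hg : EqOn g₁ g (Icc t T)) :
    HasRightMean t T g₁ L := by
  refine ⟨h.1.congr_fun hg.symm measurableSet_Icc, h.2.congr' ?_⟩
  filter_upwards [eventually_add_mem_Icc htT] with ε hε
  rw [intervalIntegral.integral_congr]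
  exact fun s hs => (hg (uIcc_subset_Icc (left_mem_Icc.2 htT.le) hε.2 hs)).symm

/-- A continuous factor that vanishes at `t` annihilates bounded means. -/
theorem mul_of_zero (htT : t < T) (hc : ContinuousOn c (Icc t T)) (hc0 : c t = 0)
    (hg : IntegrableOn g (Icc t T)) {C : ℝ}
    (hC : ∀ᶠ ε in 𝓝[>] 0, (∫ s in t..t + ε, |g s|) / ε ≤ C) :
    HasRightMean t T (fun s => c s * g s) 0 := by
  have hi := hg.continuousOn_mul hc isCompact_Icc
  refine ⟨hi, Metric.tendsto_nhds.2 fun δ hδ => ?_⟩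
  have hC0 : 0 < |C| + 1 := by positivity
  have hcont := hc t (left_mem_Icc.2 htT.le)
  have h1 : ∀ᶠ s in 𝓝[Icc t T] t, |c s| < δ / (|C| + 1) := by
    have := Metric.tendsto_nhds.1 hcont (δ / (|C| + 1)) (by positivity)
    simpa [Real.dist_eq, hc0] using this
  rw [eventually_nhdsWithin_iff, Metric.eventually_nhds_iff] at h1
  obtain ⟨η, hη, h1⟩ := h1
  filter_upwards [hC, eventually_add_mem_Icc htT, Ioo_mem_nhdsGT hη] with ε h2 h3 h4
  have ht : t ∈ Icc t T := left_mem_Icc.2 htT.le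
  have h5 : |∫ s in t..t + ε, c s * g s| ≤ δ / (|C| + 1) * ∫ s in t..t + ε, |g s| := by
    rw [← intervalIntegral.integral_const_mul, ← Real.norm_eq_abs]
    refine intervalIntegral.norm_integral_le_of_norm_le h3.2.1 (ae_of_all _ fun s hs => ?_) ?_
    · rw [norm_mul, Real.norm_eq_abs, Real.norm_eq_abs]
      refine mul_le_mul_of_nonneg_right (h1 ?_ ⟨hs.1.le, hs.2.trans h3.2.2⟩).le (abs_nonneg _)
      rw [Real.dist_eq, abs_of_pos (by linarith [hs.1])]
      linarith [hs.2, h4.2]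
    · exact (IntegrableOn.intervalIntegrable_of_mem hg.abs ht h3.2).const_mul _
  rw [Real.dist_eq, sub_zero, abs_div, abs_of_pos h3.1]
  calc |∫ s in t..t + ε, c s * g s| / ε
      ≤ (δ / (|C| + 1) * ∫ s in t..t + ε, |g s|) / ε := by gcongr; exact h3.1.le
    _ = δ / (|C| + 1) * ((∫ s in t..t + ε, |g s|) / ε) := by ring
    _ ≤ δ / (|C| + 1) * |C| := by
        gcongr
        exact h2.trans (le_abs_self C)
    _ < δ := by
        rw [div_mul_eq_mul_div, div_lt_iff₀ hC0]
        nlinarith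

/-- A continuous factor that vanishes at `t` annihilates essentially bounded functions. -/
theorem mul_of_zero_of_memLp (htT : t < T) (hc : ContinuousOn c (Icc t T)) (hc0 : c t = 0)
    (hg : MemLp g ⊤ (volume.restrict (Icc t T))) :
    HasRightMean t T (fun s => c s * g s) 0 := by
  obtain ⟨C, hC⟩ : ∃ C : ℝ, ∀ᵐ s, s ∈ Icc t T → |g s| ≤ C := by
    refine ⟨(eLpNorm g ⊤ (volume.restrict (Icc t T))).toReal, ?_⟩
    rw [← ae_restrict_iff' measurableSet_Icc]
    filter_upwards [enorm_ae_le_eLpNormEssSup g (volume.restrict (Icc t T))] with s hs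
    rw [← eLpNorm_exponent_top] at hs
    rw [← Real.norm_eq_abs, ← toReal_enorm]
    exact ENNReal.toReal_mono hg.2.ne hs
  have hgi : IntegrableOn g (Icc t T) := hg.integrable le_top
  refine mul_of_zero (C := C) htT hc hc0 hgi ?_
  filter_upwards [eventually_add_mem_Icc htT] with ε hε
  rw [div_le_iff₀ hε.1]
  have h1 : ∫ s in t..t + ε, |g s| ≤ ∫ _ in t..t + ε, C := by
    refine intervalIntegral.integral_mono_ae_restrict hε.2.1
      (IntegrableOn.intervalIntegrable_of_mem hgi.abs (left_mem_Icc.2 htT.le) hε.2)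
      intervalIntegrable_const ?_
    rw [Filter.EventuallyLE, ae_restrict_iff' measurableSet_Icc]
    filter_upwards [hC] with s hs hs'
    exact hs ⟨hs'.1, hs'.2.trans hε.2.2⟩
  simpa [mul_comm] using h1

theorem of_continuousOn (htT : t < T) (hc : ContinuousOn c (Icc t T)) :
    HasRightMean t T c (c t) := by
  have h1 : HasRightMean t T (fun s => (c s - c t) * 1) 0 :=
    mul_of_zero_of_memLp htT (hc.sub continuousOn_const) (sub_self _) (memLp_const 1)
  have h2 : HasRightMean t T (fun _ => c t) (c t) := by
    refine ⟨integrableOn_const (by simp), tendsto_const_nhds.congr' ?_⟩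
    filter_upwards [self_mem_nhdsWithin] with ε hε
    have hε' : ε ≠ 0 := (mem_Ioi.1 hε).ne'
    simp [hε']
  simpa using h1.add htT h2

end HasRightMean

/-- The means of `g` and of `|g|` over `[t, t + ε]` tend to `g t` and `|g t|`. -/
def IsRightLebesgue (t T : ℝ) (g : ℝ → ℝ) : Prop :=
  HasRightMean t T g (g t) ∧ HasRightMean t T (fun s => |g s|) |g t|

theorem ae_isRightLebesgue {T : ℝ} {g : ℝ → ℝ} (hg : IntegrableOn g (Icc 0 T)) :
    ∀ᵐ t, t ∈ Ico 0 T → IsRightLebesgue t T g := by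
  have key : ∀ {g : ℝ → ℝ}, IntegrableOn g (Icc 0 T) →
      ∀ᵐ t, t ∈ Ico 0 T → HasRightMean t T g (g t) := by
    intro g hg
    by_cases hT : 0 ≤ T
    swap
    · exact ae_of_all _ fun t ht => absurd (ht.1.trans ht.2.le) hT
    filter_upwards [(hg.intervalIntegrable_of_mem (left_mem_Icc.2 hT)
      (right_mem_Icc.2 hT)).ae_hasDerivAt_integral] with t h ht
    refine ⟨hg.mono_set (Icc_subset_Icc ht.1 le_rfl), ?_⟩
    rw [uIcc_of_le hT] at h
    have h1 := (h ⟨ht.1, ht.2.le⟩ t ⟨ht.1, ht.2.le⟩).hasDerivWithinAt (s := Ioi t)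
    rw [hasDerivWithinAt_iff_tendsto_slope' (by simp)] at h1
    have h2 : Tendsto (fun ε => t + ε) (𝓝[>] (0 : ℝ)) (𝓝[>] t) := by
      refine tendsto_nhdsWithin_iff.2 ⟨?_, ?_⟩
      · have : Tendsto (fun ε => t + ε) (𝓝 (0 : ℝ)) (𝓝 (t + 0)) :=
          tendsto_const_nhds.add tendsto_id
        rw [add_zero] at this
        exact this.mono_left nhdsWithin_le_nhds
      · filter_upwards [self_mem_nhdsWithin] with ε hε
        exact lt_add_of_pos_right t hε
    refine (h1.comp h2).congr fun ε => ?_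
    simp [slope, div_eq_inv_mul]
  filter_upwards [key hg, key hg.abs] with t h1 h2 ht
  exact ⟨h1 ht, h2 ht⟩

theorem IsRightLebesgue.continuousOn_mul {t T : ℝ} {g c : ℝ → ℝ} (htT : t < T)
    (h : IsRightLebesgue t T g) (hc : ContinuousOn c (Icc t T)) :
    HasRightMean t T (fun s => c s * g s) (c t * g t) := by
  have h1 : ∀ᶠ ε in 𝓝[>] 0, (∫ s in t..t + ε, |g s|) / ε ≤ |g t| + 1 :=
    (h.2.2.eventually (gt_mem_nhds (lt_add_one _))).mono fun _ h => h.le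
  have h2 : HasRightMean t T (fun s => (c s - c t) * g s) 0 :=
    HasRightMean.mul_of_zero htT (hc.sub continuousOn_const) (sub_self _) h.1.1 h1
  have h3 := h2.add htT (h.1.const_mul (c t))
  rw [zero_add] at h3
  exact h3.congr_on htT fun s _ => by ring

theorem HasRightMean.bilinear {κ l : Type*} [Fintype κ] [Fintype l] {t T : ℝ} (htT : t < T)
    {K : ℝ → Matrix κ l ℝ} (hK : ∀ i j, IsRightLebesgue t T (fun s => K s i j))
    {a : ℝ → κ → ℝ} {b : ℝ → l → ℝ} (ha : ContinuousOn a (Icc t T))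
    (hb : ContinuousOn b (Icc t T)) :
    HasRightMean t T (fun s => a s ⬝ᵥ (K s *ᵥ b s)) (a t ⬝ᵥ (K t *ᵥ b t)) := by
  have e : ∀ s, a s ⬝ᵥ (K s *ᵥ b s) = ∑ i, ∑ j, (a s i * b s j) * K s i j := fun s => by
    simp only [dotProduct, Matrix.mulVec, Finset.mul_sum]
    exact Finset.sum_congr rfl fun i _ => Finset.sum_congr rfl fun j _ => by ring
  simp only [e]
  exact HasRightMean.sum htT _ fun i _ => HasRightMean.sum htT _ fun j _ =>
    (hK i j).continuousOn_mul htT ((continuousOn_pi.1 ha i).mul (continuousOn_pi.1 hb j))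

theorem HasRightMean.dotProduct_of_zero {κ : Type*} [Fintype κ] {t T : ℝ} (htT : t < T)
    {a g : ℝ → κ → ℝ} (ha : ContinuousOn a (Icc t T)) (ha0 : a t = 0) (hg : VecLp ⊤ t T g) :
    HasRightMean t T (fun s => a s ⬝ᵥ g s) 0 := by
  have := HasRightMean.sum htT Finset.univ fun i _ =>
    HasRightMean.mul_of_zero_of_memLp htT (continuousOn_pi.1 ha i) (congrFun ha0 i) (hg i)
  simpa [dotProduct] using this

theorem HasRightMean.bilinear_of_zero {κ l : Type*} [Fintype κ] [Fintype l] {t T : ℝ}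
    (htT : t < T) {K : ℝ → Matrix κ l ℝ} (hK : ContinuousOn K (Icc t T)) (hK0 : K t = 0)
    {a : ℝ → κ → ℝ} {b : ℝ → l → ℝ} (ha : VecLp ⊤ t T a) (hb : VecLp ⊤ t T b) :
    HasRightMean t T (fun s => (K s *ᵥ b s) ⬝ᵥ a s) 0 := by
  have e : ∀ s, (K s *ᵥ b s) ⬝ᵥ a s = ∑ i, ∑ j, K s i j * (b s j * a s i) := fun s => by
    simp only [dotProduct, Matrix.mulVec, Finset.sum_mul]
    exact Finset.sum_congr rfl fun i _ => Finset.sum_congr rfl fun j _ => by ring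
  simp only [e]
  have := HasRightMean.sum htT Finset.univ fun i _ => HasRightMean.sum htT Finset.univ fun j _ =>
    HasRightMean.mul_of_zero_of_memLp htT (c := fun s => K s i j) (hK.matrix_entry i j)
      (by simp [hK0]) ((ha i).mul' (r := ⊤) (hb j))
  simpa using this

theorem EReal.liminf_coe_of_tendsto {f : ℝ → ℝ} {l : Filter ℝ} [l.NeBot] {L : ℝ}
    (h : Tendsto f l (𝓝 L)) : liminf (fun ε => (f ε : EReal)) l = L :=
  ((continuous_coe_real_ereal.tendsto L).comp h).liminf_eq

theorem IsPrim.of_base {a b c v : ℝ} {f g : ℝ → ℝ} (hg : IntegrableOn g (Icc a b))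
    (hc : c ∈ Icc a b) (h : ∀ s ∈ Icc a b, f s = v + ∫ r in c..s, g r) : IsPrim a b f g := by
  refine ⟨hg, fun s hs => ?_⟩
  have ha : a ∈ Icc a b := left_mem_Icc.2 (hc.1.trans hc.2)
  rw [h s hs, h a ha, add_assoc, intervalIntegral.integral_add_adjacent_intervals
    (hg.intervalIntegrable_of_mem hc ha) (hg.intervalIntegrable_of_mem ha hs)]

namespace LQProblem

variable {n m : ℕ} {D : LQProblem n m} {Υ : ℝ → Matrix (Fin m) (Fin n) ℝ}
  {F Ψ Y P : ℝ → Matrix (Fin n) (Fin n) ℝ} {Φ : ℝ → ℝ → Matrix (Fin n) (Fin n) ℝ}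

theorem IsTransition.eq (hF : MatLp 1 0 D.T F) (hf : IsFundamental 0 D.T F Ψ Y)
    (hΦ : D.IsTransition F Φ) {t s : ℝ} (ht : t ∈ Icc 0 D.T) (hs : s ∈ Icc 0 D.T) :
    Φ t s = Ψ t * Y s := by
  obtain ⟨hc, h⟩ := hΦ s hs
  have hi : MatLp 1 0 D.T (fun r => F r * Φ r s) := hF.mul (MatLp.of_continuousOn hc)
  have hp : IsMatPrim 0 D.T (fun r => Φ r s) (fun r => F r * Φ r s) := fun i j =>
    IsPrim.of_base (v := (1 : Matrix (Fin n) (Fin n) ℝ) i j) (hi.integrable i j) hs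
      fun r hr => congrFun₂ (h r hr) i j
  have h1 : Φ s s = 1 := by
    rw [h s hs]
    ext i j
    simp [matIntegral]
  rw [hf.matPrim_eq hp ht hs, h1, Matrix.mul_one]

theorem isTransition_of_isFundamental (hf : IsFundamental 0 D.T F Ψ Y) :
    D.IsTransition F (fun t s => Ψ t * Y s) := by
  intro s hs
  have hp : IsMatPrim 0 D.T (fun t => Ψ t * Y s) (fun t => F t * (Ψ t * Y s)) :=
    (hf.prim.mul (IsMatPrim.const (Y s))).congr_on (fun _ _ => rfl)
      (fun t _ => by simp [Matrix.mul_assoc])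
  refine ⟨hp.continuousOn, fun t ht => ?_⟩
  ext i j
  have := (hp i j).sub_eq hs ht
  simp only [hf.mul_inv s hs] at this
  rw [Matrix.add_apply, matIntegral, Matrix.of_apply, ← this]
  ring

theorem nonlocalWeight_congr {Υ' : ℝ → Matrix (Fin m) (Fin n) ℝ}
    {Φ' : ℝ → ℝ → Matrix (Fin n) (Fin n) ℝ} {t : ℝ} (ht : t ∈ Icc 0 D.T)
    (hΥ : Υ =ᵐ[volume.restrict (Icc 0 D.T)] Υ') (hΦ : ∀ s ∈ Icc 0 D.T, Φ s t = Φ' s t) :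
    D.nonlocalWeight Υ Φ t = D.nonlocalWeight Υ' Φ' t := by
  have hT : D.T ∈ Icc 0 D.T := right_mem_Icc.2 (ht.1.trans ht.2)
  have hmem : ∀ᵐ s ∂volume.restrict (Icc 0 D.T), s ∈ Icc 0 D.T := ae_restrict_mem measurableSet_Icc
  rw [nonlocalWeight, nonlocalWeight, hΦ D.T hT]
  congr 1
  · congr 1
    refine matIntegral_congr_ae ?_ ht hT
    filter_upwards [hmem] with s hs
    rw [hΦ s hs]
  · refine matIntegral_congr_ae ?_ ht hT
    filter_upwards [hmem, hΥ] with s hs h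
    rw [hΦ s hs, h]

theorem Assumptions.M_mul_Upsilon (hD : D.Assumptions) (P : ℝ → Matrix (Fin n) (Fin n) ℝ) {s : ℝ}
    (hs : s ∈ Icc 0 D.T) : D.M s s * D.Upsilon P s = (D.B s)ᵀ * P s + D.S s s := by
  rw [Upsilon, ← Matrix.mul_assoc, hD.M_mul_Minv hs, Matrix.one_mul]

theorem Assumptions.riccati_eq_lyapunov (hD : D.Assumptions)
    (P : ℝ → Matrix (Fin n) (Fin n) ℝ) (W : Matrix (Fin n) (Fin n) ℝ) {s : ℝ}
    (hs : s ∈ Icc 0 D.T) :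
    (D.A s)ᵀ * P s + P s * D.A s + W
        - (P s * D.B s + (D.S s s)ᵀ) * D.Minv s * ((D.B s)ᵀ * P s + D.S s s) =
      (D.A s - D.B s * D.Upsilon P s)ᵀ * P s + P s * (D.A s - D.B s * D.Upsilon P s)
        + (D.weight (D.Upsilon P) s s - D.Q s s + W) := by
  have h := hD.M_mul_Upsilon P hs
  have e : (P s * D.B s + (D.S s s)ᵀ) * D.Minv s * ((D.B s)ᵀ * P s + D.S s s) =
      (P s * D.B s + (D.S s s)ᵀ) * D.Upsilon P s := by
    rw [Upsilon, Matrix.mul_assoc]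
  rw [e]
  simp only [weight, runWeight, Matrix.mul_assoc _ (D.M s s), h]
  simp only [Matrix.transpose_sub, Matrix.transpose_mul, Matrix.mul_add, Matrix.add_mul,
    Matrix.mul_sub, Matrix.sub_mul, Matrix.mul_assoc]
  abel

theorem Assumptions.matLp_Upsilon (hD : D.Assumptions) (hP : ContinuousOn P (Icc 0 D.T)) :
    MatLp ⊤ 0 D.T (D.Upsilon P) := by
  have h1 : MatLp ⊤ 0 D.T (fun s => (D.B s)ᵀ * P s) :=
    hD.matLp_B.transpose.mul (MatLp.of_continuousOn hP)
  have h2 := h1.add (MatLp.of_continuousOn hD.S_C1.continuousOn_diag)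
  exact (MatLp.of_continuousOn hD.continuousOn_Minv).mul h2

/-- A solution of the Riccati equation is the value matrix of its feedback, on the diagonal. -/
theorem Assumptions.value_eq_of_isRiccatiSolution (hD : D.Assumptions)
    (hP : D.IsRiccatiSolution P)
    (hf : IsFundamental 0 D.T (fun s => D.A s - D.B s * D.Upsilon P s) Ψ Y) {s : ℝ}
    (hs : s ∈ Icc 0 D.T) : D.value (D.Upsilon P) Ψ Y s s = P s := by
  obtain ⟨hPc, -, Φ, hΦ, hric⟩ := hP
  have hΥ2 := (hD.matLp_Upsilon hPc).of_le (q := 2) le_top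
  have hF := hD.matLp_closedLoop hΥ2
  have hdiag := hD.isMatPrim_value_diag hΥ2 hf
  have hQ : ∀ s ∈ Icc 0 D.T, D.Qbar P Φ s =
      D.nonlocalWeight (D.Upsilon P) (fun r s => Ψ r * Y s) s := fun s hs =>
    nonlocalWeight_congr hs EventuallyEq.rfl fun r hr => hΦ.eq hF hf hr hs
  have hΨ := hf.prim.continuousOn
  have hY := hf.prim_inv.continuousOn
  have hPL := MatLp.of_continuousOn hPc
  have hSL := MatLp.of_continuousOn hD.S_C1.continuousOn_diag
  have hML := MatLp.of_continuousOn hD.continuousOn_Minv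
  have hInt : MatLp 1 0 D.T (fun s => (D.A s)ᵀ * P s + P s * D.A s + D.Qbar P Φ s
      - (P s * D.B s + (D.S s s)ᵀ) * D.Minv s * ((D.B s)ᵀ * P s + D.S s s)) := by
    have h1 : MatLp 1 0 D.T (fun s => (D.A s)ᵀ * P s) := hD.matLp_A.transpose.mul hPL
    have h2 : MatLp 1 0 D.T (fun s => P s * D.A s) := hPL.mul hD.matLp_A
    have h3 : MatLp 1 0 D.T (D.Qbar P Φ) := (hD.matLp_nonlocalWeight hΥ2 hΨ hY).congr_on hQ
    have h4 : MatLp ⊤ 0 D.T (fun s => P s * D.B s) := hPL.mul hD.matLp_B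
    have h5 : MatLp ⊤ 0 D.T (fun s => (D.B s)ᵀ * P s) := hD.matLp_B.transpose.mul hPL
    have h6 : MatLp ⊤ 0 D.T (fun s => (P s * D.B s + (D.S s s)ᵀ) * D.Minv s) :=
      (h4.add hSL.transpose).mul hML
    have h7 : MatLp ⊤ 0 D.T (fun s => (P s * D.B s + (D.S s s)ᵀ) * D.Minv s *
      ((D.B s)ᵀ * P s + D.S s s)) := h6.mul (h5.add hSL)
    exact ((h1.add h2).add h3).sub (h7.of_le le_top)
  have hPp : IsMatPrim 0 D.T P (fun s => -((D.A s - D.B s * D.Upsilon P s)ᵀ * P s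
      + P s * (D.A s - D.B s * D.Upsilon P s) + (D.weight (D.Upsilon P) s s - D.Q s s
        + D.nonlocalWeight (D.Upsilon P) (fun r s => Ψ r * Y s) s))) := by
    have h1 : IsMatPrim 0 D.T P (fun s => -((D.A s)ᵀ * P s + P s * D.A s + D.Qbar P Φ s
        - (P s * D.B s + (D.S s s)ᵀ) * D.Minv s * ((D.B s)ᵀ * P s + D.S s s))) := fun i j =>
      IsPrim.of_terminal (c := D.G D.T i j) (hInt.integrable i j)
        fun s hs => congrFun₂ (hric s hs) i j
    refine h1.congr_on (fun _ _ => rfl) fun s hs => ?_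
    beta_reduce
    rw [← hD.riccati_eq_lyapunov P _ hs, hQ s hs]
  refine hf.lyapunov_unique hdiag hPp ?_ hs
  rw [hD.value_terminal hf, hric D.T hD.T_mem]
  ext i j
  simp [matIntegral]

theorem Assumptions.riccati_excess_mean (hD : D.Assumptions) (hPc : ContinuousOn P (Icc 0 D.T))
    (hf : IsFundamental 0 D.T (fun s => D.A s - D.B s * D.Upsilon P s) Ψ Y)
    (hval : ∀ s ∈ Icc 0 D.T, D.value (D.Upsilon P) Ψ Y s s = P s) {t : ℝ} (ht : t ∈ Ico 0 D.T)
    {X : ℝ → Fin n → ℝ} (hX : ContinuousOn X (Icc t D.T)) (v : Fin m → ℝ) :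
    HasRightMean t D.T (fun s => 2 * (((D.S t s + (D.B s)ᵀ * D.value (D.Upsilon P) Ψ Y t s
      - D.M t s * D.Upsilon P s) *ᵥ X s) ⬝ᵥ (v + D.Upsilon P s *ᵥ X s))) 0 := by
  have ht' : t ∈ Icc 0 D.T := ⟨ht.1, ht.2.le⟩
  have hsub : Icc t D.T ⊆ Icc 0 D.T := Icc_subset_Icc ht.1 le_rfl
  have hΥ := hD.matLp_Upsilon hPc
  have hΥX : VecLp ⊤ t D.T (fun s => D.Upsilon P s *ᵥ X s) :=
    (hΥ.mono ht.1 le_rfl).mulVec (VecLp.of_continuousOn hX)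
  have hw : VecLp ⊤ t D.T (fun s => v + D.Upsilon P s *ᵥ X s) :=
    (VecLp.of_continuousOn continuousOn_const).add hΥX
  have hBw : VecLp ⊤ t D.T (fun s => D.B s *ᵥ (v + D.Upsilon P s *ᵥ X s)) :=
    (hD.matLp_B.mono ht.1 le_rfl).mulVec hw
  have hS : ContinuousOn (fun s => D.S t s - D.S s s) (Icc t D.T) :=
    ((hD.S_C1.continuousOn_right ht').sub hD.S_C1.continuousOn_diag).mono hsub
  have hM : ContinuousOn (fun s => D.M t s - D.M s s) (Icc t D.T) :=
    ((hD.M_C1.continuousOn_right ht').sub hD.M_C1.continuousOn_diag).mono hsub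
  have hV : ContinuousOn (fun s => D.value (D.Upsilon P) Ψ Y t s - P s) (Icc t D.T) :=
    ((hD.isMatPrim_value (hΥ.of_le le_top) hf ht').continuousOn.sub hPc).mono hsub
  have h1 := HasRightMean.dotProduct_of_zero ht.2 (hS.matMulVec hX) (by simp) hw
  have h2 := HasRightMean.dotProduct_of_zero ht.2 (hV.matMulVec hX) (by simp [hval t ht']) hBw
  have h3 := HasRightMean.bilinear_of_zero ht.2 hM (by simp) hw hΥX
  have h4 := ((h1.add ht.2 h2).sub ht.2 h3).const_mul 2
  simp only [add_zero, sub_zero, mul_zero] at h4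
  refine h4.congr_on ht.2 fun s hs => ?_
  have hs' := hsub hs
  have e : D.S t s + (D.B s)ᵀ * D.value (D.Upsilon P) Ψ Y t s - D.M t s * D.Upsilon P s =
      (D.S t s - D.S s s) + (D.B s)ᵀ * (D.value (D.Upsilon P) Ψ Y t s - P s)
        - (D.M t s - D.M s s) * D.Upsilon P s := by
    rw [Matrix.sub_mul, hD.M_mul_Upsilon P hs', Matrix.mul_sub]
    abel
  beta_reduce
  rw [e, Matrix.sub_mulVec, Matrix.add_mulVec, ← Matrix.mulVec_mulVec, ← Matrix.mulVec_mulVec,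
    sub_dotProduct, add_dotProduct, Matrix.transpose_mulVec_dotProduct]

theorem Assumptions.isLinearEquilibrium_riccatiFeedback (hD : D.Assumptions)
    (hP : D.IsRiccatiSolution P) : D.IsLinearEquilibrium (D.riccatiFeedback P) := by
  have hPc := hP.1
  have hΥ := hD.matLp_Upsilon hPc
  have hΥ2 : MatLp 2 0 D.T (D.Upsilon P) := hΥ.of_le le_top
  obtain ⟨Ψ, Y, hf⟩ := exists_isFundamental hD.T_pos.le (hD.matLp_closedLoop hΥ2).integrable
  have hval := fun s (hs : s ∈ Icc 0 D.T) => hD.value_eq_of_isRiccatiSolution hP hf hs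
  have hub : ∀ s ∈ Icc 0 D.T, ∀ y, D.riccatiFeedback P s y = -(D.Upsilon P s *ᵥ y) :=
    fun _ _ _ => rfl
  refine ⟨⟨?_, ?_, ?_, ?_⟩, fun t => - D.Upsilon P t, fun t _ x => ?_⟩
  · have e : volume.restrict (Icc 0 D.T ×ˢ (univ : Set (Fin n → ℝ))) =
        (volume.restrict (Icc 0 D.T)).prod (volume : Measure (Fin n → ℝ)) := by
      rw [← Measure.restrict_univ (μ := (volume : Measure (Fin n → ℝ))), Measure.prod_restrict]
      rfl
    rw [e]
    refine aemeasurable_pi_lambda _ fun i => ?_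
    have h1 : ∀ j, AEMeasurable (fun p : ℝ × (Fin n → ℝ) => D.Upsilon P p.1 i j)
        ((volume.restrict (Icc 0 D.T)).prod volume) := fun j =>
      ((hΥ i j).1.aemeasurable).comp_quasiMeasurePreserving Measure.quasiMeasurePreserving_fst
    have h2 : AEMeasurable (fun p : ℝ × (Fin n → ℝ) => ∑ j, D.Upsilon P p.1 i j * p.2 j)
        ((volume.restrict (Icc 0 D.T)).prod volume) :=
      Finset.aemeasurable_fun_sum _ fun j _ =>
        (h1 j).mul (((measurable_pi_apply j).comp measurable_snd).aemeasurable)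
    exact h2.neg
  · intro X hX
    have h1 : VecLp 2 0 D.T (fun s => D.Upsilon P s *ᵥ X s) :=
      hΥ2.mulVec (VecLp.of_continuousOn hX)
    exact MemLp.of_eval h1.neg
  · intro t ht x
    have ht' : t ∈ Icc 0 D.T := ⟨ht.1, ht.2.le⟩
    exact exists_closedLoop hD ht' (hΥ2.mono ht.1 le_rfl).neg
      ((VecLp.of_continuousOn continuousOn_const).of_le le_top) (c := fun _ => 0)
      (fun s _ y => by simp only [riccatiFeedback, Upsilon, Matrix.neg_mulVec, add_zero]) x
  · intro t ht x v
    have ht' : t ∈ Icc 0 D.T := ⟨ht.1, ht.2.le⟩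
    obtain ⟨X, hX, hX0⟩ := exists_constant_state hD ht' x v
    have hmean := hD.riccati_excess_mean hPc hf hval ht hX.continuousOn v
    have hi := (cost_eq hD hΥ2 hf ht' (u := fun _ => v)
      ((VecLp.of_continuousOn continuousOn_const).of_le le_top) hX).1
    have h0 := EReal.liminf_coe_of_tendsto hmean.2
    rw [EReal.coe_zero] at h0
    rw [← h0]
    refine liminf_le_liminf ?_
    filter_upwards [eventually_add_mem_Icc ht.2] with ε hε
    rw [J_perturb_sub hD hΥ2 hf hub ht' hε.1 hε.2.2 hX hX0, EReal.coe_le_coe_iff]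
    refine div_le_div_of_nonneg_right ?_ hε.1.le
    have htt := left_mem_Icc.2 ht.2.le
    refine intervalIntegral.integral_mono_on hε.2.1
      (hmean.1.intervalIntegrable_of_mem htt hε.2) (hi.intervalIntegrable_of_mem htt hε.2)
      fun s hs => ?_
    have hs' : s ∈ Icc 0 D.T := ⟨ht.1.trans hs.1, hs.2.trans hε.2.2⟩
    have := (hD.M_posDef t ht' s hs').posSemidef.dotProduct_mulVec_nonneg (v + D.Upsilon P s *ᵥ X s)
    rw [star_trivial, dotProduct_comm] at this
    exact le_add_of_nonneg_left this
  · simp only [riccatiFeedback, Upsilon, Matrix.neg_mulVec]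

end LQProblem

theorem IsFundamental.congr_ae {ι : Type*} [Fintype ι] [DecidableEq ι] {a b : ℝ}
    {F F' Ψ Y : ℝ → Matrix ι ι ℝ} (hf : IsFundamental a b F Ψ Y)
    (hF : F' =ᵐ[volume.restrict (Icc a b)] F) : IsFundamental a b F' Ψ Y :=
  ⟨hf.prim.congr_ae (hF.mono fun s hs => by simp only [hs]),
    hf.prim_inv.congr_ae (hF.mono fun s hs => by simp only [hs]), hf.inv_mul, hf.mul_inv⟩

theorem Matrix.eq_zero_of_forall_quadratic_nonneg {κ l : Type*} [Fintype κ] [Fintype l]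
    [DecidableEq l] {M : Matrix κ κ ℝ} {E : Matrix κ l ℝ}
    (h : ∀ (x : l → ℝ) (w : κ → ℝ), 0 ≤ (M *ᵥ w) ⬝ᵥ w + 2 * ((E *ᵥ x) ⬝ᵥ w)) : E = 0 := by
  have h0 : ∀ x : l → ℝ, E *ᵥ x = 0 := by
    intro x
    set y := E *ᵥ x with hy
    set a := (M *ᵥ y) ⬝ᵥ y
    set b := y ⬝ᵥ y with hb
    have hb0 : 0 ≤ b := Finset.sum_nonneg fun i _ => mul_self_nonneg _
    have key : ∀ r : ℝ, 0 ≤ r * r * a + 2 * (r * b) := fun r => by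
      have := h x (r • y)
      rw [Matrix.mulVec_smul, smul_dotProduct, dotProduct_smul, dotProduct_smul, ← hy] at this
      simp only [smul_eq_mul] at this
      linarith
    have hbz : b = 0 := by
      by_contra hne
      have hbp : 0 < b := lt_of_le_of_ne hb0 (Ne.symm hne)
      have hA : 0 < |a| + 1 := by positivity
      have h1 := key (-(b / (|a| + 1)))
      have h2 : b / (|a| + 1) * (b / (|a| + 1)) * a ≤ b * (b / (|a| + 1)) := by
        have : b / (|a| + 1) * a ≤ b := by
          rw [div_mul_eq_mul_div, div_le_iff₀ hA]
          nlinarith [le_abs_self a]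
        have hp : 0 ≤ b / (|a| + 1) := by positivity
        nlinarith
      have h3 : 0 < b * (b / (|a| + 1)) := by positivity
      nlinarith
    exact dotProduct_self_eq_zero.1 hbz
  ext i j
  have := congrFun (h0 (Pi.single j 1)) i
  simpa using this

namespace LQProblem

variable {n m : ℕ} {D : LQProblem n m} {Υ : ℝ → Matrix (Fin m) (Fin n) ℝ}
  {Ψ Y P : ℝ → Matrix (Fin n) (Fin n) ℝ}

theorem excess_expand {W : Matrix (Fin n) (Fin n) ℝ} {t s : ℝ} (hM : (D.M t s)ᵀ = D.M t s)
    (x : Fin n → ℝ) (v : Fin m → ℝ) :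
    D.excess Υ W t s x v = ((D.M t s *ᵥ v) ⬝ᵥ v + 2 * ((D.S t s *ᵥ x) ⬝ᵥ v))
      + 2 * ((D.S t s *ᵥ x) ⬝ᵥ (Υ s *ᵥ x)) + 2 * ((W *ᵥ x) ⬝ᵥ (D.B s *ᵥ v))
      + 2 * ((W *ᵥ x) ⬝ᵥ ((D.B s * Υ s) *ᵥ x))
      - ∑ k, ∑ l, (D.M t s k l • x) ⬝ᵥ (Matrix.vecMulVec (Υ s k) (Υ s l) *ᵥ x) := by
  have hM' : ∀ a b : Fin m → ℝ, (D.M t s *ᵥ a) ⬝ᵥ b = (D.M t s *ᵥ b) ⬝ᵥ a := fun a b => by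
    conv_lhs => rw [← hM]
    rw [Matrix.transpose_mulVec_dotProduct, dotProduct_comm]
  have e : ∑ k, ∑ l, (D.M t s k l • x) ⬝ᵥ (Matrix.vecMulVec (Υ s k) (Υ s l) *ᵥ x) =
      (D.M t s *ᵥ (Υ s *ᵥ x)) ⬝ᵥ (Υ s *ᵥ x) := by
    have h1 : ∀ k l, (D.M t s k l • x) ⬝ᵥ (Matrix.vecMulVec (Υ s k) (Υ s l) *ᵥ x) =
        D.M t s k l * (Υ s *ᵥ x) l * (Υ s *ᵥ x) k := fun k l => by
      rw [Matrix.vecMulVec_mulVec, smul_dotProduct, op_smul_eq_smul, dotProduct_smul,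
        smul_eq_mul, smul_eq_mul, dotProduct_comm x]
      simp only [Matrix.mulVec]
      ring
    simp only [h1, ← Finset.sum_mul]
    rfl
  rw [e]
  simp only [excess, Matrix.add_mulVec, Matrix.sub_mulVec, Matrix.mulVec_add,
    ← Matrix.mulVec_mulVec, add_dotProduct, sub_dotProduct, dotProduct_add,
    Matrix.transpose_mulVec_dotProduct]
  rw [hM' v (Υ s *ᵥ x)]
  ring

/-- At a common Lebesgue point of `Υ`, `B`, `B Υ` and the products of entries of `Υ`, the means
of the excess cost converge. -/
theorem Assumptions.excess_mean (hD : D.Assumptions) (hΥ : MatLp 2 0 D.T Υ)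
    (hf : IsFundamental 0 D.T (fun s => D.A s - D.B s * Υ s) Ψ Y) {t : ℝ} (ht : t ∈ Ico 0 D.T)
    (h1 : ∀ i j, IsRightLebesgue t D.T (fun s => Υ s i j))
    (h2 : ∀ i j, IsRightLebesgue t D.T (fun s => D.B s i j))
    (h3 : ∀ i j, IsRightLebesgue t D.T (fun s => (D.B s * Υ s) i j))
    (h4 : ∀ k l i j, IsRightLebesgue t D.T (fun s => Υ s k i * Υ s l j))
    {X : ℝ → Fin n → ℝ} (hX : ContinuousOn X (Icc t D.T)) (v : Fin m → ℝ) :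
    HasRightMean t D.T (fun s => D.excess Υ (D.value Υ Ψ Y t s) t s (X s) v)
      (D.excess Υ (D.value Υ Ψ Y t t) t t (X t) v) := by
  have ht' : t ∈ Icc 0 D.T := ⟨ht.1, ht.2.le⟩
  have hsub : Icc t D.T ⊆ Icc 0 D.T := Icc_subset_Icc ht.1 le_rfl
  have hM := (hD.M_C1.continuousOn_right ht').mono hsub
  have hSX := ((hD.S_C1.continuousOn_right ht').mono hsub).matMulVec hX
  have hVX := ((hD.isMatPrim_value hΥ hf ht').continuousOn.mono hsub).matMulVec hX
  have hv : ContinuousOn (fun _ : ℝ => v) (Icc t D.T) := continuousOn_const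
  have hdot : ∀ {p : ℕ} {a b : ℝ → Fin p → ℝ}, ContinuousOn a (Icc t D.T) →
      ContinuousOn b (Icc t D.T) → ContinuousOn (fun s => a s ⬝ᵥ b s) (Icc t D.T) :=
    fun ha hb => by
      simp only [dotProduct]
      exact continuousOn_finsetSum _ fun i _ =>
        (continuousOn_pi.1 ha i).mul (continuousOn_pi.1 hb i)
  have c0 : HasRightMean t D.T (fun s => (D.M t s *ᵥ v) ⬝ᵥ v + 2 * ((D.S t s *ᵥ X s) ⬝ᵥ v)) _ :=
    HasRightMean.of_continuousOn ht.2 ((hdot (hM.matMulVec hv) hv).add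
      (continuousOn_const.mul (hdot hSX hv)))
  have c1 := (HasRightMean.bilinear ht.2 h1 hSX hX).const_mul 2
  have c2 := (HasRightMean.bilinear ht.2 h2 hVX hv).const_mul 2
  have c3 := (HasRightMean.bilinear ht.2 h3 hVX hX).const_mul 2
  have c4 := HasRightMean.sum ht.2 Finset.univ fun (k : Fin m) _ =>
    HasRightMean.sum ht.2 Finset.univ fun (l : Fin m) _ =>
      HasRightMean.bilinear ht.2 (K := fun s => Matrix.vecMulVec (Υ s k) (Υ s l)) (h4 k l)
        ((hM.matrix_entry k l).smul hX) hX
  rw [excess_expand (hD.M_symm ht' ht')]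
  exact ((((c0.add ht.2 c1).add ht.2 c2).add ht.2 c3).sub ht.2 c4).congr_on ht.2
    fun s hs => excess_expand (hD.M_symm ht' (hsub hs)) (X s) v

theorem IsLinearEquilibrium.exists_gain
    {ub : ℝ → (Fin n → ℝ) → Fin m → ℝ} (h : D.IsLinearEquilibrium ub) :
    ∃ Υ : ℝ → Matrix (Fin m) (Fin n) ℝ, MatLp 2 0 D.T Υ ∧
      ∀ s ∈ Icc 0 D.T, ∀ y, ub s y = -(Υ s *ᵥ y) := by
  obtain ⟨he, ut, hut⟩ := h
  refine ⟨fun s => - ut s, MatLp.neg fun i j => ?_, fun s hs y => ?_⟩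
  · have h1 := (he.squareIntegrable (fun _ => Pi.single j 1) continuousOn_const).eval i
    refine h1.ae_eq ((ae_restrict_iff' measurableSet_Icc).2 (ae_of_all _ fun s hs => ?_))
    simp [hut s hs]
  · rw [hut s hs, Matrix.neg_mulVec, neg_neg]

/-- First-order condition: almost everywhere an equilibrium gain is given by its own value
matrix. -/
theorem IsEquilibrium.ae_gain_eq (hD : D.Assumptions) {ub : ℝ → (Fin n → ℝ) → Fin m → ℝ}
    (he : D.IsEquilibrium ub) (hΥ : MatLp 2 0 D.T Υ)
    (hub : ∀ s ∈ Icc 0 D.T, ∀ y, ub s y = -(Υ s *ᵥ y))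
    (hf : IsFundamental 0 D.T (fun s => D.A s - D.B s * Υ s) Ψ Y) :
    Υ =ᵐ[volume.restrict (Icc 0 D.T)] D.Upsilon (fun s => D.value Υ Ψ Y s s) := by
  have hBΥ : MatLp 2 0 D.T (fun s => D.B s * Υ s) := hD.matLp_B.mul hΥ
  have a1 : ∀ᵐ t, ∀ i j, t ∈ Ico 0 D.T → IsRightLebesgue t D.T (fun s => Υ s i j) :=
    ae_all_iff.2 fun i => ae_all_iff.2 fun j =>
      ae_isRightLebesgue ((hΥ.of_le one_le_two).integrable i j)
  have a2 : ∀ᵐ t, ∀ i j, t ∈ Ico 0 D.T → IsRightLebesgue t D.T (fun s => D.B s i j) :=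
    ae_all_iff.2 fun i => ae_all_iff.2 fun j =>
      ae_isRightLebesgue ((hD.matLp_B.of_le le_top).integrable i j)
  have a3 : ∀ᵐ t, ∀ i j, t ∈ Ico 0 D.T →
      IsRightLebesgue t D.T (fun s => (D.B s * Υ s) i j) :=
    ae_all_iff.2 fun i => ae_all_iff.2 fun j =>
      ae_isRightLebesgue ((hBΥ.of_le one_le_two).integrable i j)
  have a4 : ∀ᵐ t, ∀ k l i j, t ∈ Ico 0 D.T →
      IsRightLebesgue t D.T (fun s => Υ s k i * Υ s l j) :=
    ae_all_iff.2 fun k => ae_all_iff.2 fun l => ae_all_iff.2 fun i => ae_all_iff.2 fun j =>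
      ae_isRightLebesgue ((hΥ k i).integrable_mul (hΥ l j))
  have hne : ∀ᵐ t : ℝ, t ≠ D.T := by simp [ae_iff, measure_singleton]
  refine (ae_restrict_iff' measurableSet_Icc).2 ?_
  filter_upwards [a1, a2, a3, a4, hne] with t h1 h2 h3 h4 hT ht'
  have ht : t ∈ Ico 0 D.T := ⟨ht'.1, lt_of_le_of_ne ht'.2 hT⟩
  have key : ∀ x v, 0 ≤ D.excess Υ (D.value Υ Ψ Y t t) t t x v := by
    intro x v
    obtain ⟨X, hX, hX0⟩ := exists_constant_state hD ht' x v
    have hmean := hD.excess_mean hΥ hf ht (fun i j => h1 i j ht) (fun i j => h2 i j ht)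
      (fun i j => h3 i j ht) (fun k l i j => h4 k l i j ht) hX.continuousOn v
    rw [hX0] at hmean
    have hlim := he.equilibrium t ht x v
    rw [EReal.liminf_coe_of_tendsto (hmean.2.congr' ?_)] at hlim
    · exact_mod_cast hlim
    · filter_upwards [eventually_add_mem_Icc ht.2] with ε hε
      rw [J_perturb_sub hD hΥ hf hub ht' hε.1 hε.2.2 hX hX0]
  have hE := Matrix.eq_zero_of_forall_quadratic_nonneg (M := D.M t t)
    (E := D.S t t + (D.B t)ᵀ * D.value Υ Ψ Y t t - D.M t t * Υ t) fun x w => by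
      simpa [excess] using key x (w - Υ t *ᵥ x)
  rw [Upsilon, add_comm, sub_eq_zero.1 hE, ← Matrix.mul_assoc, hD.Minv_mul_M ht', Matrix.one_mul]

theorem IsLinearEquilibrium.exists_isRiccatiSolution (hD : D.Assumptions)
    {ub : ℝ → (Fin n → ℝ) → Fin m → ℝ} (h : D.IsLinearEquilibrium ub) :
    ∃ P, D.IsRiccatiSolution P := by
  obtain ⟨Υ, hΥ, hub⟩ := h.exists_gain
  obtain ⟨Ψ, Y, hf⟩ := exists_isFundamental hD.T_pos.le (hD.matLp_closedLoop hΥ).integrable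
  have hae := h.1.ae_gain_eq hD hΥ hub hf
  set P : ℝ → Matrix (Fin n) (Fin n) ℝ := fun s => D.value Υ Ψ Y s s with hPdef
  have hdiag := hD.isMatPrim_value_diag hΥ hf
  refine ⟨P, hdiag.continuousOn, fun t ht => hD.value_symm ht ht, fun r s => Ψ r * Y s,
    isTransition_of_isFundamental (hf.congr_ae (hae.mono fun s hs => by simp only [hs])),
    fun t ht => ?_⟩
  have hPp : IsMatPrim 0 D.T P (fun s => -((D.A s)ᵀ * P s + P s * D.A s
      + D.Qbar P (fun r s => Ψ r * Y s) s
      - (P s * D.B s + (D.S s s)ᵀ) * D.Minv s * ((D.B s)ᵀ * P s + D.S s s))) := by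
    refine hdiag.congr_ae ?_
    filter_upwards [hae, ae_restrict_mem measurableSet_Icc] with s hs hsm
    rw [hD.riccati_eq_lyapunov P _ hsm, Qbar_eq_nonlocalWeight,
      ← nonlocalWeight_congr hsm hae fun _ _ => rfl]
    simp only [weight, runWeight, ← hs]
    rfl
  have hPT : P D.T = D.G D.T := hD.value_terminal hf _
  ext i j
  have := (hPp i j).eq_sub_integral ht
  rw [hPT] at this
  simp only [Matrix.neg_apply, intervalIntegral.integral_neg, sub_neg_eq_add] at this
  exact this

end LQProblem

theorem IsVecPrim.iff_terminal {κ : Type*} [Fintype κ] {a b : ℝ} {X g : ℝ → κ → ℝ} :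
    IsVecPrim a b X (fun s => - g s) ↔ IntegrableOn g (Icc a b) ∧
      ∀ s ∈ Icc a b, X s = X b + ∫ r in s..b, g r := by
  have key : IntegrableOn g (Icc a b) → ∀ s ∈ Icc a b, ∀ i,
      (∫ r in s..b, g r) i = ∫ r in s..b, g r i := by
    intro h s hs i
    have : IntervalIntegrable g volume s b := by
      rw [intervalIntegrable_iff, uIoc_of_le hs.2]
      exact h.mono_set (Ioc_subset_Icc_self.trans (Icc_subset_Icc hs.1 le_rfl))
    exact ((ContinuousLinearMap.proj (R := ℝ) (φ := fun _ : κ => ℝ)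
      i).intervalIntegral_comp_comm this).symm
  constructor
  · intro h
    have hi : IntegrableOn g (Icc a b) := Integrable.of_eval fun i => by
      have := (h i).1.neg
      simp only [Pi.neg_apply] at this
      simpa [IntegrableOn] using this
    refine ⟨hi, fun s hs => ?_⟩
    ext i
    have := (h i).eq_sub_integral hs
    simp only [Pi.neg_apply, intervalIntegral.integral_neg, sub_neg_eq_add] at this
    rw [Pi.add_apply, key hi s hs i, ← this]
  · rintro ⟨hi, h⟩ i
    refine IsPrim.of_terminal (c := X b i) (hi.eval i) fun s hs => ?_
    rw [← key hi s hs i, ← Pi.add_apply, ← h s hs]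

theorem matIntegral_quadForm {k : ℕ} {a b c d : ℝ} {X : ℝ → Matrix (Fin k) (Fin k) ℝ}
    (hX : MatLp 1 a b X) (hc : c ∈ Icc a b) (hd : d ∈ Icc a b) (x : Fin k → ℝ) :
    (matIntegral X c d *ᵥ x) ⬝ᵥ x = ∫ s in c..d, (X s *ᵥ x) ⬝ᵥ x := by
  have e : ∀ C : Matrix (Fin k) (Fin k) ℝ,
      (C *ᵥ x) ⬝ᵥ x = (Matrix.replicateRow (Fin 1) x * C * Matrix.replicateCol (Fin 1) x) 0 0 :=
    fun C => by
      simp only [Matrix.mul_apply, dotProduct, Matrix.mulVec, Matrix.replicateRow_apply,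
        Matrix.replicateCol_apply, Finset.sum_mul]
      rw [Finset.sum_comm]
      exact Finset.sum_congr rfl fun i _ => Finset.sum_congr rfl fun j _ => by ring
  rw [e, ← matIntegral_mul_mul hX _ _ hc hd]
  simp only [e]
  rfl

theorem Matrix.IsSymm.eq_of_quadForm_eq {ι : Type*} [Fintype ι] [DecidableEq ι]
    {C E : Matrix ι ι ℝ} (hC : Cᵀ = C) (hE : Eᵀ = E)
    (h : ∀ x, (C *ᵥ x) ⬝ᵥ x = (E *ᵥ x) ⬝ᵥ x) : C = E := by
  have hs : ∀ {C : Matrix ι ι ℝ}, Cᵀ = C → ∀ x y, (C *ᵥ x) ⬝ᵥ y = (C *ᵥ y) ⬝ᵥ x := by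
    intro C hC x y
    conv_lhs => rw [← hC]
    rw [Matrix.transpose_mulVec_dotProduct, dotProduct_comm]
  ext i j
  have h1 := h (Pi.single i 1 + Pi.single j 1)
  have h2 := h (Pi.single i 1)
  have h3 := h (Pi.single j 1)
  simp only [Matrix.mulVec_add, add_dotProduct, dotProduct_add] at h1
  rw [hs hC (Pi.single j 1) (Pi.single i 1), hs hE (Pi.single j 1) (Pi.single i 1)] at h1
  have h4 : (C *ᵥ Pi.single i 1) ⬝ᵥ Pi.single j 1 = (E *ᵥ Pi.single i 1) ⬝ᵥ Pi.single j 1 := by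
    linarith
  have h5 : C j i = E j i := by simpa using h4
  rw [← hC, ← hE]
  exact h5

namespace LQProblem

variable {n m : ℕ} {D : LQProblem n m} {Υ : ℝ → Matrix (Fin m) (Fin n) ℝ}
  {Ψ Y P : ℝ → Matrix (Fin n) (Fin n) ℝ}

/-- Along a closed-loop trajectory the nonlocal form is the quadratic form of the nonlocal
weight. -/
theorem Assumptions.nonlocalForm_eq (hD : D.Assumptions) (hΥ : MatLp 2 0 D.T Υ)
    (hΨ : ContinuousOn Ψ (Icc 0 D.T)) {s : ℝ} (hs : s ∈ Icc 0 D.T) {X φ : ℝ → Fin n → ℝ}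
    (hX : ∀ τ ∈ Icc s D.T, X τ = (Ψ τ * Y s) *ᵥ X s)
    (hgain : ∀ τ ∈ Icc s D.T, D.gain X φ τ = Υ τ *ᵥ X τ) :
    D.nonlocalForm X φ s =
      (D.nonlocalWeight Υ (fun r s => Ψ r * Y s) s *ᵥ X s) ⬝ᵥ X s := by
  have hΦ : ContinuousOn (fun τ => Ψ τ * Y s) (Icc 0 D.T) := hΨ.matMul continuousOn_const
  have hconj : ∀ C E : Matrix (Fin n) (Fin n) ℝ,
      ((Cᵀ * E * C) *ᵥ X s) ⬝ᵥ X s = (E *ᵥ (C *ᵥ X s)) ⬝ᵥ (C *ᵥ X s) := fun C E => by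
    rw [Matrix.mul_assoc, ← Matrix.mulVec_mulVec, ← Matrix.mulVec_mulVec,
      Matrix.transpose_mulVec_dotProduct]
  rw [nonlocalWeight, Matrix.sub_mulVec, Matrix.sub_mulVec, Matrix.sub_mulVec, sub_dotProduct,
    sub_dotProduct, sub_dotProduct,
    matIntegral_quadForm ((hD.isMatKernel_Q hΦ).matLp_slice_deriv hs) hs hD.T_mem,
    matIntegral_quadForm ((hD.isMatKernel_feedback hΥ hΦ).matLp_slice_deriv hs) hs hD.T_mem,
    hconj, ← hX D.T (right_mem_Icc.2 hs.2), nonlocalForm]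
  congr 1
  · congr 1
    refine intervalIntegral.integral_congr fun τ hτ => ?_
    rw [uIcc_of_le hs.2] at hτ
    rw [hconj, ← hX τ hτ]
  · refine intervalIntegral.integral_congr fun τ hτ => ?_
    rw [uIcc_of_le hs.2] at hτ
    rw [hconj, ← hX τ hτ, hgain τ hτ]
    simp only [Matrix.sub_mulVec, ← Matrix.mulVec_mulVec, sub_dotProduct,
      Matrix.transpose_mulVec_dotProduct, smul_dotProduct, smul_eq_mul]
    rw [dotProduct_comm (Υ τ *ᵥ X τ) (D.d1 D.S s τ *ᵥ X τ)]
    ring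

theorem closedLoop_eq_drift (P : ℝ → Matrix (Fin n) (Fin n) ℝ) (s : ℝ) :
    D.A s - D.B s * D.Upsilon P s = D.drift s - D.B s * D.Minv s * (D.B s)ᵀ * P s := by
  simp only [Upsilon, drift, Matrix.mul_add, Matrix.mul_assoc]
  abel

theorem Assumptions.drift_transpose_mul (hD : D.Assumptions)
    (P : ℝ → Matrix (Fin n) (Fin n) ℝ) (W : Matrix (Fin n) (Fin n) ℝ) {s : ℝ}
    (hs : s ∈ Icc 0 D.T) :
    (D.A s - D.B s * D.Upsilon P s)ᵀ * P s + (D.weight (D.Upsilon P) s s - D.Q s s + W) =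
      (D.drift s)ᵀ * P s + (W - (D.S s s)ᵀ * D.Minv s * D.S s s) := by
  have h := hD.riccati_eq_lyapunov P W hs
  have e : (D.A s - D.B s * D.Upsilon P s)ᵀ * P s + (D.weight (D.Upsilon P) s s - D.Q s s + W) =
      ((D.A s)ᵀ * P s + P s * D.A s + W
        - (P s * D.B s + (D.S s s)ᵀ) * D.Minv s * ((D.B s)ᵀ * P s + D.S s s))
        - P s * (D.A s - D.B s * D.Upsilon P s) := by
    rw [h]; abel
  rw [e]
  simp only [Upsilon, drift, Matrix.transpose_sub, Matrix.transpose_mul, hD.Minv_symm hs,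
    Matrix.mul_add, Matrix.add_mul, Matrix.mul_sub, Matrix.sub_mul, Matrix.mul_assoc]
  abel

theorem gain_eq_Upsilon {X φ : ℝ → Fin n → ℝ} {τ : ℝ} (h : φ τ = P τ *ᵥ X τ) :
    D.gain X φ τ = D.Upsilon P τ *ᵥ X τ := by
  simp only [gain, Upsilon, h, Matrix.mulVec_mulVec, ← Matrix.add_mulVec]

theorem IsRiccatiSolution.bvpSolvable (hD : D.Assumptions) (hP : D.IsRiccatiSolution P) :
    D.BVPSolvable := by
  have hΥ2 : MatLp 2 0 D.T (D.Upsilon P) := (hD.matLp_Upsilon hP.1).of_le le_top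
  obtain ⟨Ψ, Y, hf⟩ := exists_isFundamental hD.T_pos.le (hD.matLp_closedLoop hΥ2).integrable
  have hΨ := hf.prim.continuousOn
  have hval := fun s (hs : s ∈ Icc 0 D.T) => hD.value_eq_of_isRiccatiSolution hP hf hs
  have hPp : IsMatPrim 0 D.T P (fun s => -((D.A s - D.B s * D.Upsilon P s)ᵀ * P s
      + P s * (D.A s - D.B s * D.Upsilon P s) + (D.weight (D.Upsilon P) s s - D.Q s s
        + D.nonlocalWeight (D.Upsilon P) (fun r s => Ψ r * Y s) s))) :=
    (hD.isMatPrim_value_diag hΥ2 hf).congr_on (fun s hs => (hval s hs).symm)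
      (fun s hs => by simp only [hval s hs])
  refine ⟨D.nonlocalWeight (D.Upsilon P) (fun r s => Ψ r * Y s),
    fun s hs => hD.nonlocalWeight_symm hΥ2 hΨ hs,
    (hD.matLp_nonlocalWeight hΥ2 hΨ hf.prim_inv.continuousOn).integrable, fun t ht x => ?_⟩
  have ht' : t ∈ Icc 0 D.T := ⟨ht.1, ht.2.le⟩
  have hsub : Icc t D.T ⊆ Icc 0 D.T := Icc_subset_Icc ht.1 le_rfl
  let X : ℝ → Fin n → ℝ := fun s => (Ψ s * Y t) *ᵥ x
  have hX₀ : IsVecPrim 0 D.T X (fun s => (D.A s - D.B s * D.Upsilon P s) *ᵥ X s) :=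
    ((hf.prim.mul (IsMatPrim.const (Y t))).mulVec (IsVecPrim.const x)).congr_on
      (fun _ _ => rfl) (fun s _ => by simp [X, Matrix.mul_assoc])
  have hX := hX₀.mono ht.1 le_rfl
  have hXt : X t = x := by simp only [X, hf.mul_inv t ht', Matrix.one_mulVec]
  have hX' : IsVecPrim t D.T X (fun s => D.drift s *ᵥ X s
      - (D.B s * D.Minv s * (D.B s)ᵀ) *ᵥ (P s *ᵥ X s)) :=
    hX.congr_on (fun _ _ => rfl) fun s _ => by
      simp only [closedLoop_eq_drift, Matrix.sub_mulVec, Matrix.mulVec_mulVec]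
  have hφ : IsVecPrim t D.T (fun s => P s *ᵥ X s) (fun s => -((D.drift s)ᵀ *ᵥ (P s *ᵥ X s)
      + (D.nonlocalWeight (D.Upsilon P) (fun r s => Ψ r * Y s) s
        - (D.S s s)ᵀ * D.Minv s * D.S s s) *ᵥ X s)) := by
    refine ((hPp.mono ht.1 le_rfl).mulVec hX).congr_on (fun _ _ => rfl) fun s hs => ?_
    beta_reduce
    generalize X s = y
    rw [Matrix.mulVec_mulVec, ← Matrix.add_mulVec, ← hD.drift_transpose_mul P _ (hsub hs),
      Matrix.mulVec_mulVec, ← Matrix.neg_mulVec, ← Matrix.add_mulVec]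
    congr 1
    abel
  have hPT : P D.T = D.G D.T := by rw [← hval D.T hD.T_mem, hD.value_terminal hf]
  refine ⟨X, fun s => P s *ᵥ X s, hX.continuousOn, hφ.continuousOn, ?_, ?_, fun s hs => ?_⟩
  · rw [← hXt]
    exact (IsVecPrim.iff_integral.1 hX').2
  · rw [← hPT]
    exact (IsVecPrim.iff_terminal.1 hφ).2
  · exact (hD.nonlocalForm_eq (Y := Y) hΥ2 hΨ (hsub hs)
      (fun τ hτ => hf.vecPrim_eq hX₀ (hsub ⟨hs.1.trans hτ.1, hτ.2⟩) (hsub hs))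
      (fun τ hτ => gain_eq_Upsilon rfl)).symm

end LQProblem

theorem MatLp.fromBlocks {κ l κ' l' : Type*} {p : ℝ≥0∞} {a b : ℝ} {A : ℝ → Matrix κ l ℝ}
    {B : ℝ → Matrix κ l' ℝ} {C : ℝ → Matrix κ' l ℝ} {E : ℝ → Matrix κ' l' ℝ}
    (hA : MatLp p a b A) (hB : MatLp p a b B) (hC : MatLp p a b C) (hE : MatLp p a b E) :
    MatLp p a b (fun s => Matrix.fromBlocks (A s) (B s) (C s) (E s)) := by
  rintro (i | i) (j | j)
  exacts [hA i j, hB i j, hC i j, hE i j]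

namespace LQProblem

variable {n m : ℕ} {D : LQProblem n m} {Qh : ℝ → Matrix (Fin n) (Fin n) ℝ}

variable (D) in
/-- The coefficient matrix of the Hamiltonian system of the boundary value problem. -/
def hamiltonian (Qh : ℝ → Matrix (Fin n) (Fin n) ℝ) (s : ℝ) :
    Matrix (Fin n ⊕ Fin n) (Fin n ⊕ Fin n) ℝ :=
  Matrix.fromBlocks (D.drift s) (-(D.B s * D.Minv s * (D.B s)ᵀ))
    (-(Qh s - (D.S s s)ᵀ * D.Minv s * D.S s s)) (-(D.drift s)ᵀ)

section

variable (hD : D.Assumptions)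

include hD

theorem Assumptions.matLp_drift : MatLp 1 0 D.T D.drift := by
  have h1 : MatLp ⊤ 0 D.T (fun s => D.B s * D.Minv s) :=
    hD.matLp_B.mul (MatLp.of_continuousOn hD.continuousOn_Minv)
  have h2 : MatLp ⊤ 0 D.T (fun s => D.B s * D.Minv s * D.S s s) :=
    h1.mul (MatLp.of_continuousOn hD.S_C1.continuousOn_diag)
  exact hD.matLp_A.sub (h2.of_le le_top)

theorem Assumptions.matLp_inputWeight :
    MatLp ⊤ 0 D.T (fun s => D.B s * D.Minv s * (D.B s)ᵀ) := by
  have h1 : MatLp ⊤ 0 D.T (fun s => D.B s * D.Minv s) :=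
    hD.matLp_B.mul (MatLp.of_continuousOn hD.continuousOn_Minv)
  exact h1.mul hD.matLp_B.transpose

theorem Assumptions.matLp_stateWeight (hQh : MatLp 1 0 D.T Qh) :
    MatLp 1 0 D.T (fun s => Qh s - (D.S s s)ᵀ * D.Minv s * D.S s s) :=
  hQh.sub ((MatLp.of_continuousOn ((hD.S_C1.continuousOn_diag.matTranspose.matMul
    hD.continuousOn_Minv).matMul hD.S_C1.continuousOn_diag)).of_le le_top)

theorem Assumptions.matLp_hamiltonian (hQh : MatLp 1 0 D.T Qh) :
    MatLp 1 0 D.T (D.hamiltonian Qh) :=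
  MatLp.fromBlocks hD.matLp_drift (hD.matLp_inputWeight.of_le le_top).neg
    (hD.matLp_stateWeight hQh).neg hD.matLp_drift.transpose.neg

theorem IsBVPSolution.isVecPrim (hQh : MatLp 1 0 D.T Qh) {t : ℝ} (ht : t ∈ Icc 0 D.T)
    {x : Fin n → ℝ} {X φ : ℝ → Fin n → ℝ} (h : D.IsBVPSolution Qh t x X φ) :
    IsVecPrim t D.T (fun s => Sum.elim (X s) (φ s))
      (fun s => D.hamiltonian Qh s *ᵥ Sum.elim (X s) (φ s)) ∧ X t = x ∧
      φ D.T = D.G D.T *ᵥ X D.T := by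
  have hX := VecLp.of_continuousOn h.continuousOn_X
  have hφ := VecLp.of_continuousOn h.continuousOn_φ
  have hXt : X t = x := by simpa using h.eq_X t (left_mem_Icc.2 ht.2)
  have hφT : φ D.T = D.G D.T *ᵥ X D.T := by simpa using h.eq_φ D.T (right_mem_Icc.2 ht.2)
  have h1 : VecLp 1 t D.T (fun s => D.drift s *ᵥ X s) :=
    (hD.matLp_drift.mono ht.1 le_rfl).mulVec hX
  have h2 : VecLp ⊤ t D.T (fun s => (D.B s * D.Minv s * (D.B s)ᵀ) *ᵥ φ s) :=
    (hD.matLp_inputWeight.mono ht.1 le_rfl).mulVec hφ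
  have h3 : VecLp 1 t D.T (fun s => (D.drift s)ᵀ *ᵥ φ s) :=
    (hD.matLp_drift.transpose.mono ht.1 le_rfl).mulVec hφ
  have h4 : VecLp 1 t D.T (fun s => (Qh s - (D.S s s)ᵀ * D.Minv s * D.S s s) *ᵥ X s) :=
    ((hD.matLp_stateWeight hQh).mono ht.1 le_rfl).mulVec hX
  have p1 : IsVecPrim t D.T X (fun s => D.drift s *ᵥ X s
      - (D.B s * D.Minv s * (D.B s)ᵀ) *ᵥ φ s) := by
    refine IsVecPrim.iff_integral.2 ⟨Integrable.of_eval fun i =>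
      (h1.integrable i).sub ((h2.of_le le_top).integrable i), ?_⟩
    rw [hXt]
    exact h.eq_X
  have p2 : IsVecPrim t D.T φ (fun s => -((D.drift s)ᵀ *ᵥ φ s
      + (Qh s - (D.S s s)ᵀ * D.Minv s * D.S s s) *ᵥ X s)) := by
    refine IsVecPrim.iff_terminal.2 ⟨Integrable.of_eval fun i =>
      (h3.integrable i).add (h4.integrable i), ?_⟩
    rw [hφT]
    exact h.eq_φ
  refine ⟨?_, hXt, hφT⟩
  rintro (i | i)
  · refine (p1 i).congr_on (fun _ _ => rfl) fun s _ => ?_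
    simp only [hamiltonian, Matrix.fromBlocks_mulVec, Sum.elim_comp_inl, Sum.elim_comp_inr,
      Sum.elim_inl, Pi.add_apply, Pi.sub_apply, Matrix.neg_mulVec, Pi.neg_apply]
    ring
  · refine (p2 i).congr_on (fun _ _ => rfl) fun s _ => ?_
    simp only [hamiltonian, Matrix.fromBlocks_mulVec, Sum.elim_comp_inl, Sum.elim_comp_inr,
      Sum.elim_inr, Pi.add_apply, Matrix.neg_mulVec, Pi.neg_apply]
    ring

/-- The matrix solution of the Hamiltonian system with terminal value `(1, G(T))` generates all
solutions of the boundary value problem. -/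
theorem Assumptions.exists_hamiltonian_flow (hQh : MatLp 1 0 D.T Qh) :
    ∃ Ξ Λ : ℝ → Matrix (Fin n) (Fin n) ℝ,
      IsMatPrim 0 D.T Ξ (fun s => D.drift s * Ξ s - D.B s * D.Minv s * (D.B s)ᵀ * Λ s) ∧
      IsMatPrim 0 D.T Λ (fun s => -((Qh s - (D.S s s)ᵀ * D.Minv s * D.S s s) * Ξ s
        + (D.drift s)ᵀ * Λ s)) ∧
      Ξ D.T = 1 ∧ Λ D.T = D.G D.T ∧
      ∀ t ∈ Icc 0 D.T, ∀ x X φ, D.IsBVPSolution Qh t x X φ → X t = x ∧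
        ∀ s ∈ Icc t D.T, X s = Ξ s *ᵥ X D.T ∧ φ s = Λ s *ᵥ X D.T := by
  obtain ⟨Ψ, Y, hf⟩ := exists_isFundamental hD.T_pos.le (hD.matLp_hamiltonian hQh).integrable
  let R : Matrix (Fin n ⊕ Fin n) (Fin n) ℝ := Matrix.fromRows 1 (D.G D.T)
  let Z : ℝ → Matrix (Fin n ⊕ Fin n) (Fin n) ℝ := fun s => Ψ s * Y D.T * R
  have hZ : IsMatPrim 0 D.T Z (fun s => D.hamiltonian Qh s *
      Matrix.fromRows (Z s).toRows₁ (Z s).toRows₂) :=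
    (hf.prim.mul (IsMatPrim.const (Y D.T * R))).congr_on
      (fun s _ => by simp only [Z, Matrix.mul_assoc])
      (fun s _ => by simp only [Z, Matrix.fromRows_toRows, Matrix.mul_assoc, Matrix.mul_zero,
        add_zero])
  have hZT : Z D.T = R := by simp only [Z, hf.mul_inv _ hD.T_mem, Matrix.one_mul]
  refine ⟨fun s => (Z s).toRows₁, fun s => (Z s).toRows₂, fun i j => ?_, fun i j => ?_, ?_, ?_,
    fun t ht x X φ h => ?_⟩
  · refine (hZ (Sum.inl i) j).congr_on (fun _ _ => rfl) fun s _ => ?_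
    simp only [hamiltonian, Matrix.fromBlocks_mul_fromRows, Matrix.fromRows_apply_inl,
      Matrix.neg_mul, ← sub_eq_add_neg]
  · refine (hZ (Sum.inr i) j).congr_on (fun _ _ => rfl) fun s _ => ?_
    simp only [hamiltonian, Matrix.fromBlocks_mul_fromRows, Matrix.fromRows_apply_inr,
      Matrix.neg_mul, neg_add]
  · simp only [hZT, R, Matrix.toRows₁_fromRows]
  · simp only [hZT, R, Matrix.toRows₂_fromRows]
  · obtain ⟨hp, hXt, hφT⟩ := h.isVecPrim hD hQh ht
    refine ⟨hXt, fun s hs => ?_⟩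
    have e := (hf.mono ht.1 le_rfl).vecPrim_eq hp hs (right_mem_Icc.2 ht.2)
    have hR : Sum.elim (X D.T) (φ D.T) = R *ᵥ X D.T := by
      simp only [R, Matrix.fromRows_mulVec, Matrix.one_mulVec, hφT]
    rw [hR, Matrix.mulVec_mulVec] at e
    change Sum.elim (X s) (φ s) = Z s *ᵥ X D.T at e
    rw [← Matrix.fromRows_toRows (Z s), Matrix.fromRows_mulVec] at e
    exact ⟨funext fun i => congrFun e (Sum.inl i), funext fun i => congrFun e (Sum.inr i)⟩

theorem BVPSolvable.exists_isRiccatiSolution (h : D.BVPSolvable) :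
    ∃ P, D.IsRiccatiSolution P := by
  obtain ⟨Qh, hsymm, hInt, hsol⟩ := h
  have hQh : MatLp 1 0 D.T Qh := MatLp.of_integrable hInt
  obtain ⟨Ξ, Λ, hΞ, hΛ, hΞT, hΛT, hflow⟩ := hD.exists_hamiltonian_flow hQh
  have hdet : ∀ s ∈ Icc 0 D.T, IsUnit (Ξ s).det := by
    intro s hs
    rcases hs.2.eq_or_lt with rfl | hlt
    · simp [hΞT]
    · rw [← Matrix.isUnit_iff_isUnit_det, ← Matrix.mulVec_surjective_iff_isUnit]
      intro x
      obtain ⟨X, φ, hX⟩ := hsol s ⟨hs.1, hlt⟩ x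
      obtain ⟨hXs, hE⟩ := hflow s hs x X φ hX
      exact ⟨X D.T, by rw [← (hE s (left_mem_Icc.2 hs.2)).1, hXs]⟩
  let P : ℝ → Matrix (Fin n) (Fin n) ℝ := fun s => Λ s * (Ξ s)⁻¹
  have hPΞ : ∀ s ∈ Icc 0 D.T, P s * Ξ s = Λ s := fun s hs => by
    simp only [P, Matrix.mul_assoc, Matrix.nonsing_inv_mul _ (hdet s hs), Matrix.mul_one]
  have hPc : ContinuousOn P (Icc 0 D.T) := hΛ.continuousOn.matMul (hΞ.continuousOn.matInv hdet)
  have hΥ2 : MatLp 2 0 D.T (D.Upsilon P) := (hD.matLp_Upsilon hPc).of_le le_top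
  obtain ⟨Ψ, Y, hf⟩ := exists_isFundamental hD.T_pos.le (hD.matLp_closedLoop hΥ2).integrable
  have hΞ' : IsMatPrim 0 D.T Ξ (fun s => (D.A s - D.B s * D.Upsilon P s) * Ξ s) :=
    hΞ.congr_on (fun _ _ => rfl) fun s hs => by
      simp only [closedLoop_eq_drift, Matrix.sub_mul, Matrix.mul_assoc, hPΞ s hs]
  let K : ℝ → Matrix (Fin n) (Fin n) ℝ := fun s => (Ξ 0)⁻¹ * Ψ 0 * Y s
  have hΞK : ∀ s ∈ Icc 0 D.T, Ξ s * K s = 1 := fun s hs => by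
    rw [hf.matPrim_eq hΞ' hs hD.zero_mem]
    calc Ψ s * Y 0 * Ξ 0 * ((Ξ 0)⁻¹ * Ψ 0 * Y s)
        = Ψ s * Y 0 * (Ξ 0 * (Ξ 0)⁻¹) * (Ψ 0 * Y s) := by simp only [Matrix.mul_assoc]
      _ = Ψ s * (Y 0 * Ψ 0) * Y s := by
          rw [Matrix.mul_nonsing_inv _ (hdet 0 hD.zero_mem), Matrix.mul_one]
          simp only [Matrix.mul_assoc]
      _ = 1 := by rw [hf.inv_mul 0 hD.zero_mem, Matrix.mul_one, hf.mul_inv s hs]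
  have hK : IsMatPrim 0 D.T K (fun s => -(K s * (D.A s - D.B s * D.Upsilon P s))) :=
    ((IsMatPrim.const ((Ξ 0)⁻¹ * Ψ 0)).mul hf.prim_inv).congr_on (fun _ _ => rfl)
      fun s _ => by simp only [K, Matrix.zero_mul, zero_add, Matrix.mul_neg, Matrix.mul_assoc]
  have hPK : ∀ s ∈ Icc 0 D.T, P s = Λ s * K s := fun s hs => by
    rw [← hPΞ s hs, Matrix.mul_assoc, hΞK s hs, Matrix.mul_one]
  have hPp : IsMatPrim 0 D.T P (fun s => -((D.A s - D.B s * D.Upsilon P s)ᵀ * P s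
      + P s * (D.A s - D.B s * D.Upsilon P s)
      + (D.weight (D.Upsilon P) s s - D.Q s s + Qh s))) := by
    refine (hΛ.mul hK).congr_on hPK fun s hs => ?_
    have e := hD.drift_transpose_mul P (Qh s) hs
    calc _ = -(((D.A s - D.B s * D.Upsilon P s)ᵀ * P s
          + (D.weight (D.Upsilon P) s s - D.Q s s + Qh s))
          + P s * (D.A s - D.B s * D.Upsilon P s)) := by abel
      _ = -(((D.drift s)ᵀ * (Λ s * K s)
          + (Qh s - (D.S s s)ᵀ * D.Minv s * D.S s s) * (Ξ s * K s))
          + Λ s * K s * (D.A s - D.B s * D.Upsilon P s)) := by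
          rw [e, hΞK s hs, Matrix.mul_one, ← hPK s hs]
      _ = _ := by
          simp only [Matrix.neg_mul, Matrix.mul_neg, Matrix.add_mul, Matrix.mul_assoc]
          abel
  have hPT : P D.T = D.G D.T := by simp only [P, hΞT, hΛT, inv_one, Matrix.mul_one]
  have hPsymm : ∀ s ∈ Icc 0 D.T, (P s)ᵀ = P s := by
    intro s hs
    refine hf.lyapunov_unique (hPp.transpose.congr_on (fun _ _ => rfl) fun s hs => ?_) hPp
      (by rw [hPT, hD.G_symm hD.T_mem]) hs
    have hw : (D.weight (D.Upsilon P) s s)ᵀ = D.weight (D.Upsilon P) s s :=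
      runWeight_symm (hD.Q_symm hs hs) (hD.M_symm hs hs)
    simp only [Matrix.transpose_neg, Matrix.transpose_add, Matrix.transpose_mul,
      Matrix.transpose_transpose, Matrix.transpose_sub, hw, hD.Q_symm hs hs, (hsymm s hs).eq]
    abel
  have hQ : ∀ s ∈ Ico 0 D.T, Qh s = D.Qbar P (fun r s => Ψ r * Y s) s := by
    intro s hs
    have hs' : s ∈ Icc 0 D.T := ⟨hs.1, hs.2.le⟩
    refine Matrix.IsSymm.eq_of_quadForm_eq (hsymm s hs')
      (hD.nonlocalWeight_symm hΥ2 hf.prim.continuousOn hs') fun x => ?_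
    obtain ⟨X, φ, hX⟩ := hsol s hs x
    obtain ⟨hXs, hE⟩ := hflow s hs' x X φ hX
    have hss := left_mem_Icc.2 hs'.2
    have key := hX.eq_Qh s hss
    rw [hD.nonlocalForm_eq (Υ := D.Upsilon P) (Y := Y) hΥ2 hf.prim.continuousOn hs'
      (fun τ hτ => ?_) (fun τ hτ => gain_eq_Upsilon ?_), hXs] at key
    · exact key
    · rw [(hE τ hτ).1, (hE s hss).1, Matrix.mulVec_mulVec,
        ← hf.matPrim_eq hΞ' ⟨hs.1.trans hτ.1, hτ.2⟩ hs']
    · rw [(hE τ hτ).2, (hE τ hτ).1, Matrix.mulVec_mulVec, hPΞ τ ⟨hs.1.trans hτ.1, hτ.2⟩]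
  refine ⟨P, hPc, hPsymm, fun r s => Ψ r * Y s, isTransition_of_isFundamental hf,
    fun t ht => ?_⟩
  have hric : IsMatPrim 0 D.T P (fun s => -((D.A s)ᵀ * P s + P s * D.A s
      + D.Qbar P (fun r s => Ψ r * Y s) s
      - (P s * D.B s + (D.S s s)ᵀ) * D.Minv s * ((D.B s)ᵀ * P s + D.S s s))) := by
    refine hPp.congr_ae ?_
    have hne : ∀ᵐ t ∂volume.restrict (Icc 0 D.T), t ≠ D.T :=
      ae_restrict_of_ae (by simp [ae_iff, measure_singleton])
    filter_upwards [hne, ae_restrict_mem measurableSet_Icc] with s hs hsm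
    rw [hD.riccati_eq_lyapunov P _ hsm, hQ s ⟨hsm.1, lt_of_le_of_ne hsm.2 hs⟩]
  ext i j
  have := (hric i j).eq_sub_integral ht
  rw [hPT] at this
  simp only [Matrix.neg_apply, intervalIntegral.integral_neg, sub_neg_eq_add] at this
  exact this

end

end LQProblem

end

theorem mainTheorem1 {n m : ℕ} (D : LQProblem n m) (hD : D.Assumptions) :
    List.TFAE [
      ∃ ub : ℝ → (Fin n → ℝ) → Fin m → ℝ, D.IsLinearEquilibrium ub,
      D.BVPSolvable,
      ∃ P : ℝ → Matrix (Fin n) (Fin n) ℝ, D.IsRiccatiSolution P] ∧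
    ∀ P : ℝ → Matrix (Fin n) (Fin n) ℝ, D.IsRiccatiSolution P →
      D.IsLinearEquilibrium (D.riccatiFeedback P) := by
  refine ⟨?_, fun P hP => hD.isLinearEquilibrium_riccatiFeedback hP⟩
  tfae_have 1 → 3 := fun ⟨_, h⟩ => h.exists_isRiccatiSolution hD
  tfae_have 3 → 1 := fun ⟨_, hP⟩ => ⟨_, hD.isLinearEquilibrium_riccatiFeedback hP⟩
  tfae_have 3 → 2 := fun ⟨_, hP⟩ => hP.bvpSolvable hD
  tfae_have 2 → 3 := fun h => h.exists_isRiccatiSolution hD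
  tfae_finish
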